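/- **Setting.** Let $(\mathfrak g,\mathfrak g^*)$ be a finite-dimensional real Lie bialgebra and $\mathfrak d=\mathfrak g\oplus\mathfrak g^*$ its double: the Lie algebra in which $\mathfrak g,\mathfrak g^*$ are subalgebras and the form $\langle (X_1,f_1),(X_2,f_2)\rangle=f_1(X_2)+f_2(X_1)$ is invariant. Put $r_{\mathfrak d}=P_{\mathfrak g}-P_{\mathfrak g^*}$. Let $D$, $G$, $G^*$ be connected Lie groups with Lie algebras $\mathfrak d$, $\mathfrak g$, $\mathfrak g^*$, where the Lie bracket on the tangent space at the identity is the commutator of the vector fields $x\mapsto \frac{d}{dt}\big|_{t=0}e^{t\xi}x$. Let $G$ and $G^*$ carry their Poisson–Lie structures with tangent Lie bialgebras $(\mathfrak g,\mathfrak g^*)$ and $(\mathfrak g^*,\mathfrak g)$; here the Lie bracket on the cotangent space at the identity is $[d_e\varphi,d_e\psi]=d_e\{\varphi,\psi\}$. Suppose that the inclusions of $\mathfrak g$ and $\mathfrak g^*$ into $\mathfrak d$ integrate to homomorphisms $G\to D$, $G^*\to D$ and that $G\times G^*\to D$, $(g,u)\mapsto gu$, is injective (so $G,G^*$ are subgroups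 of $D$, and factorizations $x=gu$ are unique). For $\varphi\in C^\infty(D)$ define $X_\varphi,X'_\varphi:D\to\mathfrak d$ by $$\langle X_\varphi(x),\xi\rangle=\tfrac{d}{dt}\big|_{t=0}\varphi(e^{t\xi}x),\qquad \langle X'_\varphi(x),\xi\rangle=\tfrac{d}{dt}\big|_{t=0}\varphi(xe^{t\xi}),\qquad \xi\in\mathfrak d,$$ and put $$\{\varphi,\psi\}_+=\tfrac12\langle r_{\mathfrak d}X_\varphi,X_\psi\rangle+\tfrac12\langle r_{\mathfrak d}X'_\varphi,X'_\psi\rangle .$$ **Theorem.** (i) Suppose that $D/G^*$ is a smooth manifold (with $D\to D/G^*$ a submersion). There is exactly one Poisson structure on $D/G^*$ for which the projection from $(D,\{\,,\}_+)$ is a Poisson map (the reduced structure). The map $G\to D/G^*$, $g\mapsto gG^*$, is a diffeomorphism onto an open subset, and $G$ is a Poisson submanifold: there is exactly one Poisson structure on $G$ for which this map is Poisson. This induced bracket is minus the original Poisson–Lie bracket of $G$ (the identity map of $G$ is an anti-isomorphism). (ii) Suppose that $D/G$ is a smooth manifold (with $D\to D/G$ a submersion). There is exactly one Poisson structure on $D/G$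 for which the projection from $(D,\{\,,\}_+)$ is a Poisson map. The map $G^*\to D/G$, $u\mapsto uG$, is a diffeomorphism onto an open subset, and $G^*$ is a Poisson submanifold in the same sense. The induced bracket on $G^*$ coincides with the original Poisson–Lie bracket. In both cases the open subset is dense if the set of $x\in D$ with unique factorizations $x=gu=u'g'$ ($g,g'\in G$, $u,u'\in G^*$) is dense in $D$. -/

import Mathlib

open scoped Manifold ContDiff

noncomputable section

namespace PoissonLie

/-! ### Poisson structures on manifolds -/

section Poisson

variable {E : Type*} [NormedAddCommGroup E] [NormedSpace ℝ E]
  {M : Type*} [TopologicalSpace M] [ChartedSpace E M]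
  {F : Type*} [NormedAddCommGroup F] [NormedSpace ℝ F]
  {N : Type*} [TopologicalSpace N] [ChartedSpace F N]

variable (E M) in
/-- A Poisson structure on the manifold `M`: a Lie bracket on `C^∞(M)` that is a derivation in
each argument. -/
@[ext]
structure PoissonStructure where
  bracket : C^∞⟮𝓘(ℝ, E), M; ℝ⟯ →ₗ[ℝ] C^∞⟮𝓘(ℝ, E), M; ℝ⟯ →ₗ[ℝ] C^∞⟮𝓘(ℝ, E), M; ℝ⟯
  bracket_self : ∀ φ, bracket φ φ = 0
  leibniz : ∀ φ ψ χ, bracket φ (ψ * χ) = bracket φ ψ * χ + ψ * bracket φ χ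
  jacobi : ∀ φ ψ χ,
    bracket φ (bracket ψ χ) + bracket ψ (bracket χ φ) + bracket χ (bracket φ ψ) = 0

variable (E M) in
/-- A pair of smooth functions is sent to a function; no axioms are imposed. This is used for
brackets given by a formula. -/
abbrev RawBracket := C^∞⟮𝓘(ℝ, E), M; ℝ⟯ → C^∞⟮𝓘(ℝ, E), M; ℝ⟯ → M → ℝ

/-- The bracket of a Poisson structure, as a function-valued operation. -/
def PoissonStructure.raw (P : PoissonStructure E M) : RawBracket E M :=
  fun φ ψ x => P.bracket φ ψ x

/-- `f : M → N` is a Poisson map: it is smooth and `{φ ∘ f, ψ ∘ f}_M = {φ, ψ}_N ∘ f`. -/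
def IsPoissonMap (B : RawBracket E M) (B' : RawBracket F N) (f : M → N) : Prop :=
  ∃ hf : ContMDiff 𝓘(ℝ, E) 𝓘(ℝ, F) ∞ f, ∀ φ ψ : C^∞⟮𝓘(ℝ, F), N; ℝ⟯, ∀ x : M,
    B (φ.comp ⟨f, hf⟩) (ψ.comp ⟨f, hf⟩) x = B' φ ψ (f x)

/-- For `Φ` smooth on `M × N`, the function `x ↦ Φ (x, y)`. -/
def sliceLeft (Φ : C^∞⟮𝓘(ℝ, E).prod 𝓘(ℝ, F), M × N; ℝ⟯) (y : N) : C^∞⟮𝓘(ℝ, E), M; ℝ⟯ :=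
  Φ.comp (ContMDiffMap.id.prodMk (ContMDiffMap.const y))

/-- For `Φ` smooth on `M × N`, the function `y ↦ Φ (x, y)`. -/
def sliceRight (Φ : C^∞⟮𝓘(ℝ, E).prod 𝓘(ℝ, F), M × N; ℝ⟯) (x : M) : C^∞⟮𝓘(ℝ, F), N; ℝ⟯ :=
  Φ.comp ((ContMDiffMap.const x).prodMk ContMDiffMap.id)

/-- The bracket of the product Poisson manifold `M × N`, evaluated at the point `p`. -/
def prodBracket (P : PoissonStructure E M) (P' : PoissonStructure F N)
    (Φ Ψ : C^∞⟮𝓘(ℝ, E).prod 𝓘(ℝ, F), M × N; ℝ⟯) (p : M × N) : ℝ :=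
  P.bracket (sliceLeft Φ p.2) (sliceLeft Ψ p.2) p.1
    + P'.bracket (sliceRight Φ p.1) (sliceRight Ψ p.1) p.2

/-- `(N, P')` is an open Poisson submanifold of `(M, P)` by way of the inclusion `f`: the map `f`
is a diffeomorphism onto an open subset, and it is a Poisson map. -/
structure IsOpenPoissonSubmanifold (P' : PoissonStructure F N) (P : PoissonStructure E M)
    (f : N → M) : Prop where
  isOpenEmbedding : Topology.IsOpenEmbedding f
  isLocalDiffeomorph : IsLocalDiffeomorph 𝓘(ℝ, F) 𝓘(ℝ, E) ∞ f
  isPoissonMap : IsPoissonMap P'.raw P.raw f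

end Poisson

/-! ### Lie groups -/

section LieGroup

variable {E : Type*} [NormedAddCommGroup E] [NormedSpace ℝ E]
  {G : Type*} [TopologicalSpace G] [ChartedSpace E G] [Group G]

/-- The vector field `x ↦ d/dt|_{t=0} e^{tξ} x`. -/
def rightInvariantField (ξ : TangentSpace 𝓘(ℝ, E) (1 : G)) (x : G) :
    TangentSpace 𝓘(ℝ, E) x :=
  (mfderiv 𝓘(ℝ, E) 𝓘(ℝ, E) (fun y : G => y * x) 1 ξ : E)

/-- The bracket on the tangent space at the identity given by the commutator of the vector fields
`x ↦ d/dt|_{t=0} e^{tξ} x`. -/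
def lieBr (ξ η : TangentSpace 𝓘(ℝ, E) (1 : G)) : TangentSpace 𝓘(ℝ, E) (1 : G) :=
  VectorField.mlieBracket 𝓘(ℝ, E) (rightInvariantField ξ) (rightInvariantField η) 1

/-- The linear isomorphism `a` identifies the Lie algebra `(V, br)` with the Lie algebra
of `G`. -/
def IsLieAlgebraOf {V : Type*} [AddCommGroup V] [Module ℝ V] (br : V → V → V)
    (a : V ≃ₗ[ℝ] TangentSpace 𝓘(ℝ, E) (1 : G)) : Prop :=
  ∀ X Y : V, a (br X Y) = lieBr (a X) (a Y)

/-- The differential at the identity of a function on `G`, as a linear form on the model `V` of the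
Lie algebra. -/
def diffOne {V : Type*} [AddCommGroup V] [Module ℝ V]
    (a : V ≃ₗ[ℝ] TangentSpace 𝓘(ℝ, E) (1 : G)) (φ : G → ℝ) : Module.Dual ℝ V where
  toFun X := (mfderiv 𝓘(ℝ, E) 𝓘(ℝ, ℝ) φ 1 (a X) : ℝ)
  map_add' X Y := by rw [map_add]; exact map_add _ _ _
  map_smul' t X := by rw [map_smul]; exact map_smul _ _ _

/-- `(G, P)` is a Poisson Lie group: multiplication `G × G → G` is a Poisson map. -/
def IsPoissonLieGroup [LieGroup 𝓘(ℝ, E) ∞ G] (P : PoissonStructure E G) : Prop :=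
  ∀ φ ψ : C^∞⟮𝓘(ℝ, E), G; ℝ⟯, ∀ p : G × G,
    prodBracket P P
      (φ.comp ⟨fun q : G × G => q.1 * q.2, contMDiff_mul 𝓘(ℝ, E) ∞⟩)
      (ψ.comp ⟨fun q : G × G => q.1 * q.2, contMDiff_mul 𝓘(ℝ, E) ∞⟩) p
      = P.bracket φ ψ (p.1 * p.2)

/-- The linearization of the Poisson structure at the identity is the bracket `br` on the dual of
the Lie algebra: `d_e {φ, ψ} = [d_e φ, d_e ψ]`. -/
def HasLinearization {V : Type*} [AddCommGroup V] [Module ℝ V]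
    (a : V ≃ₗ[ℝ] TangentSpace 𝓘(ℝ, E) (1 : G))
    (br : Module.Dual ℝ V → Module.Dual ℝ V → Module.Dual ℝ V) (P : PoissonStructure E G) : Prop :=
  ∀ φ ψ : C^∞⟮𝓘(ℝ, E), G; ℝ⟯,
    diffOne a (P.bracket φ ψ) = br (diffOne a φ) (diffOne a ψ)

end LieGroup

/-! ### Lie bialgebras and their doubles -/

section Bialgebra

open Module

variable {L : Type*} [LieRing L] [LieAlgebra ℝ L]

/-- The linear form `Y ↦ f [X, Y]`. -/
def adTranspose (X : L) (f : Dual ℝ L) : Dual ℝ L := f ∘ₗ LieAlgebra.ad ℝ L X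

variable (L) in
/-- A Lie bialgebra `(L, L*)`: a Lie bracket on the dual space such that the transposed map
`L → L ∧ L` is a 1-cocycle. -/
structure LieBialgebra where
  dualBracket : Dual ℝ L →ₗ[ℝ] Dual ℝ L →ₗ[ℝ] Dual ℝ L
  dualBracket_self : ∀ f, dualBracket f f = 0
  dualBracket_jacobi : ∀ f h k, dualBracket f (dualBracket h k) + dualBracket h (dualBracket k f)
    + dualBracket k (dualBracket f h) = 0
  cocycle : ∀ (X Y : L) (f h : Dual ℝ L), dualBracket f h ⁅X, Y⁆ =
    (dualBracket (adTranspose X f) h Y + dualBracket f (adTranspose X h) Y)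
    - (dualBracket (adTranspose Y f) h X + dualBracket f (adTranspose Y h) X)

/-- The canonical symmetric form on `L ⊕ L*`. -/
def form (a b : L × Dual ℝ L) : ℝ := a.2 b.1 + b.2 a.1

/-- The operator `P_L - P_{L*}` on `L ⊕ L*`. -/
def rOp (a : L × Dual ℝ L) : L × Dual ℝ L := (a.1, -a.2)

theorem LieBialgebra.dualBracket_skew (B : LieBialgebra L) (f h : Dual ℝ L) : B.dualBracket f h = -B.dualBracket h f := by
  have h1 := B.dualBracket_self (f + h)
  simp only [map_add, LinearMap.add_apply, B.dualBracket_self] at h1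
  exact eq_neg_of_add_eq_zero_left (by simpa [add_comm] using h1)

variable [FiniteDimensional ℝ L]

/-- The element of `L ⊕ L*` that represents a linear form with respect to `form`. -/
def grad (l : Dual ℝ (L × Dual ℝ L)) : L × Dual ℝ L :=
  ((evalEquiv ℝ L).symm (l ∘ₗ LinearMap.inr ℝ L (Dual ℝ L)), l ∘ₗ LinearMap.inl ℝ L (Dual ℝ L))

theorem form_grad (l : Dual ℝ (L × Dual ℝ L)) (a : L × Dual ℝ L) : form (grad l) a = l a := by
  obtain ⟨X, f⟩ := a
  have h : f ((evalEquiv ℝ L).symm (l ∘ₗ LinearMap.inr ℝ L (Dual ℝ L))) = l (0, f) := by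
    rw [apply_evalEquiv_symm_apply]; rfl
  change l (X, 0) + f ((evalEquiv ℝ L).symm (l ∘ₗ LinearMap.inr ℝ L (Dual ℝ L))) = _
  rw [h, ← map_add]; simp

theorem form_nondegenerate {a b : L × Dual ℝ L} (h : ∀ c, form a c = form b c) : a = b := by
  refine Prod.ext ?_ ?_
  · have : ∀ f : Dual ℝ L, f (a.1 - b.1) = 0 := fun f => by
      have := h (0, f); simp [form] at this; simp [this]
    exact sub_eq_zero.mp ((forall_dual_apply_eq_zero_iff ℝ _).mp this)
  · ext X
    simpa [form] using h (X, 0)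

namespace LieBialgebra

variable (B : LieBialgebra L)

/-- For `f` in `L*` and `Y` in `L`, the element of `L` on which `h` takes the value `[h, f] Y`. -/
def coadDual (f : Dual ℝ L) (Y : L) : L :=
  (evalEquiv ℝ L).symm (Dual.eval ℝ L Y ∘ₗ B.dualBracket.flip f)

/-- The bracket of the double: the Lie bracket on `L ⊕ L*` for which `L` and `L*` are subalgebras
and the canonical form is invariant. -/
def doubleBracket (a b : L × Dual ℝ L) : L × Dual ℝ L :=
  (⁅a.1, b.1⁆ + B.coadDual a.2 b.1 - B.coadDual b.2 a.1,
    B.dualBracket a.2 b.2 - adTranspose a.1 b.2 + adTranspose b.1 a.2)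

/-- The bracket on the dual of `L*` that is the bracket of `L` under `L ≃ L**`. -/
def bidualBracket (u v : Dual ℝ (Dual ℝ L)) : Dual ℝ (Dual ℝ L) :=
  evalEquiv ℝ L ⁅(evalEquiv ℝ L).symm u, (evalEquiv ℝ L).symm v⁆

theorem apply_coadDual (f h : Dual ℝ L) (Y : L) :
    h (B.coadDual f Y) = B.dualBracket h f Y := by
  rw [coadDual, apply_evalEquiv_symm_apply]; rfl

theorem doubleBracket_inl (X Y : L) : B.doubleBracket (X, 0) (Y, 0) = (⁅X, Y⁆, 0) := by
  simp [doubleBracket, coadDual, adTranspose]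

theorem doubleBracket_inr (f h : Dual ℝ L) :
    B.doubleBracket (0, f) (0, h) = (0, B.dualBracket f h) := by
  simp [doubleBracket, coadDual, adTranspose]

theorem form_doubleBracket (a b c : L × Dual ℝ L) :
    form (B.doubleBracket a b) c = form a (B.doubleBracket b c) := by
  obtain ⟨X, f⟩ := a
  obtain ⟨Y, h⟩ := b
  obtain ⟨Z, k⟩ := c
  simp only [form, doubleBracket, map_add, map_sub, apply_coadDual, LinearMap.add_apply,
    LinearMap.sub_apply, adTranspose, LinearMap.comp_apply]
  simp only [LieAlgebra.ad_apply]
  rw [B.dualBracket_skew k f, B.dualBracket_skew k h, ← lie_skew X Y, ← lie_skew X Z]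
  simp only [LinearMap.neg_apply, map_neg]
  ring

/-- There is only one bracket on `L ⊕ L*` as in `doubleBracket`. -/
theorem doubleBracket_unique
    (br : (L × Dual ℝ L) →ₗ[ℝ] (L × Dual ℝ L) →ₗ[ℝ] (L × Dual ℝ L))
    (hskew : ∀ a b, br a b = -br b a)
    (hL : ∀ X Y : L, br (X, 0) (Y, 0) = (⁅X, Y⁆, 0))
    (hL' : ∀ f h : Dual ℝ L, br (0, f) (0, h) = (0, B.dualBracket f h))
    (hinv : ∀ a b c, form (br a b) c = form a (br b c)) (a b : L × Dual ℝ L) :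
    br a b = B.doubleBracket a b := by
  have key : ∀ (X : L) (f : Dual ℝ L), br (X, 0) (0, f) = B.doubleBracket (X, 0) (0, f) := by
    intro X f
    have h1 : ∀ Z : L, (br (X, 0) (0, f)).2 Z = -f ⁅X, Z⁆ := fun Z => by
      have := hinv (0, f) (X, 0) (Z, 0)
      rw [hskew, hL] at this
      simp only [form, Prod.snd_neg, Prod.fst_neg, LinearMap.neg_apply] at this
      simp at this
      linarith
    have h2 : ∀ k : Dual ℝ L, k (br (X, 0) (0, f)).1 = B.dualBracket f k X := fun k => by
      have := hinv (X, 0) (0, f) (0, k)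
      rw [hL'] at this
      simpa [form] using this
    refine form_nondegenerate fun c => ?_
    obtain ⟨Z, k⟩ := c
    have e1 : form (br (X, 0) (0, f)) (Z, k) = -f ⁅X, Z⁆ + B.dualBracket f k X := by
      rw [← h1, ← h2]; rfl
    rw [e1]
    simp only [form, doubleBracket, map_add, map_sub, apply_coadDual, LinearMap.add_apply,
      LinearMap.sub_apply, adTranspose, LinearMap.comp_apply]
    simp only [LieAlgebra.ad_apply]
    rw [B.dualBracket_skew k f]
    simp
  obtain ⟨X, f⟩ := a
  obtain ⟨Y, h⟩ := b
  have e : ∀ (X : L) (f : Dual ℝ L), ((X, f) : L × Dual ℝ L) = (X, 0) + (0, f) := by simp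
  rw [e X f, e Y h, map_add, map_add, LinearMap.add_apply, LinearMap.add_apply, hL, hL', key,
    hskew (0, f), key]
  ext <;> simp [doubleBracket, coadDual, adTranspose] <;> abel

end LieBialgebra

end Bialgebra

/-! ### The bracket `{ , }₊` on the double -/

section Double

open Module

variable {L : Type*} [LieRing L] [LieAlgebra ℝ L] [FiniteDimensional ℝ L]
  {E : Type*} [NormedAddCommGroup E] [NormedSpace ℝ E]
  {D : Type*} [TopologicalSpace D] [ChartedSpace E D] [Group D]

/-- The left gradient: `⟨X_φ(x), ξ⟩ = d/dt|_{t=0} φ(e^{tξ} x)`. -/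
def leftGrad (c : (L × Dual ℝ L) ≃ₗ[ℝ] TangentSpace 𝓘(ℝ, E) (1 : D)) (φ : D → ℝ) (x : D) :
    L × Dual ℝ L :=
  grad (diffOne c (fun y => φ (y * x)))

/-- The right gradient: `⟨X'_φ(x), ξ⟩ = d/dt|_{t=0} φ(x e^{tξ})`. -/
def rightGrad (c : (L × Dual ℝ L) ≃ₗ[ℝ] TangentSpace 𝓘(ℝ, E) (1 : D)) (φ : D → ℝ) (x : D) :
    L × Dual ℝ L :=
  grad (diffOne c (fun y => φ (x * y)))

/-- `{φ, ψ}₊ = ½⟨r X_φ, X_ψ⟩ + ½⟨r X'_φ, X'_ψ⟩`. -/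
def plusBracket (c : (L × Dual ℝ L) ≃ₗ[ℝ] TangentSpace 𝓘(ℝ, E) (1 : D)) : RawBracket E D :=
  fun φ ψ x => (1 / 2 : ℝ) * form (rOp (leftGrad c φ x)) (leftGrad c ψ x)
    + (1 / 2 : ℝ) * form (rOp (rightGrad c φ x)) (rightGrad c ψ x)

/-- The reduced Poisson structure on `D ⧸ H`: the projection from `D`, with the bracket
`{ , }₊`, is a Poisson map. -/
def IsReducedStructure (c : (L × Dual ℝ L) ≃ₗ[ℝ] TangentSpace 𝓘(ℝ, E) (1 : D))
    {H : Subgroup D} {F : Type*} [NormedAddCommGroup F] [NormedSpace ℝ F]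
    [ChartedSpace F (D ⧸ H)] (P : PoissonStructure F (D ⧸ H)) : Prop :=
  IsPoissonMap (plusBracket c) P.raw (QuotientGroup.mk : D → D ⧸ H)

/-- The elements of `D` with unique factorizations `x = g u = u' g'`, where `g`, `g'` are in `G`
and `u`, `u'` are in `K`. -/
def factorizable {G K : Type*} [Group G] [Group K] (i : G →* D) (j : K →* D) : Set D :=
  {x | (∃! p : G × K, x = i p.1 * j p.2) ∧ ∃! p : G × K, x = j p.2 * i p.1}

end Double

end PoissonLie

end

/-!
Both quotients are treated at once, for a Manin triple `(V₁ ⊕ V₂, V₁, V₂)` that is realized by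
connected Lie groups `D`, `G`, `K` with homomorphisms `i : G →* D`, `j : K →* D`; the second
quotient is the first one for the triple with the summands exchanged, and the sign in the theorem
is the sign `ε` in `{ , }₊ = ε β` below.

*The reduced structure.* A function on `D ⧸ K` pulls back to a function on `D` whose left
differential at each point vanishes on `V₂`, hence is represented by an isotropic element
`(0, f)`. The canonical form is invariant under the adjoint action (`ManinTriple.bilin_adjointOn`), so
the right differential is represented by `Ad_x (0, f)`, and these elements are mutually
orthogonal. Therefore the half of `{ , }₊` made of left differentials vanishes on such functions,
and the other half equals, up to the sign `ε`, the operation `β(Φ, Ψ) = ∑ k, ρ(f k) Φ * ρ(e k) Ψ`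
(`ManinTriple.biDer`), where `ρ` is the infinitesimal action of the double on `D ⧸ K` and `e`, `f`
are dual bases of `V₁`, `V₂`. By the same orthogonality `β` is skew-symmetric, and then its Jacobi
identity is a computation with structure constants (`jacobi_of_structure_constants`). Uniqueness
holds because the projection is onto.

*The open embedding.* The differential of `(g, u) ↦ i g * j u` is invertible everywhere, so this
map has smooth local inverses; composed with local sections of the projection they give smooth
local inverses of `g ↦ i g K` (`exists_local_section_mk_comp`).

*Comparison with the Poisson Lie structure.* The bracket `β` restricted to `G` is
`⟨(Ad_g (0, f))₁, (Ad_g (0, h))₂⟩` in terms of the left differentials `f`, `h`. It is multiplicative, and its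
linearization at the identity is minus the bracket of `V₂`
(`ManinTriple.dressingBracket_multiplicative`, `ManinTriple.mder_dressingBracket_one`). A
multiplicative biderivation on a connected group with zero linearization vanishes
(`multiplicative_biderivation_eq_zero`), so the Poisson Lie bracket is `-β` on `G`, and the
induced bracket is `-ε` times the Poisson Lie bracket. It is the only one for which the embedding
is Poisson, because the functions on the quotient realize all differentials on `G`.
-/

open scoped Manifold ContDiff

noncomputable section

namespace PoissonLie

open Filter Topology

/-! ### Differentials of maps between manifolds -/

section Derivative

variable {E : Type*} [NormedAddCommGroup E] [NormedSpace ℝ E]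
  {M : Type*} [TopologicalSpace M] [ChartedSpace E M]
  {F : Type*} [NormedAddCommGroup F] [NormedSpace ℝ F]
  {N : Type*} [TopologicalSpace N] [ChartedSpace F N]
  {F' : Type*} [NormedAddCommGroup F'] [NormedSpace ℝ F']
  {P : Type*} [TopologicalSpace P] [ChartedSpace F' P]

/-- The differential of a map between manifolds, as a continuous linear map between the model
spaces. Unlike in `mfderiv`, the type does not mention the base points. -/
def mder (E : Type*) [NormedAddCommGroup E] [NormedSpace ℝ E] {M : Type*} [TopologicalSpace M]
    [ChartedSpace E M] (F : Type*) [NormedAddCommGroup F] [NormedSpace ℝ F] {N : Type*}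
    [TopologicalSpace N] [ChartedSpace F N] (f : M → N) (x : M) : E →L[ℝ] F :=
  mfderiv 𝓘(ℝ, E) 𝓘(ℝ, F) f x

theorem mder_comp {g : N → P} {f : M → N} {x : M}
    (hg : MDifferentiableAt 𝓘(ℝ, F) 𝓘(ℝ, F') g (f x))
    (hf : MDifferentiableAt 𝓘(ℝ, E) 𝓘(ℝ, F) f x) (v : E) :
    mder E F' (g ∘ f) x v = mder F F' g (f x) (mder E F f x v) :=
  mfderiv_comp_apply x hg hf v

theorem mder_id (x : M) (v : E) : mder E E (fun y : M => y) x v = v :=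
  congrArg (fun T : E →L[ℝ] E => T v) (mfderiv_id (I := 𝓘(ℝ, E)) (x := x))

theorem mder_const (x : M) (y : N) : mder E F (fun _ : M => y) x = 0 :=
  mfderiv_const

theorem mder_congr {f g : M → N} {x : M} (h : f =ᶠ[𝓝 x] g) : mder E F f x = mder E F g x :=
  h.mfderiv_eq

theorem mder_eq_fderiv (f : E → F) (x : E) : mder E F f x = fderiv ℝ f x :=
  mfderiv_eq_fderiv

theorem mder_comp₂ {f : M × N → P} {Q' : Type*} [NormedAddCommGroup Q'] [NormedSpace ℝ Q']
    {Q : Type*} [TopologicalSpace Q] [ChartedSpace Q' Q] {g : Q → M} {h : Q → N} {q : Q}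
    (hf : MDifferentiableAt (𝓘(ℝ, E).prod 𝓘(ℝ, F)) 𝓘(ℝ, F') f (g q, h q))
    (hg : MDifferentiableAt 𝓘(ℝ, Q') 𝓘(ℝ, E) g q)
    (hh : MDifferentiableAt 𝓘(ℝ, Q') 𝓘(ℝ, F) h q) (v : Q') :
    mder Q' F' (fun q => f (g q, h q)) q v
      = mder E F' (fun x => f (x, h q)) (g q) (mder Q' E g q v)
        + mder F F' (fun y => f (g q, y)) (h q) (mder Q' F h q v) := by
  have h1 : mder Q' F' (fun q => f (g q, h q)) q v
      = mfderiv (𝓘(ℝ, E).prod 𝓘(ℝ, F)) 𝓘(ℝ, F') f (g q, h q)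
        (mfderiv 𝓘(ℝ, Q') (𝓘(ℝ, E).prod 𝓘(ℝ, F)) (fun q => (g q, h q)) q v) :=
    mfderiv_comp_apply q hf (hg.prodMk hh) v
  have h2 : (mfderiv 𝓘(ℝ, Q') (𝓘(ℝ, E).prod 𝓘(ℝ, F)) (fun q => (g q, h q)) q v : E × F)
      = (mder Q' E g q v, mder Q' F h q v) := by
    rw [(hg.hasMFDerivAt.prodMk hh.hasMFDerivAt).mfderiv]
    rfl
  rw [h1]
  refine (mfderiv_prod_eq_add_apply hf).trans ?_
  change mder E F' _ _ (_ : E × F).1 + mder F F' _ _ (_ : E × F).2 = _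
  rw [h2]

variable {φ ψ : M → ℝ} {x : M}

theorem mder_add (hφ : MDifferentiableAt 𝓘(ℝ, E) 𝓘(ℝ, ℝ) φ x)
    (hψ : MDifferentiableAt 𝓘(ℝ, E) 𝓘(ℝ, ℝ) ψ x) :
    mder E ℝ (φ + ψ) x = mder E ℝ φ x + mder E ℝ ψ x :=
  mfderiv_add hφ hψ

theorem mder_smul (hφ : MDifferentiableAt 𝓘(ℝ, E) 𝓘(ℝ, ℝ) φ x) (t : ℝ) :
    mder E ℝ (t • φ) x = t • mder E ℝ φ x :=
  const_smul_mfderiv hφ t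

theorem mder_mul (hφ : MDifferentiableAt 𝓘(ℝ, E) 𝓘(ℝ, ℝ) φ x)
    (hψ : MDifferentiableAt 𝓘(ℝ, E) 𝓘(ℝ, ℝ) ψ x) (v : E) :
    mder E ℝ (φ * ψ) x v = mder E ℝ φ x v * ψ x + φ x * mder E ℝ ψ x v := by
  have := (hφ.hasMFDerivAt.mul hψ.hasMFDerivAt).mfderiv
  have h2 : mder E ℝ (φ * ψ) x v = φ x * mder E ℝ ψ x v + ψ x * mder E ℝ φ x v :=
    congrArg (fun T : E →L[ℝ] ℝ => T v) this
  rw [h2]; ring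

end Derivative

section Smooth

theorem two_le_infty : (2 : ℕ∞ω) ≤ ∞ :=
  WithTop.coe_le_coe.2 (le_top : (2 : ℕ∞) ≤ ⊤)

variable {E : Type*} [NormedAddCommGroup E] [NormedSpace ℝ E]
  {M : Type*} [TopologicalSpace M] [ChartedSpace E M]
  {F : Type*} [NormedAddCommGroup F] [NormedSpace ℝ F]
  {N : Type*} [TopologicalSpace N] [ChartedSpace F N]

theorem smooth_mdiffAt {f : M → N} (hf : ContMDiff 𝓘(ℝ, E) 𝓘(ℝ, F) ∞ f) (x : M) :
    MDifferentiableAt 𝓘(ℝ, E) 𝓘(ℝ, F) f x :=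
  hf.contMDiffAt.mdifferentiableAt (by simp)

/-- The derivative in the second variable, in a fixed direction at a fixed point, depends smoothly
on the first variable. -/
theorem contMDiff_mder_right [IsManifold 𝓘(ℝ, E) ∞ M] [IsManifold 𝓘(ℝ, F) ∞ N]
    {f : M × N → ℝ} (hf : ContMDiff (𝓘(ℝ, E).prod 𝓘(ℝ, F)) 𝓘(ℝ, ℝ) ∞ f) (y : N) (v : F) :
    ContMDiff 𝓘(ℝ, E) 𝓘(ℝ, ℝ) ∞ (fun x => mder F ℝ (fun y => f (x, y)) y v) := by
  intro x₀
  have h := ContMDiffAt.mfderiv_apply (I := 𝓘(ℝ, F)) (I' := 𝓘(ℝ, ℝ)) (J := 𝓘(ℝ, E))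
    (J' := 𝓘(ℝ, E)) (n := ∞) (m := ∞)
    (fun (x : M) (y : N) => f (x, y)) (fun _ => y) (id : M → M) (fun _ => v) (x₀ := x₀)
    hf.contMDiffAt contMDiffAt_const contMDiffAt_id contMDiffAt_const (by simp)
  refine h.congr_of_eventuallyEq (Eventually.of_forall fun x => ?_)
  have e := inTangentCoordinates_eq (I := 𝓘(ℝ, F)) (I' := 𝓘(ℝ, ℝ)) (fun _ : M => y)
    (fun x => f (x, y)) (fun x => mder F ℝ (fun y => f (x, y)) y) (x₀ := x₀) (x := x)
    (mem_chart_source _ _) (by rw [chartAt_self_eq]; trivial)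
  refine Eq.trans ?_ (congrArg (fun T : F →L[ℝ] ℝ => T v) e).symm
  have h1 : (tangentBundleCore 𝓘(ℝ, F) N).coordChange (achart F y) (achart F y) y v = v :=
    tangentCoordChange_self (mem_extChartAt_source y)
  have h2 := TangentBundle.coordChange_model_space (𝕜 := ℝ) (F := ℝ) (f (x, y)) (f (x₀, y))
    (f (x, y))
  change _ = (tangentBundleCore 𝓘(ℝ, ℝ) ℝ).coordChange _ _ _ (mder F ℝ (fun y => f (x, y)) y
    ((tangentBundleCore 𝓘(ℝ, F) N).coordChange (achart F y) (achart F y) y v))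
  rw [h1, h2]
  rfl

theorem mder_eq_fderiv_chart {f : M → ℝ} {x : M} (hf : MDifferentiableAt 𝓘(ℝ, E) 𝓘(ℝ, ℝ) f x) :
    mder E ℝ f x = fderiv ℝ (f ∘ (extChartAt 𝓘(ℝ, E) x).symm) (extChartAt 𝓘(ℝ, E) x x) := by
  have h := hf.mfderiv
  rw [mder, h]
  simp [writtenInExtChartAt]
  rfl

theorem mder_extChartAt_self [IsManifold 𝓘(ℝ, E) ∞ M] (x : M) :
    mder E E (extChartAt 𝓘(ℝ, E) x) x = ContinuousLinearMap.id ℝ E := by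
  have : IsManifold 𝓘(ℝ, E) 1 M := .of_le (n := ∞) (mod_cast le_top)
  ext v
  have h1 := mfderiv_chartAt_eq_tangentCoordChange (I := 𝓘(ℝ, E)) (x := x) (y := x)
    (mem_chart_source E x)
  exact (congrArg (fun S : E →L[ℝ] E => S v) h1).trans
    (tangentCoordChange_self (mem_extChartAt_source x))

theorem contDiffAt_comp_chart_symm {f : M → ℝ} {n : ℕ∞ω} {x : M}
    [IsManifold 𝓘(ℝ, E) n M] (hf : ContMDiff 𝓘(ℝ, E) 𝓘(ℝ, ℝ) n f) {z : E}
    (hz : z ∈ (extChartAt 𝓘(ℝ, E) x).target) :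
    ContDiffAt ℝ n (f ∘ (extChartAt 𝓘(ℝ, E) x).symm) z := by
  rw [← contMDiffAt_iff_contDiffAt]
  exact hf.contMDiffAt.comp z ((contMDiffOn_extChartAt_symm x).contMDiffAt
    ((isOpen_extChartAt_target x).mem_nhds hz))

/-- Mixed partial derivatives of a function on a product manifold commute. -/
theorem mder_mder_comm [IsManifold 𝓘(ℝ, E) ∞ M] [IsManifold 𝓘(ℝ, F) ∞ N]
    {f : M × N → ℝ} (hf : ContMDiff (𝓘(ℝ, E).prod 𝓘(ℝ, F)) 𝓘(ℝ, ℝ) ∞ f) (x : M) (y : N)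
    (u : E) (v : F) :
    mder E ℝ (fun x => mder F ℝ (fun y => f (x, y)) y v) x u
      = mder F ℝ (fun y => mder E ℝ (fun x => f (x, y)) x u) y v := by
  set χ := extChartAt 𝓘(ℝ, E) x
  set η := extChartAt 𝓘(ℝ, F) y
  have hf' : ContMDiff (𝓘(ℝ, F).prod 𝓘(ℝ, E)) 𝓘(ℝ, ℝ) ∞ (fun p : N × M => f (p.2, p.1)) :=
    hf.comp (contMDiff_snd.prodMk contMDiff_fst)
  have hx : ∀ y, ContMDiff 𝓘(ℝ, E) 𝓘(ℝ, ℝ) ∞ (fun x => f (x, y)) := fun y =>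
    hf.comp (contMDiff_id.prodMk contMDiff_const)
  have hy : ∀ x, ContMDiff 𝓘(ℝ, F) 𝓘(ℝ, ℝ) ∞ (fun y => f (x, y)) := fun x =>
    hf.comp (contMDiff_const.prodMk contMDiff_id)
  have h1 := smooth_mdiffAt (contMDiff_mder_right hf y v) x
  have h2 := smooth_mdiffAt (contMDiff_mder_right hf' x u) y
  rw [mder_eq_fderiv_chart h1, mder_eq_fderiv_chart h2]
  set g : E × F → ℝ := fun p => f (χ.symm p.1, η.symm p.2) with hg
  have hgs : ContDiffAt ℝ ∞ g (χ x, η y) := by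
    rw [← contMDiffAt_iff_contDiffAt]
    refine hf.contMDiffAt.comp (χ x, η y) ?_
    have hχ : ContMDiffAt 𝓘(ℝ, E) 𝓘(ℝ, E) ∞ χ.symm (χ x) :=
      (contMDiffOn_extChartAt_symm x).contMDiffAt (extChartAt_target_mem_nhds x)
    have hη : ContMDiffAt 𝓘(ℝ, F) 𝓘(ℝ, F) ∞ η.symm (η y) :=
      (contMDiffOn_extChartAt_symm y).contMDiffAt (extChartAt_target_mem_nhds y)
    rw [← modelWithCornersSelf_prod, ← chartedSpaceSelf_prod]
    exact (hχ.comp (χ x, η y) contMDiffAt_fst).prodMk (hη.comp (χ x, η y) contMDiffAt_snd)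
  have hd : ∀ᶠ p in 𝓝 (χ x, η y), DifferentiableAt ℝ g p :=
    ((hgs.of_le (m := 1) (mod_cast le_top)).eventually (by simp)).mono fun p hp =>
      hp.differentiableAt (by simp)
  have hd2 : DifferentiableAt ℝ (fderiv ℝ g) (χ x, η y) :=
    (hgs.fderiv_right (m := 1) (by norm_cast)).differentiableAt (by simp)
  have e1 : (fun x => mder F ℝ (fun y => f (x, y)) y v) ∘ χ.symm
      =ᶠ[𝓝 (χ x)] fun a => fderiv ℝ g (a, η y) (0, v) := by
    have : Tendsto (fun a : E => (a, η y)) (𝓝 (χ x)) (𝓝 (χ x, η y)) :=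
      (Continuous.prodMk_left (η y)).continuousAt
    filter_upwards [this.eventually hd] with a ha
    rw [Function.comp_apply, mder_eq_fderiv_chart (smooth_mdiffAt (hy _) _)]
    have := (ha.hasFDerivAt.comp (η y) (hasFDerivAt_prodMk_right a (η y))).fderiv
    exact congrArg (fun T : F →L[ℝ] ℝ => T v) this
  have e2 : (fun y => mder E ℝ (fun x => f (x, y)) x u) ∘ η.symm
      =ᶠ[𝓝 (η y)] fun b => fderiv ℝ g (χ x, b) (u, 0) := by
    have : Tendsto (fun b : F => (χ x, b)) (𝓝 (η y)) (𝓝 (χ x, η y)) :=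
      (Continuous.prodMk_right (χ x)).continuousAt
    filter_upwards [this.eventually hd] with b hb
    rw [Function.comp_apply, mder_eq_fderiv_chart (smooth_mdiffAt (hx _) _)]
    have := (HasFDerivAt.comp (g := g) (f := fun a => (a, b)) (χ x) hb.hasFDerivAt
      (hasFDerivAt_prodMk_left (χ x) b)).fderiv
    exact congrArg (fun T : E →L[ℝ] ℝ => T u) this
  have k1 : HasFDerivAt (fun a => fderiv ℝ g (a, η y) (0, v)) _ (χ x) :=
    (hd2.hasFDerivAt.comp (χ x) (hasFDerivAt_prodMk_left (χ x) (η y))).clm_apply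
      (hasFDerivAt_const (0, v) (χ x))
  have k2 : HasFDerivAt (fun b => fderiv ℝ g (χ x, b) (u, 0)) _ (η y) :=
    (hd2.hasFDerivAt.comp (η y) (hasFDerivAt_prodMk_right (χ x) (η y))).clm_apply
      (hasFDerivAt_const (u, 0) (η y))
  have hsymm : IsSymmSndFDerivAt ℝ g (χ x, η y) :=
    hgs.isSymmSndFDerivAt (by simpa using two_le_infty)
  rw [e1.fderiv_eq, e2.fderiv_eq, k1.fderiv, k2.fderiv]
  simpa using hsymm (u, 0) (0, v)

/-- A function with vanishing differential on a connected manifold is constant. -/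
theorem eq_of_mder_eq_zero [IsManifold 𝓘(ℝ, E) ∞ M] [PreconnectedSpace M] {f : M → ℝ}
    (hf : ∀ x, MDifferentiableAt 𝓘(ℝ, E) 𝓘(ℝ, ℝ) f x) (h : ∀ x v, mder E ℝ f x v = 0) (x y : M) :
    f x = f y := by
  refine IsLocallyConstant.apply_eq_of_preconnectedSpace ?_ x y
  rw [IsLocallyConstant.iff_eventually_eq]
  intro x
  set χ := extChartAt 𝓘(ℝ, E) x
  obtain ⟨r, hr, hball⟩ := Metric.mem_nhds_iff.1 (extChartAt_target_mem_nhds (I := 𝓘(ℝ, E)) x)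
  have hd : ∀ z ∈ Metric.ball (χ x) r, HasFDerivAt (f ∘ χ.symm) (0 : E →L[ℝ] ℝ) z := by
    intro z hz
    have hz' := hball hz
    have hs : MDifferentiableAt 𝓘(ℝ, E) 𝓘(ℝ, E) χ.symm z :=
      ((contMDiffOn_extChartAt_symm (n := ∞) x).contMDiffAt
        ((isOpen_extChartAt_target x).mem_nhds hz')).mdifferentiableAt (by simp)
    have h1 : DifferentiableAt ℝ (f ∘ χ.symm) z :=
      mdifferentiableAt_iff_differentiableAt.1 (MDifferentiableAt.comp z (hf _) hs)
    have h2 : fderiv ℝ (f ∘ χ.symm) z = 0 := by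
      ext v
      rw [← mder_eq_fderiv]
      rw [mder_comp (hf _) hs, h]
      rfl
    rw [← h2]
    exact h1.hasFDerivAt
  have hc : ∀ z ∈ Metric.ball (χ x) r, (f ∘ χ.symm) z = (f ∘ χ.symm) (χ x) := fun z hz =>
    (convex_ball (χ x) r).is_const_of_fderivWithin_eq_zero (𝕜 := ℝ)
      (fun w hw => (hd w hw).differentiableAt.differentiableWithinAt)
      (fun w hw => by
        rw [fderivWithin_of_isOpen Metric.isOpen_ball hw, (hd w hw).fderiv]) hz
      (Metric.mem_ball_self hr)
  filter_upwards [(continuousAt_extChartAt (I := 𝓘(ℝ, E)) x).preimage_mem_nhds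
    (Metric.ball_mem_nhds (χ x) hr), extChartAt_source_mem_nhds (I := 𝓘(ℝ, E)) x] with y hy hy'
  have := hc (χ y) hy
  rwa [Function.comp_apply, Function.comp_apply, (extChartAt 𝓘(ℝ, E) x).left_inv hy',
    extChartAt_to_inv] at this

end Smooth

/-! ### Commutators of vector fields as commutators of derivations -/

section LieBracket

variable {E : Type*} [NormedAddCommGroup E] [NormedSpace ℝ E]
  {M : Type*} [TopologicalSpace M] [ChartedSpace E M] [IsManifold 𝓘(ℝ, E) ∞ M]

/-- Derivatives of a function along a vector field may be computed in a chart. -/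
theorem fderiv_comp_chart_symm {h : M → ℝ} {x : M} {z : E}
    (hz : z ∈ (extChartAt 𝓘(ℝ, E) x).target)
    (hh : MDifferentiableAt 𝓘(ℝ, E) 𝓘(ℝ, ℝ) h ((extChartAt 𝓘(ℝ, E) x).symm z))
    (V : Π y : M, TangentSpace 𝓘(ℝ, E) y) :
    fderiv ℝ (h ∘ (extChartAt 𝓘(ℝ, E) x).symm) z
      (VectorField.mpullbackWithin 𝓘(ℝ, E) 𝓘(ℝ, E) (extChartAt 𝓘(ℝ, E) x).symm V (Set.range 𝓘(ℝ, E)) z)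
      = mder E ℝ h ((extChartAt 𝓘(ℝ, E) x).symm z) (V ((extChartAt 𝓘(ℝ, E) x).symm z)) := by
  have : IsManifold 𝓘(ℝ, E) 1 M := .of_le (n := ∞) (mod_cast le_top)
  have hs : MDifferentiableAt 𝓘(ℝ, E) 𝓘(ℝ, E) (extChartAt 𝓘(ℝ, E) x).symm z :=
    ((contMDiffOn_extChartAt_symm (n := ∞) x).contMDiffAt
      ((isOpen_extChartAt_target x).mem_nhds hz)).mdifferentiableAt (by simp)
  have hi := isInvertible_mfderivWithin_extChartAt_symm (I := 𝓘(ℝ, E)) hz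
  rw [← mder_eq_fderiv]
  refine (mder_comp hh hs _).trans ?_
  congr 1
  have h1 : mfderivWithin 𝓘(ℝ, E) 𝓘(ℝ, E) (extChartAt 𝓘(ℝ, E) x).symm (Set.range 𝓘(ℝ, E)) z
      = mfderiv 𝓘(ℝ, E) 𝓘(ℝ, E) (extChartAt 𝓘(ℝ, E) x).symm z := by
    have hr : Set.range 𝓘(ℝ, E) = Set.univ := by simp
    rw [hr, mfderivWithin_univ]
  rw [h1] at hi
  change mfderiv 𝓘(ℝ, E) 𝓘(ℝ, E) (extChartAt 𝓘(ℝ, E) x).symm z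
    ((mfderivWithin 𝓘(ℝ, E) 𝓘(ℝ, E) (extChartAt 𝓘(ℝ, E) x).symm (Set.range 𝓘(ℝ, E)) z).inverse
    (V ((extChartAt 𝓘(ℝ, E) x).symm z))) = _
  rw [h1]
  exact hi.self_apply_inverse _

/-- The bracket of vector fields, acting on functions, is the commutator. -/
theorem mder_mlieBracket [CompleteSpace E] {V W : Π y : M, TangentSpace 𝓘(ℝ, E) y} {x : M}
    (hV : MDifferentiableAt 𝓘(ℝ, E) 𝓘(ℝ, E).tangent (fun y => (V y : TangentBundle 𝓘(ℝ, E) M)) x)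
    (hW : MDifferentiableAt 𝓘(ℝ, E) 𝓘(ℝ, E).tangent (fun y => (W y : TangentBundle 𝓘(ℝ, E) M)) x)
    {h : M → ℝ} (hh : ContMDiff 𝓘(ℝ, E) 𝓘(ℝ, ℝ) ∞ h)
    (hVh : MDifferentiableAt 𝓘(ℝ, E) 𝓘(ℝ, ℝ) (fun y => mder E ℝ h y (V y)) x)
    (hWh : MDifferentiableAt 𝓘(ℝ, E) 𝓘(ℝ, ℝ) (fun y => mder E ℝ h y (W y)) x) :
    mder E ℝ h x (VectorField.mlieBracket 𝓘(ℝ, E) V W x)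
      = mder E ℝ (fun y => mder E ℝ h y (W y)) x (V x)
        - mder E ℝ (fun y => mder E ℝ h y (V y)) x (W x) := by
  have i1 : IsManifold 𝓘(ℝ, E) 1 M := .of_le (n := ∞) (mod_cast le_top)
  have i2 : IsManifold 𝓘(ℝ, E) 2 M :=
    .of_le (n := ∞) two_le_infty
  set χ := extChartAt 𝓘(ℝ, E) x with hχ
  set V' : E → E := VectorField.mpullbackWithin 𝓘(ℝ, E) 𝓘(ℝ, E) χ.symm V (Set.range 𝓘(ℝ, E)) with hV'
  set W' : E → E := VectorField.mpullbackWithin 𝓘(ℝ, E) 𝓘(ℝ, E) χ.symm W (Set.range 𝓘(ℝ, E)) with hW'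
  have hmem : χ x ∈ χ.target := mem_extChartAt_target x
  have hx : χ.symm (χ x) = x := extChartAt_to_inv x
  have hset : χ.symm ⁻¹' Set.univ ∩ Set.range 𝓘(ℝ, E) = Set.univ := by simp
  have dV : DifferentiableAt ℝ V' (χ x) := by
    have := MDifferentiableWithinAt.differentiableWithinAt_mpullbackWithin_vectorField
      (s := Set.univ) (hV.mdifferentiableWithinAt)
    rw [hset] at this
    exact differentiableWithinAt_univ.1 this
  have dW : DifferentiableAt ℝ W' (χ x) := by
    have := MDifferentiableWithinAt.differentiableWithinAt_mpullbackWithin_vectorField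
      (s := Set.univ) (hW.mdifferentiableWithinAt)
    rw [hset] at this
    exact differentiableWithinAt_univ.1 this
  set g := h ∘ χ.symm with hg
  have hgs : ContDiffAt ℝ ∞ g (χ x) := contDiffAt_comp_chart_symm hh hmem
  have hd2 : DifferentiableAt ℝ (fderiv ℝ g) (χ x) :=
    (hgs.fderiv_right (m := 1) (by norm_cast)).differentiableAt (by simp)
  have hsymm : IsSymmSndFDerivAt ℝ g (χ x) :=
    hgs.isSymmSndFDerivAt (by simpa using two_le_infty)
  have key : ∀ U : Π y : M, TangentSpace 𝓘(ℝ, E) y, ∀ z ∈ χ.target,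
      fderiv ℝ g z (VectorField.mpullbackWithin 𝓘(ℝ, E) 𝓘(ℝ, E) χ.symm U (Set.range 𝓘(ℝ, E)) z)
        = ((fun y => mder E ℝ h y (U y)) ∘ χ.symm) z :=
    fun U z hz => fderiv_comp_chart_symm hz (smooth_mdiffAt hh _) U
  have htar : χ.target ∈ 𝓝 (χ x) := extChartAt_target_mem_nhds x
  -- the derivative of `U h` along `V`, computed in the chart
  have step : ∀ (U T : Π y : M, TangentSpace 𝓘(ℝ, E) y) (_ : DifferentiableAt ℝ
      (VectorField.mpullbackWithin 𝓘(ℝ, E) 𝓘(ℝ, E) χ.symm U (Set.range 𝓘(ℝ, E)) : E → E) (χ x))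
      (_ : MDifferentiableAt 𝓘(ℝ, E) 𝓘(ℝ, ℝ) (fun y => mder E ℝ h y (U y)) x),
      mder E ℝ (fun y => mder E ℝ h y (U y)) x (T x)
        = fderiv ℝ g (χ x) (fderiv ℝ (VectorField.mpullbackWithin 𝓘(ℝ, E) 𝓘(ℝ, E) χ.symm U
            (Set.range 𝓘(ℝ, E)) : E → E) (χ x)
            (VectorField.mpullbackWithin 𝓘(ℝ, E) 𝓘(ℝ, E) χ.symm T (Set.range 𝓘(ℝ, E)) (χ x)))
          + fderiv ℝ (fderiv ℝ g) (χ x)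
              (VectorField.mpullbackWithin 𝓘(ℝ, E) 𝓘(ℝ, E) χ.symm T (Set.range 𝓘(ℝ, E)) (χ x))
              (VectorField.mpullbackWithin 𝓘(ℝ, E) 𝓘(ℝ, E) χ.symm U (Set.range 𝓘(ℝ, E)) (χ x)) := by
    intro U T hU hUh
    have e1 : mder E ℝ (fun y => mder E ℝ h y (U y)) x (T x)
        = mder E ℝ (fun y => mder E ℝ h y (U y)) (χ.symm (χ x)) (T (χ.symm (χ x))) := by
      rw [hx]
    rw [e1, ← fderiv_comp_chart_symm hmem (by rwa [hx]) T]
    have e2 : (fun y => mder E ℝ h y (U y)) ∘ χ.symm =ᶠ[𝓝 (χ x)]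
        fun z => fderiv ℝ g z
          (VectorField.mpullbackWithin 𝓘(ℝ, E) 𝓘(ℝ, E) χ.symm U (Set.range 𝓘(ℝ, E)) z) := by
      filter_upwards [htar] with z hz using (key U z hz).symm
    rw [e2.fderiv_eq]
    have := (hd2.hasFDerivAt.clm_apply hU.hasFDerivAt).fderiv
    exact congrArg (fun S : E →L[ℝ] ℝ => S _) this
  have e0 : (VectorField.mlieBracket 𝓘(ℝ, E) V W x : E)
      = fderiv ℝ W' (χ x) (V' (χ x)) - fderiv ℝ V' (χ x) (W' (χ x)) := by
    have h1 : (VectorField.mlieBracket 𝓘(ℝ, E) V W x : E)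
        = (mder E E χ x).inverse
          (VectorField.lieBracketWithin (E := E) ℝ V' W' (χ.symm ⁻¹' Set.univ ∩ Set.range 𝓘(ℝ, E)) (χ x)) := rfl
    rw [h1, hχ, mder_extChartAt_self, ← hχ, ContinuousLinearMap.inverse_id]
    rw [hset, VectorField.lieBracketWithin, fderivWithin_univ, fderivWithin_univ]
    rfl
  rw [step W V dW hWh, step V W dV hVh, mder_eq_fderiv_chart (smooth_mdiffAt hh x)]
  have e3 := hsymm (V' (χ x)) (W' (χ x))
  have e4 : fderiv ℝ g (χ x) (VectorField.mlieBracket 𝓘(ℝ, E) V W x)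
      = fderiv ℝ g (χ x) (fderiv ℝ W' (χ x) (V' (χ x)))
        - fderiv ℝ g (χ x) (fderiv ℝ V' (χ x) (W' (χ x))) := by
    rw [← map_sub]; exact congrArg _ e0
  refine e4.trans ?_
  rw [← hV', ← hW', e3]
  ring

end LieBracket

/-! ### Point derivations and functions with a given differential -/

section Hadamard

variable {E : Type*} [NormedAddCommGroup E] [NormedSpace ℝ E]

/-- Hadamard's lemma, with the linear form `∫₀¹ dφ(t x) dt`. -/
theorem exists_hadamard {φ : E → ℝ} (hφ : ContDiff ℝ ∞ φ) :
    ∃ g : E → E →L[ℝ] ℝ, ContDiff ℝ ∞ g ∧ g 0 = fderiv ℝ φ 0 ∧ ∀ x, φ x = φ 0 + g x x := by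
  have hφ' : ContDiff ℝ ∞ (fderiv ℝ φ) := hφ.fderiv_right (by simp)
  -- smooth dependence of the integral on `x` comes from writing it as the value at `0` of a
  -- convolution with the indicator function of `(0, 1]`; the cutoff `b` gives compact support
  let b : ContDiffBump (0 : ℝ) := ⟨1, 2, one_pos, by norm_num⟩
  let k : E → ℝ → E →L[ℝ] ℝ := fun x s => b s • fderiv ℝ φ (-s • x)
  let f : ℝ → ℝ := Set.indicator (Set.Ioc 0 1) 1
  have hb : ∀ t ∈ Set.Ioc (0 : ℝ) 1, b (0 - t) = 1 := fun t ht => by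
    refine b.one_of_mem_closedBall ?_
    change _ ≤ (1 : ℝ)
    simp [abs_of_pos ht.1, ht.2]
  have hk : ContDiff ℝ ∞ (Function.uncurry k) := by
    have h1 : ContDiff ℝ ∞ (fun p : E × ℝ => b p.2) := b.contDiff.comp contDiff_snd
    have h2 : ContDiff ℝ ∞ (fun p : E × ℝ => fderiv ℝ φ (-p.2 • p.1)) :=
      hφ'.comp (contDiff_snd.neg.smul contDiff_fst)
    exact h1.smul h2
  have hs := MeasureTheory.contDiffOn_convolution_right_with_param (μ := MeasureTheory.volume) (n := ⊤)
    (ContinuousLinearMap.lsmul ℝ ℝ : ℝ →L[ℝ] (E →L[ℝ] ℝ) →L[ℝ] (E →L[ℝ] ℝ)) (f := f) (g := k)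
    (s := Set.univ) (k := Metric.closedBall 0 2) isOpen_univ (isCompact_closedBall _ _)
    (by
      intro p x _ hx
      have : b x = 0 := b.zero_of_le_dist (by
        change (2 : ℝ) ≤ _
        exact (not_le.1 (fun h => hx (Metric.mem_closedBall.2 h))).le)
      simp [k, this])
    ((MeasureTheory.integrable_indicator_iff measurableSet_Ioc).2
      (by
        have h : MeasureTheory.IntegrableOn (fun _ : ℝ => (1 : ℝ)) (Set.Ioc 0 1) :=
          MeasureTheory.integrableOn_const (by simp)
        exact h)).locallyIntegrable
    hk.contDiffOn
  have hint : ∀ x, (MeasureTheory.convolution f (k x) (ContinuousLinearMap.lsmul ℝ ℝ)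
      MeasureTheory.volume) 0 = ∫ t in (0 : ℝ)..1, fderiv ℝ φ (t • x) := fun x => by
    rw [intervalIntegral.integral_of_le zero_le_one, ← MeasureTheory.integral_indicator
      measurableSet_Ioc, MeasureTheory.convolution]
    refine MeasureTheory.integral_congr_ae (Eventually.of_forall fun t => ?_)
    by_cases ht : t ∈ Set.Ioc (0 : ℝ) 1
    · simp only [f, k, Set.indicator_of_mem ht, Pi.one_apply, ContinuousLinearMap.lsmul_apply,
        hb t ht, one_smul]
      simp
    · simp [f, Set.indicator_of_notMem ht]
  refine ⟨fun x => ∫ t in (0 : ℝ)..1, fderiv ℝ φ (t • x), ?_, ?_, ?_⟩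
  · obtain ⟨C, hC, hCi⟩ : ∃ C : E × ℝ → E →L[ℝ] ℝ, ContDiff ℝ ∞ C ∧
        ∀ x, C (x, 0) = ∫ t in (0 : ℝ)..1, fderiv ℝ φ (t • x) := by
      refine ⟨fun q => MeasureTheory.convolution f (k q.1) (ContinuousLinearMap.lsmul ℝ ℝ)
        MeasureTheory.volume q.2, ?_, hint⟩
      rw [← contDiffOn_univ, ← Set.univ_prod_univ]
      exact hs
    simp only [← hCi]
    exact hC.comp (contDiff_id.prodMk contDiff_const)
  · simp
  · intro x
    have hc : Continuous fun t : ℝ => fderiv ℝ φ (t • x) :=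
      hφ'.continuous.comp (continuous_id.smul continuous_const)
    have h1 : (∫ t in (0 : ℝ)..1, fderiv ℝ φ (t • x)) x
        = ∫ t in (0 : ℝ)..1, fderiv ℝ φ (t • x) x :=
      ContinuousLinearMap.intervalIntegral_apply (hc.intervalIntegrable _ _) x
    have h2 : ∫ t in (0 : ℝ)..1, fderiv ℝ φ (t • x) x = φ ((1 : ℝ) • x) - φ ((0 : ℝ) • x) := by
      refine intervalIntegral.integral_eq_sub_of_hasDerivAt (f := fun t : ℝ => φ (t • x))
        (fun t _ => ?_) ((hc.clm_apply continuous_const).intervalIntegrable _ _)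
      have h3 : HasDerivAt (fun t : ℝ => t • x) x t := by
        simpa using (hasDerivAt_id t).smul_const x
      exact ((hφ.differentiable (by simp) _).hasFDerivAt).comp_hasDerivAt t h3
    rw [h1, h2]
    simp

end Hadamard

section PointDerivation

variable {E : Type*} [NormedAddCommGroup E] [NormedSpace ℝ E] [FiniteDimensional ℝ E]
  {M : Type*} [TopologicalSpace M] [ChartedSpace E M] [IsManifold 𝓘(ℝ, E) ∞ M] [T2Space M]

/-- A globally defined smooth function that agrees near `x` with `g` read in the chart at `x`. -/
theorem exists_contMDiffMap_eventuallyEq (x : M) {g : E → ℝ} (hg : ContDiff ℝ ∞ g) :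
    ∃ φ : C^∞⟮𝓘(ℝ, E), M; ℝ⟯, φ =ᶠ[𝓝 x] fun y => g (extChartAt 𝓘(ℝ, E) x y) := by
  let ρ : SmoothBumpFunction 𝓘(ℝ, E) x := Classical.arbitrary _
  refine ⟨⟨fun y => ρ y • g (extChartAt 𝓘(ℝ, E) x y), ρ.contMDiff_smul ?_⟩, ?_⟩
  · exact hg.contMDiff.comp_contMDiffOn (contMDiffOn_extChartAt (n := ∞))
  · filter_upwards [ρ.eventuallyEq_one] with y hy
    change ρ y • g (extChartAt 𝓘(ℝ, E) x y) = _
    rw [hy, Pi.one_apply, one_smul]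

theorem exists_mder_eq (x : M) (l : E →L[ℝ] ℝ) :
    ∃ φ : C^∞⟮𝓘(ℝ, E), M; ℝ⟯, mder E ℝ φ x = l := by
  obtain ⟨φ, hφ⟩ := exists_contMDiffMap_eventuallyEq x l.contDiff
  refine ⟨φ, ?_⟩
  ext v
  rw [mder_congr hφ]
  refine (mder_comp (g := l) ((l.contMDiff (n := ∞)).contMDiffAt.mdifferentiableAt
    (by simp)) ((contMDiffAt_extChartAt (n := ∞)).mdifferentiableAt (by simp)) v).trans ?_
  rw [mder_extChartAt_self, mder_eq_fderiv]
  simp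

theorem pointDerivation_eq_zero_of_eventuallyEq {x : M} (v : C^∞⟮𝓘(ℝ, E), M; ℝ⟯ →ₗ[ℝ] ℝ)
    (hv : ∀ φ ψ, v (φ * ψ) = v φ * ψ x + φ x * v ψ) {φ : C^∞⟮𝓘(ℝ, E), M; ℝ⟯}
    (h : φ =ᶠ[𝓝 x] 0) : v φ = 0 := by
  obtain ⟨ρ, -, hρ⟩ := (SmoothBumpFunction.nhds_basis_support (I := 𝓘(ℝ, E)) (c := x)
    (s := Set.univ) univ_mem).mem_iff.1 h
  let r : C^∞⟮𝓘(ℝ, E), M; ℝ⟯ := ⟨ρ, ρ.contMDiff⟩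
  have h0 : r * φ = 0 := by
    ext y
    change ρ y * φ y = 0
    by_cases hy : y ∈ Function.support ρ
    · rw [show φ y = 0 from hρ hy, mul_zero]
    · rw [Function.notMem_support.1 hy, zero_mul]
  have h1 := hv r φ
  rw [h0, map_zero, show φ x = 0 from h.self_of_nhds, show r x = 1 from ρ.eq_one] at h1
  linarith

/-- A derivation at a point only depends on the differential of the function there. -/
theorem pointDerivation_eq_zero {x : M} (v : C^∞⟮𝓘(ℝ, E), M; ℝ⟯ →ₗ[ℝ] ℝ)
    (hv : ∀ φ ψ, v (φ * ψ) = v φ * ψ x + φ x * v ψ) {φ : C^∞⟮𝓘(ℝ, E), M; ℝ⟯}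
    (h : mder E ℝ φ x = 0) : v φ = 0 := by
  set χ := extChartAt 𝓘(ℝ, E) x with hχ
  obtain ⟨r, hr, hball⟩ := Metric.mem_nhds_iff.1
    (extChartAt_target_mem_nhds x : χ.target ∈ 𝓝 (χ x))
  rw [← hχ] at hball
  -- a smooth map of `E` into the chart domain that is the identity near `χ x`
  let b : ContDiffBump (χ x) := ⟨r / 2, r, by positivity, by linarith⟩
  let τ : E → E := fun z => χ x + b z • (z - χ x)
  have hτ : ContDiff ℝ ∞ τ := contDiff_const.add (b.contDiff.smul (contDiff_id.sub contDiff_const))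
  have hτmem : ∀ z, τ z ∈ χ.target := fun z => hball (by
    rw [Metric.mem_ball, dist_eq_norm]
    by_cases hz : r ≤ dist z (χ x)
    · have : b z = 0 := b.zero_of_le_dist hz
      simpa [τ, this] using hr
    · rw [not_le, dist_eq_norm] at hz
      simp only [τ, add_sub_cancel_left, norm_smul, Real.norm_eq_abs, abs_of_nonneg b.nonneg]
      exact (mul_le_of_le_one_left (norm_nonneg _) b.le_one).trans_lt hz)
  have hτ1 : τ =ᶠ[𝓝 (χ x)] id := by
    filter_upwards [b.eventuallyEq_one] with z hz
    simp [τ, hz]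
  have hφτ : ContDiff ℝ ∞ (fun z => φ (χ.symm (τ (χ x + z)))) := by
    rw [contDiff_iff_contDiffAt]
    intro z
    exact ContDiffAt.comp (f := fun z => τ (χ x + z)) z
      (contDiffAt_comp_chart_symm φ.contMDiff (hτmem _)) (hτ.comp (contDiff_const.add contDiff_id)).contDiffAt
  -- Hadamard's lemma writes `φ - φ x` near `x` as a sum of products `u i * w i` of functions that
  -- vanish at `x`
  obtain ⟨g, hg, hg0, hgx⟩ := exists_hadamard hφτ
  have hloc : (fun z => φ (χ.symm (τ (χ x + z)))) =ᶠ[𝓝 0] fun z => φ (χ.symm (χ x + z)) := by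
    have : Tendsto (fun z => χ x + z) (𝓝 0) (𝓝 (χ x)) := by
      have h : Continuous fun z : E => χ x + z := by fun_prop
      simpa using h.tendsto 0
    filter_upwards [this.eventually hτ1] with z hz
    rw [hz]; rfl
  have hg0' : g 0 = 0 := by
    rw [hg0, hloc.fderiv_eq]
    have := fderiv_comp_add_left (𝕜 := ℝ) (f := φ ∘ χ.symm) (x := (0 : E)) (χ x)
    refine this.trans ?_
    rw [add_zero, ← mder_eq_fderiv_chart (smooth_mdiffAt φ.contMDiff x), h]
  let e := Module.finBasis ℝ E
  have hu : ∀ i, ∃ u : C^∞⟮𝓘(ℝ, E), M; ℝ⟯, u =ᶠ[𝓝 x] fun y => e.coord i (χ y - χ x) := fun i =>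
    exists_contMDiffMap_eventuallyEq x (g := fun z => e.coord i (z - χ x))
      ((LinearMap.toContinuousLinearMap (e.coord i)).contDiff.comp
        (contDiff_id.sub contDiff_const))
  have hw : ∀ i, ∃ w : C^∞⟮𝓘(ℝ, E), M; ℝ⟯, w =ᶠ[𝓝 x] fun y => g (χ y - χ x) (e i) := fun i =>
    exists_contMDiffMap_eventuallyEq x (g := fun z => g (z - χ x) (e i))
      ((hg.comp (contDiff_id.sub contDiff_const)).clm_apply contDiff_const)
  choose u hu using hu
  choose w hw using hw
  have hu0 : ∀ i, u i x = 0 := fun i => by rw [(hu i).self_of_nhds]; simp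
  have hw0 : ∀ i, w i x = 0 := fun i => by rw [(hw i).self_of_nhds]; simp [hg0']
  have hone : v 1 = 0 := by
    have := hv 1 1
    simp only [mul_one] at this
    rw [show (1 : C^∞⟮𝓘(ℝ, E), M; ℝ⟯) x = 1 from rfl] at this
    linarith
  have hz : v (φ - (φ x • 1 + ∑ i, u i * w i)) = 0 := by
    refine pointDerivation_eq_zero_of_eventuallyEq v hv ?_
    have hcont : Tendsto (fun y => χ y - χ x) (𝓝 x) (𝓝 0) := by
      have h : Tendsto χ (𝓝 x) (𝓝 (χ x)) := continuousAt_extChartAt x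
      simpa using h.sub_const (χ x)
    filter_upwards [hcont.eventually hloc, extChartAt_source_mem_nhds (I := 𝓘(ℝ, E)) x,
      eventually_all.2 hu, eventually_all.2 hw] with y hy hys huy hwy
    have h1 : φ y = φ x + g (χ y - χ x) (χ y - χ x) := by
      have h2 := hgx (χ y - χ x)
      have h3 : φ (χ.symm (τ (χ x + 0))) = φ (χ.symm (χ x + 0)) := hloc.self_of_nhds
      rw [hy, h3, add_zero, add_sub_cancel, χ.left_inv hys,
        extChartAt_to_inv] at h2
      exact h2
    have h3 : g (χ y - χ x) (χ y - χ x) = ∑ i, u i y * w i y := by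
      have h5 := congrArg (g (χ y - χ x)) (e.sum_repr (χ y - χ x))
      rw [← h5, map_sum]
      simp only [map_smul, smul_eq_mul, huy, hwy, Module.Basis.coord_apply]
    have h4 : (∑ i, u i * w i : C^∞⟮𝓘(ℝ, E), M; ℝ⟯) y = ∑ i, u i y * w i y := by
      have := map_sum (ContMDiffMap.coeFnRingHom (I := 𝓘(ℝ, E)) (N := M) (R := ℝ)
        (I' := 𝓘(ℝ, ℝ)) (n := ∞)) (fun i => u i * w i) Finset.univ
      have := congrFun this y
      simpa using this
    change φ y - (φ x * 1 + (∑ i, u i * w i : C^∞⟮𝓘(ℝ, E), M; ℝ⟯) y) = 0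
    rw [h4, h1, h3]; ring
  rw [map_sub, map_add, map_smul, hone, map_sum] at hz
  have : ∀ i, v (u i * w i) = 0 := fun i => by rw [hv, hu0, hw0]; ring
  simpa [this] using hz

end PointDerivation

/-! ### Local inverses and local sections -/

section LocalInverse

variable {E : Type*} [NormedAddCommGroup E] [NormedSpace ℝ E]
  {M : Type*} [TopologicalSpace M] [ChartedSpace E M]
  {F : Type*} [NormedAddCommGroup F] [NormedSpace ℝ F]
  {N : Type*} [TopologicalSpace N] [ChartedSpace F N]
  {F' : Type*} [NormedAddCommGroup F'] [NormedSpace ℝ F']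
  {P : Type*} [TopologicalSpace P] [ChartedSpace F' P]

theorem contMDiffAt_extChartAt_symm_self [IsManifold 𝓘(ℝ, E) ∞ M] (x : M) :
    ContMDiffAt 𝓘(ℝ, E) 𝓘(ℝ, E) ∞ (extChartAt 𝓘(ℝ, E) x).symm (extChartAt 𝓘(ℝ, E) x x) :=
  (contMDiffOn_extChartAt_symm x).contMDiffAt (extChartAt_target_mem_nhds x)

theorem mder_extChartAt_symm_self [IsManifold 𝓘(ℝ, E) ∞ M] (x : M) :
    mder E E (extChartAt 𝓘(ℝ, E) x).symm (extChartAt 𝓘(ℝ, E) x x)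
      = ContinuousLinearMap.id ℝ E := by
  have hx : (extChartAt 𝓘(ℝ, E) x).symm (extChartAt 𝓘(ℝ, E) x x) = x := extChartAt_to_inv x
  have h1 : extChartAt 𝓘(ℝ, E) x ∘ (extChartAt 𝓘(ℝ, E) x).symm
      =ᶠ[𝓝 (extChartAt 𝓘(ℝ, E) x x)] fun z => z := by
    filter_upwards [extChartAt_target_mem_nhds (I := 𝓘(ℝ, E)) x] with z hz
    exact (extChartAt 𝓘(ℝ, E) x).right_inv hz
  ext v
  have h2 := mder_comp (g := extChartAt 𝓘(ℝ, E) x) (f := (extChartAt 𝓘(ℝ, E) x).symm)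
    (x := extChartAt 𝓘(ℝ, E) x x)
    (by rw [hx]; exact (contMDiffAt_extChartAt (n := ∞)).mdifferentiableAt (by simp))
    ((contMDiffAt_extChartAt_symm_self x).mdifferentiableAt (by simp)) v
  rw [mder_congr h1, mder_id, hx, mder_extChartAt_self] at h2
  exact h2.symm

/-- The inverse function theorem for a map from a product of two manifolds. -/
theorem exists_local_inverse_prod [FiniteDimensional ℝ E] [FiniteDimensional ℝ F]
    [IsManifold 𝓘(ℝ, E) ∞ M] [IsManifold 𝓘(ℝ, F) ∞ N] [IsManifold 𝓘(ℝ, F') ∞ P]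
    {f : M × N → P} (hf : ContMDiff (𝓘(ℝ, E).prod 𝓘(ℝ, F)) 𝓘(ℝ, F') ∞ f) (x : M) (y : N)
    (T : (E × F) ≃ₗ[ℝ] F')
    (hT : ∀ u v, T (u, v)
      = mder E F' (fun x => f (x, y)) x u + mder F F' (fun y => f (x, y)) y v) :
    ∃ (s₁ : P → M) (s₂ : P → N), ContMDiffAt 𝓘(ℝ, F') 𝓘(ℝ, E) ∞ s₁ (f (x, y)) ∧
      ContMDiffAt 𝓘(ℝ, F') 𝓘(ℝ, F) ∞ s₂ (f (x, y)) ∧ s₁ (f (x, y)) = x ∧ s₂ (f (x, y)) = y ∧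
      ∀ᶠ p in 𝓝 (f (x, y)), f (s₁ p, s₂ p) = p := by
  set χ := extChartAt 𝓘(ℝ, E) x
  set η := extChartAt 𝓘(ℝ, F) y
  set ζ := extChartAt 𝓘(ℝ, F') (f (x, y))
  have hx : χ.symm (χ x) = x := extChartAt_to_inv x
  have hy : η.symm (η y) = y := extChartAt_to_inv y
  have hζ : ζ.symm (ζ (f (x, y))) = f (x, y) := extChartAt_to_inv _
  have hχs : ContMDiffAt 𝓘(ℝ, E) 𝓘(ℝ, E) ∞ χ.symm (χ x) := contMDiffAt_extChartAt_symm_self x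
  have hηs : ContMDiffAt 𝓘(ℝ, F) 𝓘(ℝ, F) ∞ η.symm (η y) := contMDiffAt_extChartAt_symm_self y
  have h1 : ContMDiffAt 𝓘(ℝ, E × F) 𝓘(ℝ, E) ∞ (fun p : E × F => χ.symm p.1) (χ x, η y) :=
    hχs.comp (χ x, η y) (contDiff_fst.contMDiff.contMDiffAt)
  have h2 : ContMDiffAt 𝓘(ℝ, E × F) 𝓘(ℝ, F) ∞ (fun p : E × F => η.symm p.2) (χ x, η y) :=
    hηs.comp (χ x, η y) (contDiff_snd.contMDiff.contMDiffAt)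
  have h3 : ContMDiffAt 𝓘(ℝ, E × F) 𝓘(ℝ, F') ∞ (fun p : E × F => f (χ.symm p.1, η.symm p.2))
      (χ x, η y) := hf.contMDiffAt.comp (χ x, η y) (h1.prodMk h2)
  set g : E × F → F' := ζ ∘ fun p : E × F => f (χ.symm p.1, η.symm p.2) with hg
  have hζs : ContMDiffAt 𝓘(ℝ, F') 𝓘(ℝ, F') ∞ ζ (f (x, y)) := contMDiffAt_extChartAt
  have hgs : ContDiffAt ℝ ∞ g (χ x, η y) := by
    rw [← contMDiffAt_iff_contDiffAt]
    refine ContMDiffAt.comp (χ x, η y) ?_ h3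
    simp only [hx, hy]; exact hζs
  let T' : (E × F) ≃L[ℝ] F' := T.toContinuousLinearEquiv
  have hgd : HasFDerivAt g (T' : (E × F) →L[ℝ] F') (χ x, η y) := by
    have h4 : fderiv ℝ g (χ x, η y) = (T' : (E × F) →L[ℝ] F') := by
      refine ContinuousLinearMap.ext fun w => ?_
      have h8 : MDifferentiableAt 𝓘(ℝ, F') 𝓘(ℝ, F') ζ (f (χ.symm (χ x), η.symm (η y))) := by
        rw [hx, hy]; exact hζs.mdifferentiableAt (by simp)
      rw [← mder_eq_fderiv, hg,
        mder_comp (f := fun p : E × F => f (χ.symm p.1, η.symm p.2)) h8 (h3.mdifferentiableAt (by simp))]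
      have h5 := mder_comp₂ (f := f) (g := fun p : E × F => χ.symm p.1)
        (h := fun p : E × F => η.symm p.2) (q := (χ x, η y))
        (hf.contMDiffAt.mdifferentiableAt (by simp)) (h1.mdifferentiableAt (by simp))
        (h2.mdifferentiableAt (by simp)) w
      have h6 : mder (E × F) E (fun p : E × F => χ.symm p.1) (χ x, η y) w = w.1 := by
        refine (mder_comp (g := χ.symm) (f := Prod.fst) (x := (χ x, η y))
          (hχs.mdifferentiableAt (by simp))
          ((contDiff_fst (n := ∞)).contMDiff.contMDiffAt.mdifferentiableAt (by simp)) w).trans ?_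
        rw [mder_extChartAt_symm_self, mder_eq_fderiv, fderiv_fst]
        rfl
      have h7 : mder (E × F) F (fun p : E × F => η.symm p.2) (χ x, η y) w = w.2 := by
        refine (mder_comp (g := η.symm) (f := Prod.snd) (x := (χ x, η y))
          (hηs.mdifferentiableAt (by simp))
          ((contDiff_snd (n := ∞)).contMDiff.contMDiffAt.mdifferentiableAt (by simp)) w).trans ?_
        rw [mder_extChartAt_symm_self, mder_eq_fderiv, fderiv_snd]
        rfl
      rw [h5, h6, h7]
      simp only [hx, hy]
      rw [mder_extChartAt_self, ← hT]
      rfl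
    rw [← h4]
    exact (hgs.differentiableAt (by simp)).hasFDerivAt
  have hstrict : HasStrictFDerivAt g (T' : (E × F) →L[ℝ] F') (χ x, η y) :=
    hgs.hasStrictFDerivAt' hgd (by simp)
  have : CompleteSpace (E × F) := FiniteDimensional.complete ℝ _
  let σ : F' → E × F := hgs.localInverse hgd (by simp)
  have hσ : ContDiffAt ℝ ∞ σ (g (χ x, η y)) := hgs.to_localInverse hgd (by simp)
  have hσ0 : σ (g (χ x, η y)) = (χ x, η y) := hgs.localInverse_apply_image hgd (by simp)
  have hσr : ∀ᶠ z in 𝓝 (g (χ x, η y)), g (σ z) = z := hstrict.eventually_right_inverse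
  have hg0 : g (χ x, η y) = ζ (f (x, y)) := by simp [hg, hx, hy]
  rw [hg0] at hσ hσ0 hσr
  have hσM : ContMDiffAt 𝓘(ℝ, F') 𝓘(ℝ, E × F) ∞ (fun p => σ (ζ p)) (f (x, y)) :=
    hσ.contMDiffAt.comp (f (x, y)) hζs
  have s1 : ContMDiffAt 𝓘(ℝ, F') 𝓘(ℝ, E) ∞ (fun p => χ.symm (σ (ζ p)).1) (f (x, y)) := by
    have h1' : ContMDiffAt 𝓘(ℝ, E × F) 𝓘(ℝ, E) ∞ (fun p : E × F => χ.symm p.1)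
        (σ (ζ (f (x, y)))) := by rw [hσ0]; exact h1
    exact ContMDiffAt.comp (g := fun p : E × F => χ.symm p.1) (f (x, y)) h1' hσM
  have s2 : ContMDiffAt 𝓘(ℝ, F') 𝓘(ℝ, F) ∞ (fun p => η.symm (σ (ζ p)).2) (f (x, y)) := by
    have h2' : ContMDiffAt 𝓘(ℝ, E × F) 𝓘(ℝ, F) ∞ (fun p : E × F => η.symm p.2)
        (σ (ζ (f (x, y)))) := by rw [hσ0]; exact h2
    exact ContMDiffAt.comp (g := fun p : E × F => η.symm p.2) (f (x, y)) h2' hσM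
  refine ⟨_, _, s1, s2, by rw [hσ0, hx], by rw [hσ0, hy], ?_⟩
  have hc : Tendsto (fun p => f (χ.symm (σ (ζ p)).1, η.symm (σ (ζ p)).2)) (𝓝 (f (x, y)))
      (𝓝 (f (x, y))) := by
    have := (hf.continuous.continuousAt).comp (s1.continuousAt.prodMk s2.continuousAt)
    have h := this.tendsto
    simpa only [Function.comp_def, hσ0, hx, hy] using h
  filter_upwards [hζs.continuousAt.eventually hσr, extChartAt_source_mem_nhds (I := 𝓘(ℝ, F'))
    (f (x, y)), hc.eventually (extChartAt_source_mem_nhds (I := 𝓘(ℝ, F')) (f (x, y)))]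
    with p hp hps hpf
  exact ζ.injOn hpf hps hp

/-- A submersion has smooth local sections through every point. -/
theorem exists_local_section {f : M → N}
    (hf : Manifold.IsSubmersion 𝓘(ℝ, E) 𝓘(ℝ, F) ∞ f) (x : M) :
    ∃ s : N → M, ContMDiffAt 𝓘(ℝ, F) 𝓘(ℝ, E) ∞ s (f x) ∧ s (f x) = x ∧
      ∀ᶠ y in 𝓝 (f x), f (s y) = y := by
  have h := hf.isSubmersionAt x
  set φ := h.domChart with hφ
  set ψ := h.codChart with hψ
  set e := h.equiv with he
  have hxφ : x ∈ φ.source := h.mem_domChart_source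
  have hxψ : f x ∈ ψ.source := h.mem_codChart_source
  have hw : ∀ z ∈ φ.target, ψ (f (φ.symm z)) = (e z).1 := fun z hz =>
    h.writtenInCharts (show z ∈ (h.domChart.extend 𝓘(ℝ, E)).target by simpa using hz)
  have h0 : (e (φ x)).1 = ψ (f x) := by
    rw [← hw _ (φ.map_source hxφ), φ.left_inv hxφ]
  have hpt : e.symm (ψ (f x), (e (φ x)).2) = φ x := by
    rw [← h0]; exact e.symm_apply_apply _
  have hτ : ContMDiffAt 𝓘(ℝ, F) 𝓘(ℝ, E) ∞ (fun y => e.symm (ψ y, (e (φ x)).2)) (f x) := by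
    have h1 : ContDiff ℝ ∞ (fun z : F => e.symm (z, (e (φ x)).2)) :=
      e.symm.contDiff.comp (contDiff_id.prodMk contDiff_const)
    have h2 : ContMDiffAt 𝓘(ℝ, F) 𝓘(ℝ, F) ∞ ψ (f x) :=
      (contMDiffOn_of_mem_maximalAtlas h.codChart_mem_maximalAtlas).contMDiffAt
        (ψ.open_source.mem_nhds hxψ)
    exact h1.contMDiff.contMDiffAt.comp (f x) h2
  have hφs : ContMDiffAt 𝓘(ℝ, E) 𝓘(ℝ, E) ∞ φ.symm (φ x) :=
    (contMDiffOn_symm_of_mem_maximalAtlas h.domChart_mem_maximalAtlas).contMDiffAt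
      (φ.open_target.mem_nhds (φ.map_source hxφ))
  refine ⟨fun y => φ.symm (e.symm (ψ y, (e (φ x)).2)), ?_, ?_, ?_⟩
  · refine ContMDiffAt.comp (f x) (g := φ.symm) ?_ hτ
    rw [hpt]; exact hφs
  · change φ.symm (e.symm (ψ (f x), (e (φ x)).2)) = x
    rw [hpt, φ.left_inv hxφ]
  · have hc : Tendsto (fun y => e.symm (ψ y, (e (φ x)).2)) (𝓝 (f x)) (𝓝 (φ x)) := by
      have := hτ.continuousAt.tendsto
      rwa [hpt] at this
    filter_upwards [hc.eventually (φ.open_target.mem_nhds (φ.map_source hxφ)),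
      ψ.open_source.mem_nhds hxψ] with y hy hyψ
    refine ψ.injOn (h.source_subset_preimage_source (φ.map_target hy)) hyψ ?_
    rw [hw _ hy]; simp

end LocalInverse

section Hausdorff

variable {E : Type*} [NormedAddCommGroup E] [NormedSpace ℝ E]
  {D : Type*} [TopologicalSpace D] [ChartedSpace E D] [Group D]
  {F : Type*} [NormedAddCommGroup F]

theorem t2Space_of_lieGroup [LieGroup 𝓘(ℝ, E) ∞ D] : T2Space D := by
  have := topologicalGroup_of_lieGroup 𝓘(ℝ, E) ∞ (G := D)
  have := ChartedSpace.t1Space E D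
  infer_instance

/-- A quotient of a Lie group that is a manifold is Hausdorff: its points are closed, so the
subgroup is closed. -/
theorem t2Space_quotient [LieGroup 𝓘(ℝ, E) ∞ D] (H : Subgroup D) [ChartedSpace F (D ⧸ H)] :
    T2Space (D ⧸ H) := by
  have := topologicalGroup_of_lieGroup 𝓘(ℝ, E) ∞ (G := D)
  have := ChartedSpace.t1Space F (D ⧸ H)
  have h : IsClosed (H : Set D) := by
    have h1 : (H : Set D) = (QuotientGroup.mk : D → D ⧸ H) ⁻¹' {QuotientGroup.mk 1} := by
      ext x
      simp only [Set.mem_preimage, Set.mem_singleton_iff, SetLike.mem_coe]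
      rw [eq_comm, QuotientGroup.eq]
      simp
    rw [h1]
    exact isClosed_singleton.preimage QuotientGroup.continuous_mk
  infer_instance

end Hausdorff

/-! ### Invariant derivatives and the adjoint action of a Lie group -/

section InvariantDerivatives

variable {E : Type*} [NormedAddCommGroup E] [NormedSpace ℝ E]
  {D : Type*} [TopologicalSpace D] [ChartedSpace E D] [Group D] [LieGroup 𝓘(ℝ, E) ∞ D]

theorem contMDiff_apply_mul (φ : C^∞⟮𝓘(ℝ, E), D; ℝ⟯) :
    ContMDiff (𝓘(ℝ, E).prod 𝓘(ℝ, E)) 𝓘(ℝ, ℝ) ∞ (fun p : D × D => φ (p.1 * p.2)) :=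
  φ.contMDiff.comp (contMDiff_mul 𝓘(ℝ, E) ∞)

theorem contMDiff_apply_mul_swap (φ : C^∞⟮𝓘(ℝ, E), D; ℝ⟯) :
    ContMDiff (𝓘(ℝ, E).prod 𝓘(ℝ, E)) 𝓘(ℝ, ℝ) ∞ (fun p : D × D => φ (p.2 * p.1)) :=
  φ.contMDiff.comp (contMDiff_snd.mul contMDiff_fst)

theorem mdiffAt_apply_mul_const (φ : C^∞⟮𝓘(ℝ, E), D; ℝ⟯) (x y : D) :
    MDifferentiableAt 𝓘(ℝ, E) 𝓘(ℝ, ℝ) (fun y => φ (y * x)) y :=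
  smooth_mdiffAt (φ.contMDiff.comp (contMDiff_id.mul contMDiff_const)) y

theorem mdiffAt_apply_const_mul (φ : C^∞⟮𝓘(ℝ, E), D; ℝ⟯) (x y : D) :
    MDifferentiableAt 𝓘(ℝ, E) 𝓘(ℝ, ℝ) (fun y => φ (x * y)) y :=
  smooth_mdiffAt (φ.contMDiff.comp (contMDiff_const.mul contMDiff_id)) y

theorem mdiffAt_mul_const (x y : D) :
    MDifferentiableAt 𝓘(ℝ, E) 𝓘(ℝ, E) (fun y : D => y * x) y :=
  smooth_mdiffAt (contMDiff_id.mul contMDiff_const) y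

theorem mdiffAt_const_mul (x y : D) :
    MDifferentiableAt 𝓘(ℝ, E) 𝓘(ℝ, E) (fun y : D => x * y) y :=
  smooth_mdiffAt (contMDiff_const.mul contMDiff_id) y

/-- The derivative of functions along the right-invariant vector fields:
`x ↦ d/dt|_{t=0} φ(e^{tv} x)`. -/
def rightInvDeriv : E →ₗ[ℝ] C^∞⟮𝓘(ℝ, E), D; ℝ⟯ →ₗ[ℝ] C^∞⟮𝓘(ℝ, E), D; ℝ⟯ :=
  LinearMap.mk₂ ℝ
    (fun v φ => ⟨fun x => mder E ℝ (fun y => φ (y * x)) 1 v,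
      contMDiff_mder_right (contMDiff_apply_mul_swap φ) 1 v⟩)
    (fun v w φ => by
      ext x; exact (mder E ℝ (fun y => φ (y * x)) 1).map_add v w)
    (fun t v φ => by
      ext x; exact (mder E ℝ (fun y => φ (y * x)) 1).map_smul t v)
    (fun v φ ψ => by
      ext x
      exact congrArg (fun T : E →L[ℝ] ℝ => T v)
        (mder_add (mdiffAt_apply_mul_const φ x 1) (mdiffAt_apply_mul_const ψ x 1)))
    (fun t v φ => by
      ext x
      exact congrArg (fun T : E →L[ℝ] ℝ => T v) (mder_smul (mdiffAt_apply_mul_const φ x 1) t))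

theorem rightInvDeriv_apply (v : E) (φ : C^∞⟮𝓘(ℝ, E), D; ℝ⟯) (x : D) :
    rightInvDeriv v φ x = mder E ℝ (fun y => φ (y * x)) 1 v := rfl

/-- The derivative of functions along the left-invariant vector fields:
`x ↦ d/dt|_{t=0} φ(x e^{tv})`. -/
def leftInvDeriv (v : E) (φ : C^∞⟮𝓘(ℝ, E), D; ℝ⟯) : C^∞⟮𝓘(ℝ, E), D; ℝ⟯ :=
  ⟨fun x => mder E ℝ (fun y => φ (x * y)) 1 v,
    contMDiff_mder_right (contMDiff_apply_mul φ) 1 v⟩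

theorem leftInvDeriv_apply (v : E) (φ : C^∞⟮𝓘(ℝ, E), D; ℝ⟯) (x : D) :
    leftInvDeriv v φ x = mder E ℝ (fun y => φ (x * y)) 1 v := rfl

theorem rightInvDeriv_one (v : E) (φ : C^∞⟮𝓘(ℝ, E), D; ℝ⟯) :
    rightInvDeriv v φ 1 = mder E ℝ φ 1 v := by
  rw [rightInvDeriv_apply]; simp only [mul_one]

theorem leftInvDeriv_one (v : E) (φ : C^∞⟮𝓘(ℝ, E), D; ℝ⟯) :
    leftInvDeriv v φ 1 = mder E ℝ φ 1 v := by
  rw [leftInvDeriv_apply]; simp only [one_mul]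

theorem rightInvDeriv_mul (v : E) (φ ψ : C^∞⟮𝓘(ℝ, E), D; ℝ⟯) :
    rightInvDeriv v (φ * ψ) = rightInvDeriv v φ * ψ + φ * rightInvDeriv v ψ := by
  ext x
  refine (mder_mul (mdiffAt_apply_mul_const φ x 1) (mdiffAt_apply_mul_const ψ x 1) v).trans ?_
  rw [one_mul]
  rfl

/-- The function `y ↦ φ (y x)`. -/
def translate (x : D) (φ : C^∞⟮𝓘(ℝ, E), D; ℝ⟯) : C^∞⟮𝓘(ℝ, E), D; ℝ⟯ :=
  ⟨fun y => φ (y * x), φ.contMDiff.comp (contMDiff_id.mul contMDiff_const)⟩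

theorem translate_apply (x y : D) (φ : C^∞⟮𝓘(ℝ, E), D; ℝ⟯) : translate x φ y = φ (y * x) := rfl

/-- The function `y ↦ φ (x y)`. -/
def leftTranslate (x : D) (φ : C^∞⟮𝓘(ℝ, E), D; ℝ⟯) : C^∞⟮𝓘(ℝ, E), D; ℝ⟯ :=
  ⟨fun y => φ (x * y), φ.contMDiff.comp (contMDiff_const.mul contMDiff_id)⟩

theorem leftTranslate_apply (x y : D) (φ : C^∞⟮𝓘(ℝ, E), D; ℝ⟯) :
    leftTranslate x φ y = φ (x * y) := rfl

theorem leftInvDeriv_leftTranslate (v : E) (x y : D) (φ : C^∞⟮𝓘(ℝ, E), D; ℝ⟯) :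
    leftInvDeriv v (leftTranslate x φ) y = leftInvDeriv v φ (x * y) := by
  simp only [leftInvDeriv_apply, leftTranslate_apply, mul_assoc]

theorem rightInvDeriv_translate (v : E) (x : D) (φ : C^∞⟮𝓘(ℝ, E), D; ℝ⟯) :
    rightInvDeriv v (translate x φ) = translate x (rightInvDeriv v φ) := by
  ext y
  simp only [rightInvDeriv_apply, translate_apply, mul_assoc]

theorem mder_apply_rightInvariantField (v : E) (φ : C^∞⟮𝓘(ℝ, E), D; ℝ⟯) (x : D) :
    mder E ℝ φ x (rightInvariantField (G := D) v x) = rightInvDeriv v φ x := by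
  have h := mder_comp (g := φ) (f := fun y : D => y * x) (x := 1)
    (smooth_mdiffAt φ.contMDiff _) (mdiffAt_mul_const x 1) v
  rw [one_mul] at h
  exact h.symm

theorem contMDiff_rightInvariantField (v : E) :
    ContMDiff 𝓘(ℝ, E) 𝓘(ℝ, E).tangent ∞
      (fun x : D => (rightInvariantField (G := D) v x : TangentBundle 𝓘(ℝ, E) D)) := by
  let fg : D → TangentBundle 𝓘(ℝ, E) D := fun x => Bundle.TotalSpace.mk' E x 0
  have sfg : ContMDiff 𝓘(ℝ, E) 𝓘(ℝ, E).tangent ∞ fg := Bundle.contMDiff_zeroSection _ _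
  let fv : D → TangentBundle 𝓘(ℝ, E) D := fun _ => Bundle.TotalSpace.mk' E 1 v
  have sfv : ContMDiff 𝓘(ℝ, E) 𝓘(ℝ, E).tangent ∞ fv := contMDiff_const
  have S₁ := sfv.prodMk sfg
  have S₂ := contMDiff_equivTangentBundleProd_symm (I := 𝓘(ℝ, E)) (M := D) (I' := 𝓘(ℝ, E))
    (M' := D) (n := ∞)
  have S₃ : ContMDiff (𝓘(ℝ, E).prod 𝓘(ℝ, E)).tangent 𝓘(ℝ, E).tangent ∞
      (tangentMap (𝓘(ℝ, E).prod 𝓘(ℝ, E)) 𝓘(ℝ, E) (fun p : D × D => p.1 * p.2)) :=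
    ContMDiff.contMDiff_tangentMap (m := ∞) (n := ∞) (contMDiff_mul 𝓘(ℝ, E) ∞) (by simp)
  have S := (S₃.comp S₂).comp S₁
  refine S.congr fun x => ?_
  have h : (mfderiv (𝓘(ℝ, E).prod 𝓘(ℝ, E)) 𝓘(ℝ, E) (fun p : D × D => p.1 * p.2) (1, x)
      ((v, 0) : E × E) : E) = rightInvariantField (G := D) v x := by
    refine (mfderiv_prod_eq_add_apply
      ((contMDiff_mul 𝓘(ℝ, E) ∞).mdifferentiableAt (by simp))).trans ?_
    have h0 : mder E E (fun z : D => 1 * z) x (0 : E) = 0 := map_zero _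
    have h1 : mder E E (fun z : D => z * x) 1 v + mder E E (fun z : D => 1 * z) x (0 : E)
      = mder E E (fun z : D => z * x) 1 v := by rw [h0, add_zero]
    exact h1
  have hp : ∀ (p q : D) (u : E), p = q →
      (Bundle.TotalSpace.mk' E p u : TangentBundle 𝓘(ℝ, E) D) = Bundle.TotalSpace.mk' E q u := by
    rintro p q u rfl; rfl
  refine (hp x (1 * x) _ (one_mul x).symm).trans ?_
  exact congrArg (fun u : E => (Bundle.TotalSpace.mk' E (1 * x) u : TangentBundle 𝓘(ℝ, E) D)) h.symm

variable (D) in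
/-- The bracket `lieBr` on the model space `E`, which is definitionally the tangent space at the
identity. -/
def modelBracket (u v : E) : E := lieBr (E := E) (G := D) u v

/-- The right-invariant derivatives represent the bracket `lieBr`. -/
theorem rightInvDeriv_lieBr [CompleteSpace E] (u v : E) (φ : C^∞⟮𝓘(ℝ, E), D; ℝ⟯) :
    rightInvDeriv (modelBracket D u v) φ
      = rightInvDeriv u (rightInvDeriv v φ) - rightInvDeriv v (rightInvDeriv u φ) := by
  have h1 : ∀ (φ : C^∞⟮𝓘(ℝ, E), D; ℝ⟯), rightInvDeriv (modelBracket D u v) φ 1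
      = rightInvDeriv u (rightInvDeriv v φ) 1 - rightInvDeriv v (rightInvDeriv u φ) 1 := by
    intro φ
    have e : ∀ w : E, (fun y : D => mder E ℝ φ y (rightInvariantField (G := D) w y))
        = rightInvDeriv w φ := fun w => funext fun y => mder_apply_rightInvariantField w φ y
    have h := mder_mlieBracket (x := (1 : D)) (h := φ)
      ((contMDiff_rightInvariantField u).contMDiffAt.mdifferentiableAt (by simp))
      ((contMDiff_rightInvariantField v).contMDiffAt.mdifferentiableAt (by simp))
      φ.contMDiff (by rw [e]; exact smooth_mdiffAt (rightInvDeriv u φ).contMDiff 1)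
      (by rw [e]; exact smooth_mdiffAt (rightInvDeriv v φ).contMDiff 1)
    rw [e, e, mder_apply_rightInvariantField, mder_apply_rightInvariantField] at h
    rw [rightInvDeriv_one]
    exact h
  ext x
  have h2 := h1 (translate x φ)
  simp only [rightInvDeriv_translate, translate_apply, one_mul] at h2
  exact h2

/-- Left-invariant and right-invariant derivatives commute. -/
theorem rightInvDeriv_leftInvDeriv (u v : E) (φ : C^∞⟮𝓘(ℝ, E), D; ℝ⟯) :
    rightInvDeriv u (leftInvDeriv v φ) = leftInvDeriv v (rightInvDeriv u φ) := by
  ext x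
  have h : ContMDiff (𝓘(ℝ, E).prod 𝓘(ℝ, E)) 𝓘(ℝ, ℝ) ∞ (fun p : D × D => φ (p.1 * (x * p.2))) :=
    φ.contMDiff.comp (contMDiff_fst.mul (contMDiff_const.mul contMDiff_snd))
  have := mder_mder_comm h 1 1 u v
  simpa only [rightInvDeriv_apply, leftInvDeriv_apply, mul_assoc] using this

theorem eq_of_rightInvDeriv_eq_zero [PreconnectedSpace D] {φ : C^∞⟮𝓘(ℝ, E), D; ℝ⟯}
    (h : ∀ v x, rightInvDeriv v φ x = 0) (x y : D) : φ x = φ y := by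
  refine eq_of_mder_eq_zero (smooth_mdiffAt φ.contMDiff) (fun x w => ?_) x y
  have h1 := mder_comp (g := fun y => φ (y * x)) (f := fun y : D => y * x⁻¹) (x := x)
    (mdiffAt_apply_mul_const φ x _) (mdiffAt_mul_const x⁻¹ x) w
  have h2 : (fun y => φ (y * x)) ∘ (fun y : D => y * x⁻¹) = φ := by ext y; simp
  rw [h2, mul_inv_cancel] at h1
  rw [h1]
  exact h _ x

theorem mder_eq_leftInvDeriv (φ : C^∞⟮𝓘(ℝ, E), D; ℝ⟯) (x : D) (w : E) :
    mder E ℝ φ x w = leftInvDeriv (mder E E (fun y : D => x⁻¹ * y) x w) φ x := by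
  have h1 := mder_comp (g := fun y => φ (x * y)) (f := fun y : D => x⁻¹ * y) (x := x)
    (mdiffAt_apply_const_mul φ x _) (mdiffAt_const_mul x⁻¹ x) w
  have h2 : (fun y => φ (x * y)) ∘ (fun y : D => x⁻¹ * y) = φ := by ext y; simp
  rw [h2, inv_mul_cancel] at h1
  exact h1

theorem leftInvDeriv_add (v : E) (φ ψ : C^∞⟮𝓘(ℝ, E), D; ℝ⟯) :
    leftInvDeriv v (φ + ψ) = leftInvDeriv v φ + leftInvDeriv v ψ := by
  ext x
  exact congrArg (fun T : E →L[ℝ] ℝ => T v)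
    (mder_add (mdiffAt_apply_const_mul φ x 1) (mdiffAt_apply_const_mul ψ x 1))

theorem leftInvDeriv_smul (v : E) (t : ℝ) (φ : C^∞⟮𝓘(ℝ, E), D; ℝ⟯) :
    leftInvDeriv v (t • φ) = t • leftInvDeriv v φ := by
  ext x
  exact congrArg (fun T : E →L[ℝ] ℝ => T v) (mder_smul (mdiffAt_apply_const_mul φ x 1) t)

theorem leftInvDeriv_mul (v : E) (φ ψ : C^∞⟮𝓘(ℝ, E), D; ℝ⟯) :
    leftInvDeriv v (φ * ψ) = leftInvDeriv v φ * ψ + φ * leftInvDeriv v ψ := by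
  ext x
  refine (mder_mul (mdiffAt_apply_const_mul φ x 1) (mdiffAt_apply_const_mul ψ x 1) v).trans ?_
  rw [mul_one]
  rfl

section Homomorphism

variable {E' : Type*} [NormedAddCommGroup E'] [NormedSpace ℝ E']
  {G : Type*} [TopologicalSpace G] [ChartedSpace E' G] [Group G] [LieGroup 𝓘(ℝ, E') ∞ G]

theorem rightInvDeriv_comp (i : G →* D) (hi : ContMDiff 𝓘(ℝ, E') 𝓘(ℝ, E) ∞ i) (v : E')
    (φ : C^∞⟮𝓘(ℝ, E), D; ℝ⟯) (g : G) :
    rightInvDeriv v (φ.comp ⟨i, hi⟩) g = rightInvDeriv (mder E' E i 1 v) φ (i g) := by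
  have h := mder_comp (g := fun y => φ (y * i g)) (f := i) (x := 1)
    (mdiffAt_apply_mul_const φ (i g) _) (smooth_mdiffAt hi 1) v
  have h2 : (fun y => φ (y * i g)) ∘ i = fun y => φ.comp ⟨i, hi⟩ (y * g) := by
    ext y
    exact congrArg φ (map_mul i y g).symm
  rw [h2, map_one] at h
  exact h

theorem leftInvDeriv_comp (i : G →* D) (hi : ContMDiff 𝓘(ℝ, E') 𝓘(ℝ, E) ∞ i) (v : E')
    (φ : C^∞⟮𝓘(ℝ, E), D; ℝ⟯) (g : G) :
    leftInvDeriv v (φ.comp ⟨i, hi⟩) g = leftInvDeriv (mder E' E i 1 v) φ (i g) := by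
  have h := mder_comp (g := fun y => φ (i g * y)) (f := i) (x := 1)
    (mdiffAt_apply_const_mul φ (i g) _) (smooth_mdiffAt hi 1) v
  have h2 : (fun y => φ (i g * y)) ∘ i = fun y => φ.comp ⟨i, hi⟩ (g * y) := by
    ext y
    exact congrArg φ (map_mul i g y).symm
  rw [h2, map_one] at h
  exact h

end Homomorphism

end InvariantDerivatives

theorem coe_sum {E : Type*} [NormedAddCommGroup E] [NormedSpace ℝ E]
    {M : Type*} [TopologicalSpace M] [ChartedSpace E M] {ι : Type*} (s : Finset ι)
    (f : ι → C^∞⟮𝓘(ℝ, E), M; ℝ⟯) (x : M) : (∑ i ∈ s, f i) x = ∑ i ∈ s, f i x := by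
  have := map_sum (ContMDiffMap.coeFnRingHom (I := 𝓘(ℝ, E)) (N := M) (R := ℝ)
    (I' := 𝓘(ℝ, ℝ)) (n := ∞)) f s
  simpa using congrFun this x

section Adjoint

variable {E : Type*} [NormedAddCommGroup E] [NormedSpace ℝ E]
  {D : Type*} [TopologicalSpace D] [ChartedSpace E D] [Group D] [LieGroup 𝓘(ℝ, E) ∞ D]

/-- The adjoint action: the differential at the identity of the conjugation by `x`. -/
def adjointMap (x : D) : E →L[ℝ] E := mder E E (fun y : D => x * y * x⁻¹) 1

theorem contMDiff_conj (x : D) : ContMDiff 𝓘(ℝ, E) 𝓘(ℝ, E) ∞ (fun y : D => x * y * x⁻¹) :=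
  (contMDiff_const.mul contMDiff_id).mul contMDiff_const

omit [LieGroup 𝓘(ℝ, E) ∞ D] in
theorem adjointMap_one (v : E) : adjointMap (1 : D) v = v := by
  rw [adjointMap]
  simpa using mder_id (1 : D) v

theorem adjointMap_mul (x z : D) (v : E) :
    adjointMap (x * z) v = adjointMap x (adjointMap z v) := by
  have h := mder_comp (g := fun y : D => x * y * x⁻¹) (f := fun y : D => z * y * z⁻¹) (x := 1)
    (smooth_mdiffAt (contMDiff_conj x) _) (smooth_mdiffAt (contMDiff_conj z) _) v
  have h2 : (fun y : D => x * y * x⁻¹) ∘ (fun y : D => z * y * z⁻¹)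
      = fun y : D => (x * z) * y * (x * z)⁻¹ := by ext y; simp [mul_assoc]
  rw [h2] at h
  refine h.trans ?_
  simp only [mul_one, mul_inv_cancel]
  rfl

theorem adjointMap_inv_apply (x : D) (v : E) : adjointMap x (adjointMap x⁻¹ v) = v := by
  rw [← adjointMap_mul, mul_inv_cancel, adjointMap_one]

theorem leftInvDeriv_eq_rightInvDeriv (v : E) (φ : C^∞⟮𝓘(ℝ, E), D; ℝ⟯) (x : D) :
    leftInvDeriv v φ x = rightInvDeriv (adjointMap x v) φ x := by
  have h := mder_comp (g := fun y => φ (y * x)) (f := fun y : D => x * y * x⁻¹) (x := 1)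
    (mdiffAt_apply_mul_const φ x _) (smooth_mdiffAt (contMDiff_conj x) _) v
  have h2 : (fun y => φ (y * x)) ∘ (fun y : D => x * y * x⁻¹) = fun y => φ (x * y) := by
    ext y; simp
  rw [h2] at h
  simp only [mul_one, mul_inv_cancel] at h
  exact h

theorem adjointMap_map {E' : Type*} [NormedAddCommGroup E'] [NormedSpace ℝ E']
    {G : Type*} [TopologicalSpace G] [ChartedSpace E' G] [Group G] [LieGroup 𝓘(ℝ, E') ∞ G]
    (i : G →* D) (hi : ContMDiff 𝓘(ℝ, E') 𝓘(ℝ, E) ∞ i) (g : G) (v : E') :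
    adjointMap (i g) (mder E' E i 1 v) = mder E' E i 1 (adjointMap g v) := by
  have h1 := mder_comp (g := fun y : D => i g * y * (i g)⁻¹) (f := i) (x := 1)
    (smooth_mdiffAt (contMDiff_conj (i g)) _) (smooth_mdiffAt hi 1) v
  have h2 := mder_comp (g := i) (f := fun y : G => g * y * g⁻¹) (x := 1)
    (smooth_mdiffAt hi _) (smooth_mdiffAt (contMDiff_conj g) 1) v
  have h3 : (fun y : D => i g * y * (i g)⁻¹) ∘ i = i ∘ fun y : G => g * y * g⁻¹ := by
    ext y; simp
  rw [h3, h2, map_one] at h1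
  simp only [mul_one, mul_inv_cancel] at h1
  exact h1.symm

variable [FiniteDimensional ℝ E]

theorem contMDiff_adjointMap (l : E →L[ℝ] ℝ) (v : E) :
    ContMDiff 𝓘(ℝ, E) 𝓘(ℝ, ℝ) ∞ (fun x : D => l (adjointMap x v)) := by
  have := t2Space_of_lieGroup (E := E) (D := D)
  obtain ⟨χ, hχ⟩ := exists_mder_eq (1 : D) l
  have h1 : ContMDiff (𝓘(ℝ, E).prod 𝓘(ℝ, E)) 𝓘(ℝ, ℝ) ∞
      (fun p : D × D => χ (p.1 * p.2 * p.1⁻¹)) :=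
    χ.contMDiff.comp ((contMDiff_fst.mul contMDiff_snd).mul contMDiff_fst.inv)
  refine (contMDiff_mder_right h1 1 v).congr fun x => ?_
  have h2 := mder_comp (g := χ) (f := fun y : D => x * y * x⁻¹) (x := 1)
    (smooth_mdiffAt χ.contMDiff _) (smooth_mdiffAt (contMDiff_conj x) _) v
  rw [← hχ]
  simp only [mul_one, mul_inv_cancel] at h2
  exact h2.symm

/-- The matrix coefficient `x ↦ l (Ad_x v)` of the adjoint action. -/
def adjointCoeff (l : E →L[ℝ] ℝ) (v : E) : C^∞⟮𝓘(ℝ, E), D; ℝ⟯ :=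
  ⟨fun x => l (adjointMap x v), contMDiff_adjointMap l v⟩

theorem adjointCoeff_apply (l : E →L[ℝ] ℝ) (v : E) (x : D) :
    adjointCoeff l v x = l (adjointMap x v) := rfl

/-- The differential of the adjoint action. The sign comes from the convention for `lieBr`, which
is the bracket of right-invariant vector fields. -/
theorem rightInvDeriv_adjointCoeff (l : E →L[ℝ] ℝ) (u v : E) (x : D) :
    rightInvDeriv u (adjointCoeff l v) x = -l (modelBracket D u (adjointMap x v)) := by
  have : CompleteSpace E := FiniteDimensional.complete ℝ E
  have := t2Space_of_lieGroup (E := E) (D := D)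
  have h1 : ∀ v : E, rightInvDeriv u (adjointCoeff (D := D) l v) 1
      = -l (modelBracket D u v) := by
    intro v
    obtain ⟨φ, hφ⟩ := exists_mder_eq (1 : D) l
    let e := Module.finBasis ℝ E
    let co : Fin (Module.finrank ℝ E) → E →L[ℝ] ℝ := fun k =>
      LinearMap.toContinuousLinearMap (e.coord k)
    have hexp : ∀ w : E, ∑ k, co k w • e k = w := fun w => e.sum_repr w
    -- the left-invariant derivative in terms of the right-invariant ones
    have h2 : leftInvDeriv v φ = ∑ k, adjointCoeff (co k) v * rightInvDeriv (e k) φ := by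
      ext x
      rw [leftInvDeriv_eq_rightInvDeriv, coe_sum]
      conv_lhs => rw [← hexp (adjointMap x v), map_sum, LinearMap.sum_apply, coe_sum]
      refine Finset.sum_congr rfl fun k _ => ?_
      rw [map_smul]
      rfl
    have h3 := congrArg (fun ψ => rightInvDeriv u ψ 1) h2
    simp only [rightInvDeriv_leftInvDeriv, map_sum, rightInvDeriv_mul, coe_sum] at h3
    have h4 : leftInvDeriv v (rightInvDeriv u φ) 1 = rightInvDeriv v (rightInvDeriv u φ) 1 := by
      rw [leftInvDeriv_one, rightInvDeriv_one]
    have h5 : ∀ k, (rightInvDeriv u (adjointCoeff (co k) v) * rightInvDeriv (e k) φ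
        + adjointCoeff (co k) v * rightInvDeriv u (rightInvDeriv (e k) φ) : C^∞⟮𝓘(ℝ, E), D; ℝ⟯) 1
        = rightInvDeriv u (adjointCoeff (D := D) (co k) v) 1 * l (e k)
          + co k v * rightInvDeriv u (rightInvDeriv (e k) φ) 1 := by
      intro k
      change _ * rightInvDeriv (e k) φ 1 + co k (adjointMap (1 : D) v) * _ = _
      rw [rightInvDeriv_one (e k) φ, hφ, adjointMap_one]
    have h6 : ∑ k, co k v * rightInvDeriv u (rightInvDeriv (e k) φ) 1
        = rightInvDeriv u (rightInvDeriv v φ) 1 := by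
      conv_rhs => rw [← hexp v]
      simp only [map_sum, LinearMap.sum_apply, map_smul, LinearMap.smul_apply, coe_sum]
      rfl
    have h7 : adjointCoeff (D := D) l v = ∑ k, l (e k) • adjointCoeff (co k) v := by
      ext x
      rw [adjointCoeff_apply, coe_sum]
      conv_lhs => rw [← hexp (adjointMap x v), map_sum]
      refine Finset.sum_congr rfl fun k _ => ?_
      rw [map_smul, smul_eq_mul, mul_comm]
      rfl
    have h8 : l (modelBracket D u v) = rightInvDeriv u (rightInvDeriv v φ) 1
        - rightInvDeriv v (rightInvDeriv u φ) 1 := by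
      have := congrArg (fun ψ : C^∞⟮𝓘(ℝ, E), D; ℝ⟯ => ψ 1) (rightInvDeriv_lieBr u v φ)
      simp only [rightInvDeriv_one (modelBracket D u v) φ, hφ] at this
      exact this
    rw [h4, Finset.sum_congr rfl fun k _ => h5 k, Finset.sum_add_distrib, h6] at h3
    rw [h7, map_sum, coe_sum, h8, h3]
    have h9 : ∀ k, rightInvDeriv u (l (e k) • adjointCoeff (D := D) (co k) v) 1
        = rightInvDeriv u (adjointCoeff (D := D) (co k) v) 1 * l (e k) := fun k => by
      rw [map_smul, mul_comm]
      rfl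
    rw [Finset.sum_congr rfl fun k _ => h9 k]
    ring
  have h2 : translate x (adjointCoeff (D := D) l v) = adjointCoeff l (adjointMap x v) := by
    ext y
    rw [translate_apply, adjointCoeff_apply, adjointMap_mul]
    rfl
  have h3 := h1 (adjointMap x v)
  rw [← h2, rightInvDeriv_translate, translate_apply, one_mul] at h3
  exact h3

/-- On a connected group, a bilinear form that is infinitesimally invariant is invariant. -/
theorem adjointMap_invariant [PreconnectedSpace D] (Q : E →ₗ[ℝ] E →ₗ[ℝ] ℝ)
    (hQ : ∀ u v w : E, Q (modelBracket D u v) w + Q v (modelBracket D u w) = 0)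
    (x : D) (v w : E) : Q (adjointMap x v) (adjointMap x w) = Q v w := by
  let e := Module.finBasis ℝ E
  let co : Fin (Module.finrank ℝ E) → E →L[ℝ] ℝ := fun k =>
    LinearMap.toContinuousLinearMap (e.coord k)
  let q : Fin (Module.finrank ℝ E) → E →L[ℝ] ℝ := fun k =>
    LinearMap.toContinuousLinearMap (Q (e k))
  have hexp : ∀ v w : E, ∑ k, co k v * q k w = Q v w := fun v w => by
    have h := congrArg (fun z => Q z w) (e.sum_repr v)
    simp only [map_sum, LinearMap.sum_apply, map_smul, LinearMap.smul_apply, smul_eq_mul] at h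
    exact h
  let Φ : C^∞⟮𝓘(ℝ, E), D; ℝ⟯ := ∑ k, adjointCoeff (co k) v * adjointCoeff (q k) w
  have hΦ : ∀ x, Φ x = Q (adjointMap x v) (adjointMap x w) := fun x => by
    rw [← hexp, coe_sum]; rfl
  have h0 : ∀ u x, rightInvDeriv u Φ x = 0 := by
    intro u x
    simp only [Φ, map_sum, rightInvDeriv_mul, coe_sum]
    have h1 : ∀ k, (rightInvDeriv u (adjointCoeff (co k) v) * adjointCoeff (q k) w
        + adjointCoeff (co k) v * rightInvDeriv u (adjointCoeff (q k) w) :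
          C^∞⟮𝓘(ℝ, E), D; ℝ⟯) x
        = -(co k (modelBracket D u (adjointMap x v)) * q k (adjointMap x w)
          + co k (adjointMap x v) * q k (modelBracket D u (adjointMap x w))) := by
      intro k
      change rightInvDeriv u (adjointCoeff (co k) v) x * q k (adjointMap x w)
        + co k (adjointMap x v) * rightInvDeriv u (adjointCoeff (q k) w) x = _
      rw [rightInvDeriv_adjointCoeff, rightInvDeriv_adjointCoeff]
      ring
    rw [Finset.sum_congr rfl fun k _ => h1 k, Finset.sum_neg_distrib, Finset.sum_add_distrib,
      hexp, hexp, hQ, neg_zero]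
  have h1 := eq_of_rightInvDeriv_eq_zero h0 x 1
  rwa [hΦ, hΦ, adjointMap_one, adjointMap_one] at h1

end Adjoint

/-! ### Manin triples and the Jacobi identity -/

section Jacobi

variable {A ι : Type*} [CommRing A] [Fintype ι] (X F : ι → A →+ A)

/-- The Jacobi identity for `β(φ, ψ) = ∑ i, F i φ * X i ψ`, when the derivations `X i`, `F i`
satisfy the commutation relations of a Manin triple in dual bases, with structure constants `a`, `b`,
and the symmetric part of `β` vanishes. -/
theorem jacobi_of_structure_constants (a b : ι → ι → ι → A)
    (hX : ∀ i φ ψ, X i (φ * ψ) = X i φ * ψ + φ * X i ψ)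
    (hF : ∀ i φ ψ, F i (φ * ψ) = F i φ * ψ + φ * F i ψ)
    (hXX : ∀ i k φ, X i (X k φ) - X k (X i φ) = ∑ m, a i k m * X m φ)
    (hFF : ∀ i k φ, F i (F k φ) - F k (F i φ) = ∑ m, b i k m * F m φ)
    (hXF : ∀ i k φ, X i (F k φ) - F k (X i φ) = ∑ m, b k m i * X m φ - ∑ m, a i m k * F m φ)
    (hb : ∀ i k m, b i k m = -b k i m)
    (hcas : ∀ φ ψ, ∑ i, (F i φ * X i ψ + X i φ * F i ψ) = 0) (φ ψ χ : A) :
    ∑ i, F i φ * X i (∑ k, F k ψ * X k χ) - ∑ k, F k ψ * X k (∑ i, F i φ * X i χ)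
      - ∑ k, F k (∑ i, F i φ * X i ψ) * X k χ = 0 := by
  have h1 : ∑ i, F i φ * X i (∑ k, F k ψ * X k χ)
      = ∑ i, ∑ k, (F i φ * X k χ * X i (F k ψ) + F i φ * F k ψ * X i (X k χ)) := by
    refine Finset.sum_congr rfl fun i _ => ?_
    rw [map_sum, Finset.mul_sum]
    exact Finset.sum_congr rfl fun k _ => by rw [hX]; ring
  have h2 : ∑ k, F k ψ * X k (∑ i, F i φ * X i χ)
      = ∑ i, ∑ k, (F k ψ * X k (F i φ) * X i χ + F i φ * F k ψ * X k (X i χ)) := by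
    rw [Finset.sum_comm]
    refine Finset.sum_congr rfl fun i _ => ?_
    rw [map_sum, Finset.mul_sum]
    exact Finset.sum_congr rfl fun k _ => by rw [hX]; ring
  have h3 : ∑ k, F k (∑ i, F i φ * X i ψ) * X k χ
      = ∑ i, ∑ k, (F k (F i φ) * X i ψ * X k χ + F i φ * X k χ * F k (X i ψ)) := by
    rw [Finset.sum_comm]
    refine Finset.sum_congr rfl fun i _ => ?_
    rw [map_sum, Finset.sum_mul]
    exact Finset.sum_congr rfl fun k _ => by rw [hF]; ring
  -- the vanishing of the symmetric part exchanges `F` and `X` here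
  have h4 : ∑ i, ∑ k, F k ψ * X k (F i φ) * X i χ
      = -∑ i, ∑ k, X i ψ * F i (F k φ) * X k χ := by
    rw [Finset.sum_comm (f := fun i k => X i ψ * F i (F k φ) * X k χ), ← Finset.sum_neg_distrib]
    refine Finset.sum_congr rfl fun i _ => ?_
    have h := hcas ψ (F i φ)
    rw [Finset.sum_add_distrib] at h
    rw [← Finset.sum_mul, ← Finset.sum_mul, eq_neg_of_add_eq_zero_left h, neg_mul]
  have h5 : ∑ i, ∑ k, F i φ * F k ψ * (X i (X k χ) - X k (X i χ))
      = ∑ i, ∑ k, ∑ m, a i k m * F i φ * F k ψ * X m χ := by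
    refine Finset.sum_congr rfl fun i _ => Finset.sum_congr rfl fun k _ => ?_
    rw [hXX, Finset.mul_sum]
    exact Finset.sum_congr rfl fun m _ => by ring
  have h6 : ∑ i, ∑ k, F i φ * X k χ * (X i (F k ψ) - F k (X i ψ))
      = (∑ i, ∑ k, ∑ m, b k m i * F i φ * X k χ * X m ψ)
        - ∑ i, ∑ k, ∑ m, a i m k * F i φ * F m ψ * X k χ := by
    rw [← Finset.sum_sub_distrib]
    refine Finset.sum_congr rfl fun i _ => ?_
    rw [← Finset.sum_sub_distrib]
    refine Finset.sum_congr rfl fun k _ => ?_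
    rw [hXF, mul_sub, Finset.mul_sum, Finset.mul_sum]
    congr 1 <;> exact Finset.sum_congr rfl fun m _ => by ring
  have h7 : ∑ i, ∑ k, X i ψ * X k χ * (F i (F k φ) - F k (F i φ))
      = ∑ i, ∑ k, ∑ m, b i k m * F m φ * X k χ * X i ψ := by
    refine Finset.sum_congr rfl fun i _ => Finset.sum_congr rfl fun k _ => ?_
    rw [hFF, Finset.mul_sum]
    exact Finset.sum_congr rfl fun m _ => by ring
  have h8 : ∑ i, ∑ k, ∑ m, a i m k * F i φ * F m ψ * X k χ
      = ∑ i, ∑ k, ∑ m, a i k m * F i φ * F k ψ * X m χ :=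
    Finset.sum_congr rfl fun i _ => Finset.sum_comm
  have h9 : ∑ i, ∑ k, ∑ m, b i k m * F m φ * X k χ * X i ψ
      = -∑ i, ∑ k, ∑ m, b k m i * F i φ * X k χ * X m ψ := by
    rw [Finset.sum_comm' (t' := Finset.univ) (s' := fun _ => Finset.univ) (by simp)]
    rw [Finset.sum_comm (f := fun i k => ∑ m, b k m i * F i φ * X k χ * X m ψ),
      ← Finset.sum_neg_distrib]
    refine Finset.sum_congr rfl fun k _ => ?_
    rw [Finset.sum_comm, ← Finset.sum_neg_distrib]
    refine Finset.sum_congr rfl fun m _ => ?_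
    rw [← Finset.sum_neg_distrib]
    exact Finset.sum_congr rfl fun i _ => by rw [hb i k m]; ring
  rw [h8] at h6
  rw [h9] at h7
  rw [h1, h2, h3]
  simp only [Finset.sum_add_distrib, mul_sub, Finset.sum_sub_distrib] at h4 h5 h6 h7 ⊢
  rw [h4]
  have h10 : ∑ i, ∑ k, X i ψ * F i (F k φ) * X k χ = ∑ i, ∑ k, X i ψ * X k χ * F i (F k φ) :=
    Finset.sum_congr rfl fun i _ => Finset.sum_congr rfl fun k _ => by ring
  have h11 : ∑ i, ∑ k, F k (F i φ) * X i ψ * X k χ = ∑ i, ∑ k, X i ψ * X k χ * F k (F i φ) :=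
    Finset.sum_congr rfl fun i _ => Finset.sum_congr rfl fun k _ => by ring
  rw [h10, h11]
  linear_combination h5 + h6 + h7

end Jacobi

section ManinTriple

variable (V₁ V₂ : Type*) [AddCommGroup V₁] [Module ℝ V₁] [AddCommGroup V₂] [Module ℝ V₂]

/-- A Manin triple `(V₁ ⊕ V₂, V₁, V₂)`: a skew-symmetric bracket on the sum of two spaces in
duality, for which the summands are subalgebras and the canonical form is invariant. The Jacobi
identity and the bilinearity are not part of the structure: they follow from a realization by
derivations wherever they are used. -/
structure ManinTriple where
  /-- the duality between the summands -/
  pair : V₂ ≃ₗ[ℝ] Module.Dual ℝ V₁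
  br : V₁ × V₂ → V₁ × V₂ → V₁ × V₂
  br₁ : V₁ → V₁ → V₁
  br₂ : V₂ → V₂ → V₂
  br_inl : ∀ X Y, br (X, 0) (Y, 0) = (br₁ X Y, 0)
  br_inr : ∀ f h, br (0, f) (0, h) = (0, br₂ f h)
  br_skew : ∀ a b, br a b = -br b a
  br_invariant : ∀ a b c, pair (br a b).2 c.1 + pair c.2 (br a b).1
    = pair a.2 (br b c).1 + pair (br b c).2 a.1

variable {V₁ V₂}

namespace ManinTriple

variable (T : ManinTriple V₁ V₂)

/-- The canonical symmetric form of a Manin triple. -/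
def bilin : V₁ × V₂ →ₗ[ℝ] V₁ × V₂ →ₗ[ℝ] ℝ :=
  LinearMap.mk₂ ℝ (fun a b => T.pair a.2 b.1 + T.pair b.2 a.1)
    (fun a a' b => by simp; ring) (fun t a b => by simp; ring)
    (fun a b b' => by simp; ring) (fun t a b => by simp; ring)

theorem bilin_apply (a b : V₁ × V₂) : T.bilin a b = T.pair a.2 b.1 + T.pair b.2 a.1 := rfl

theorem bilin_br (a b c : V₁ × V₂) : T.bilin (T.br a b) c = T.bilin a (T.br b c) :=
  T.br_invariant a b c

theorem br₂_skew (f h : V₂) : T.br₂ f h = -T.br₂ h f := by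
  have := T.br_skew (0, f) (0, h)
  rw [T.br_inr, T.br_inr] at this
  simpa using congrArg Prod.snd this

theorem pair_br_inl_inr_snd (X : V₁) (f : V₂) (Z : V₁) :
    T.pair (T.br (X, 0) (0, f)).2 Z = -T.pair f (T.br₁ X Z) := by
  have := T.bilin_br (0, f) (X, 0) (Z, 0)
  rw [T.br_skew, T.br_inl, map_neg, LinearMap.neg_apply, bilin_apply, bilin_apply] at this
  simp at this
  linarith

theorem pair_br_inl_inr_fst (X : V₁) (f h : V₂) :
    T.pair h (T.br (X, 0) (0, f)).1 = T.pair (T.br₂ f h) X := by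
  have := T.bilin_br (X, 0) (0, f) (0, h)
  rw [T.br_inr, bilin_apply, bilin_apply] at this
  simpa using this

section Basis

variable {ι : Type*} [Fintype ι] (e : Module.Basis ι ℝ V₁)

/-- The basis of `V₂` dual to a basis of `V₁`. -/
def dualVec (k : ι) : V₂ := T.pair.symm (e.coord k)

omit [Fintype ι] in
theorem pair_dualVec (k : ι) (X : V₁) : T.pair (T.dualVec e k) X = e.coord k X := by
  simp [dualVec]

theorem sum_pair_dualVec_smul (X : V₁) : ∑ k, T.pair (T.dualVec e k) X • e k = X := by
  simp_rw [pair_dualVec]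
  exact e.sum_repr X

theorem sum_pair_smul_dualVec (f : V₂) : ∑ k, T.pair f (e k) • T.dualVec e k = f := by
  refine T.pair.injective (LinearMap.ext fun X => ?_)
  conv_rhs => rw [← T.sum_pair_dualVec_smul e X]
  simp [mul_comm]

theorem sum_smul_inl_add_sum_smul_inr (a : V₁ × V₂) :
    ∑ k, T.pair (T.dualVec e k) a.1 • ((e k, 0) : V₁ × V₂)
      + ∑ k, T.pair a.2 (e k) • ((0, T.dualVec e k) : V₁ × V₂) = a := by
  refine Prod.ext ?_ ?_
  · simp only [Prod.fst_add, Prod.fst_sum, Prod.smul_fst, smul_zero, Finset.sum_const_zero,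
      add_zero, sum_pair_dualVec_smul]
  · simp only [Prod.snd_add, Prod.snd_sum, Prod.smul_snd, smul_zero, Finset.sum_const_zero,
      zero_add, sum_pair_smul_dualVec]

variable {A : Type*} [CommRing A] [Algebra ℝ A] (ρ : V₁ × V₂ →ₗ[ℝ] A →ₗ[ℝ] A)

/-- The operation `∑ k, ρ(f k) φ * ρ(e k) ψ` for dual bases `e` of `V₁` and `f` of `V₂`. -/
def biDer : A →ₗ[ℝ] A →ₗ[ℝ] A :=
  LinearMap.mk₂ ℝ (fun φ ψ => ∑ k, ρ (0, T.dualVec e k) φ * ρ (e k, 0) ψ)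
    (fun φ φ' ψ => by simp [add_mul, Finset.sum_add_distrib])
    (fun t φ ψ => by simp [Finset.smul_sum])
    (fun φ ψ ψ' => by simp [mul_add, Finset.sum_add_distrib])
    (fun t φ ψ => by simp [Finset.smul_sum])

theorem biDer_apply (φ ψ : A) :
    T.biDer e ρ φ ψ = ∑ k, ρ (0, T.dualVec e k) φ * ρ (e k, 0) ψ := rfl

/-- `biDer` satisfies the Jacobi identity if `ρ` is a representation by derivations for which
`biDer` is skew-symmetric. -/
theorem biDer_jacobi
    (hder : ∀ a φ ψ, ρ a (φ * ψ) = ρ a φ * ψ + φ * ρ a ψ)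
    (hbr : ∀ a b φ, ρ (T.br a b) φ = ρ a (ρ b φ) - ρ b (ρ a φ))
    (hskew : ∀ φ ψ, T.biDer e ρ φ ψ = -T.biDer e ρ ψ φ) (φ ψ χ : A) :
    T.biDer e ρ φ (T.biDer e ρ ψ χ) + T.biDer e ρ ψ (T.biDer e ρ χ φ)
      + T.biDer e ρ χ (T.biDer e ρ φ ψ) = 0 := by
  have hρ : ∀ a φ, ρ a φ = ∑ k, algebraMap ℝ A (T.pair (T.dualVec e k) a.1) * ρ (e k, 0) φ
      + ∑ k, algebraMap ℝ A (T.pair a.2 (e k)) * ρ (0, T.dualVec e k) φ := by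
    intro a φ
    conv_lhs => rw [← T.sum_smul_inl_add_sum_smul_inr e a]
    simp only [map_add, map_sum, map_smul, LinearMap.add_apply, LinearMap.sum_apply,
      LinearMap.smul_apply]
    simp only [Algebra.smul_def]
  have h := jacobi_of_structure_constants (fun k => (ρ (e k, 0)).toAddMonoidHom)
    (fun k => (ρ (0, T.dualVec e k)).toAddMonoidHom)
    (fun i k m => algebraMap ℝ A (T.pair (T.dualVec e m) (T.br₁ (e i) (e k))))
    (fun i k m => algebraMap ℝ A (T.pair (T.br₂ (T.dualVec e i) (T.dualVec e k)) (e m)))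
    (fun i => hder _) (fun i => hder _)
    (fun i k φ => by
      refine (hbr _ _ φ).symm.trans ?_
      rw [T.br_inl, hρ]
      simp)
    (fun i k φ => by
      refine (hbr _ _ φ).symm.trans ?_
      rw [T.br_inr, hρ]
      simp)
    (fun i k φ => by
      refine (hbr _ _ φ).symm.trans ?_
      rw [hρ, sub_eq_add_neg, ← Finset.sum_neg_distrib]
      simp only [pair_br_inl_inr_fst, pair_br_inl_inr_snd, map_neg, neg_mul]
      rfl)
    (fun i k m => by rw [T.br₂_skew]; simp)
    (fun φ ψ => by
      have := hskew φ ψ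
      rw [biDer_apply, biDer_apply, eq_neg_iff_add_eq_zero, ← Finset.sum_add_distrib] at this
      rw [← this]
      exact Finset.sum_congr rfl fun k _ => by simp [mul_comm]) φ ψ χ
  have h' : T.biDer e ρ φ (T.biDer e ρ ψ χ) - T.biDer e ρ ψ (T.biDer e ρ φ χ)
      - T.biDer e ρ (T.biDer e ρ φ ψ) χ = 0 := h
  rw [hskew χ φ, map_neg, hskew χ]
  linear_combination h'

theorem biDer_leibniz (hder : ∀ a φ ψ, ρ a (φ * ψ) = ρ a φ * ψ + φ * ρ a ψ) (φ ψ χ : A) :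
    T.biDer e ρ φ (ψ * χ) = T.biDer e ρ φ ψ * χ + ψ * T.biDer e ρ φ χ := by
  simp only [biDer_apply, Finset.sum_mul, Finset.mul_sum, ← Finset.sum_add_distrib, hder]
  exact Finset.sum_congr rfl fun k _ => by ring

end Basis

end ManinTriple

end ManinTriple

/-! ### Reduction to the quotient -/

section AdjointOn

variable {E : Type*} [NormedAddCommGroup E] [NormedSpace ℝ E]
  {D : Type*} [TopologicalSpace D] [ChartedSpace E D] [Group D] [LieGroup 𝓘(ℝ, E) ∞ D]
  {V : Type*} [AddCommGroup V] [Module ℝ V] (c : V ≃ₗ[ℝ] E)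

/-- The adjoint action, transported to a vector space `V` identified with the Lie algebra. -/
def adjointOn (x : D) : V →ₗ[ℝ] V :=
  c.symm.toLinearMap ∘ₗ (adjointMap x).toLinearMap ∘ₗ c.toLinearMap

omit [LieGroup 𝓘(ℝ, E) ∞ D] in
theorem apply_adjointOn (x : D) (v : V) : c (adjointOn c x v) = adjointMap x (c v) := by
  simp [adjointOn]

theorem adjointOn_one (v : V) : adjointOn c (1 : D) v = v := by
  apply c.injective
  rw [apply_adjointOn, adjointMap_one]

theorem adjointOn_mul (x y : D) (v : V) :
    adjointOn c (x * y) v = adjointOn c x (adjointOn c y v) := by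
  apply c.injective
  simp only [apply_adjointOn, adjointMap_mul]

theorem adjointOn_inv_apply (x : D) (v : V) : adjointOn c x (adjointOn c x⁻¹ v) = v := by
  rw [← adjointOn_mul, mul_inv_cancel, adjointOn_one]

/-- The linear form `X ↦ d/dt|_{t=0} φ(x e^{tX})`. -/
def leftForm (φ : C^∞⟮𝓘(ℝ, E), D; ℝ⟯) (x : D) : Module.Dual ℝ V :=
  (mder E ℝ (fun y => φ (x * y)) 1).toLinearMap ∘ₗ c.toLinearMap

/-- The linear form `X ↦ d/dt|_{t=0} φ(e^{tX} x)`. -/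
def rightForm (φ : C^∞⟮𝓘(ℝ, E), D; ℝ⟯) (x : D) : Module.Dual ℝ V :=
  (mder E ℝ (fun y => φ (y * x)) 1).toLinearMap ∘ₗ c.toLinearMap

theorem leftForm_apply (φ : C^∞⟮𝓘(ℝ, E), D; ℝ⟯) (x : D) (v : V) :
    leftForm c φ x v = leftInvDeriv (c v) φ x := rfl

theorem rightForm_apply (φ : C^∞⟮𝓘(ℝ, E), D; ℝ⟯) (x : D) (v : V) :
    rightForm c φ x v = rightInvDeriv (c v) φ x := rfl

theorem leftForm_apply_eq_rightForm (φ : C^∞⟮𝓘(ℝ, E), D; ℝ⟯) (x : D) (v : V) :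
    leftForm c φ x v = rightForm c φ x (adjointOn c x v) := by
  rw [leftForm_apply, rightForm_apply, leftInvDeriv_eq_rightInvDeriv, apply_adjointOn]

theorem rightForm_apply_eq_leftForm (φ : C^∞⟮𝓘(ℝ, E), D; ℝ⟯) (x : D) (v : V) :
    rightForm c φ x v = leftForm c φ x (adjointOn c x⁻¹ v) := by
  rw [leftForm_apply_eq_rightForm, adjointOn_inv_apply]

end AdjointOn

section Isotropy

variable {V₁ V₂ : Type*} [AddCommGroup V₁] [Module ℝ V₁] [AddCommGroup V₂] [Module ℝ V₂]
  (T : ManinTriple V₁ V₂)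
  {E : Type*} [NormedAddCommGroup E] [NormedSpace ℝ E] [FiniteDimensional ℝ E]
  {D : Type*} [TopologicalSpace D] [ChartedSpace E D] [Group D] [LieGroup 𝓘(ℝ, E) ∞ D]
  (c : (V₁ × V₂) ≃ₗ[ℝ] E)

/-- The canonical form of a Manin triple is invariant under the adjoint action of a connected group
that integrates it. -/
theorem ManinTriple.bilin_adjointOn [PreconnectedSpace D]
    (hc : ∀ a b, c (T.br a b) = modelBracket D (c a) (c b)) (x : D) (a b : V₁ × V₂) :
    T.bilin (adjointOn c x a) (adjointOn c x b) = T.bilin a b := by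
  have h := adjointMap_invariant (D := D)
    (T.bilin.compl₁₂ c.symm.toLinearMap c.symm.toLinearMap) (fun u v w => by
      obtain ⟨u, rfl⟩ := c.surjective u
      obtain ⟨v, rfl⟩ := c.surjective v
      obtain ⟨w, rfl⟩ := c.surjective w
      simp only [LinearMap.compl₁₂_apply, LinearEquiv.coe_coe, ← hc, c.symm_apply_apply]
      rw [T.br_skew u v, map_neg, LinearMap.neg_apply, T.bilin_br]
      ring) x (c a) (c b)
  simpa [adjointOn] using h

theorem ManinTriple.bilin_adjointOn_left [PreconnectedSpace D]
    (hc : ∀ a b, c (T.br a b) = modelBracket D (c a) (c b)) (x : D) (a b : V₁ × V₂) :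
    T.bilin (adjointOn c x a) b = T.bilin a (adjointOn c x⁻¹ b) := by
  rw [← T.bilin_adjointOn c hc x a, adjointOn_inv_apply]

omit [FiniteDimensional ℝ E] [LieGroup 𝓘(ℝ, E) ∞ D] in
/-- A smooth function whose left-invariant derivatives along `V₂` vanish at `x` has at `x` a left
differential represented by an element of `V₂`. -/
theorem ManinTriple.leftForm_eq_of_isotropic {φ : C^∞⟮𝓘(ℝ, E), D; ℝ⟯} {x : D}
    (h : ∀ f, leftForm c φ x (0, f) = 0) (a : V₁ × V₂) :
    leftForm c φ x a
      = T.bilin (0, T.pair.symm (leftForm c φ x ∘ₗ LinearMap.inl ℝ V₁ V₂)) a := by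
  have e : a = (a.1, 0) + (0, a.2) := by simp
  conv_lhs => rw [e, map_add, h, add_zero]
  simp [T.bilin_apply]

theorem ManinTriple.rightForm_eq_of_isotropic [PreconnectedSpace D]
    (hc : ∀ a b, c (T.br a b) = modelBracket D (c a) (c b)) {φ : C^∞⟮𝓘(ℝ, E), D; ℝ⟯} {x : D}
    (h : ∀ f, leftForm c φ x (0, f) = 0) (a : V₁ × V₂) :
    rightForm c φ x a = T.bilin (adjointOn c x
      (0, T.pair.symm (leftForm c φ x ∘ₗ LinearMap.inl ℝ V₁ V₂))) a := by
  rw [rightForm_apply_eq_leftForm, T.leftForm_eq_of_isotropic c h, T.bilin_adjointOn_left c hc]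

theorem ManinTriple.sum_bilin {ι : Type*} [Fintype ι] (e : Module.Basis ι ℝ V₁)
    (p q : V₁ × V₂) :
    ∑ k, T.bilin p (0, T.dualVec e k) * T.bilin q (e k, 0) = T.pair q.2 p.1 := by
  conv_rhs => rw [← T.sum_pair_dualVec_smul e p.1]
  simp [T.bilin_apply]

omit [FiniteDimensional ℝ E] in
theorem leftForm_inr_eq_zero
    {E' : Type*} [NormedAddCommGroup E'] [NormedSpace ℝ E']
    {K : Type*} [TopologicalSpace K] [ChartedSpace E' K] [Group K] (b : V₂ ≃ₗ[ℝ] E')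
    (j : K →* D) (hj : ContMDiff 𝓘(ℝ, E') 𝓘(ℝ, E) ∞ j)
    (hjb : ∀ f, mder E' E j 1 (b f) = c (0, f)) {φ : C^∞⟮𝓘(ℝ, E), D; ℝ⟯}
    (hφ : ∀ x u, φ (x * j u) = φ x) (x : D) (f : V₂) : leftForm c φ x (0, f) = 0 := by
  have h := mder_comp (g := fun y => φ (x * y)) (f := j) (x := 1)
    (mdiffAt_apply_const_mul φ x _) (smooth_mdiffAt hj 1) (b f)
  have h2 : (fun y => φ (x * y)) ∘ j = fun _ => φ x := by ext u; exact hφ x u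
  rw [h2, mder_const, hjb, map_one] at h
  exact h.symm

end Isotropy

section Descent

variable {E : Type*} [NormedAddCommGroup E] [NormedSpace ℝ E] [FiniteDimensional ℝ E]
  {D : Type*} [TopologicalSpace D] [ChartedSpace E D] [Group D]
  {H : Subgroup D}
  {F : Type*} [NormedAddCommGroup F] [NormedSpace ℝ F] [FiniteDimensional ℝ F]
  [ChartedSpace F (D ⧸ H)]

/-- The pullback of a function under the projection `D → D ⧸ H`. -/
def pullMk (hmk : ContMDiff 𝓘(ℝ, E) 𝓘(ℝ, F) ∞ (QuotientGroup.mk : D → D ⧸ H))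
    (Φ : C^∞⟮𝓘(ℝ, F), D ⧸ H; ℝ⟯) : C^∞⟮𝓘(ℝ, E), D; ℝ⟯ := Φ.comp ⟨_, hmk⟩

omit [FiniteDimensional ℝ E] [FiniteDimensional ℝ F] in
theorem pullMk_apply (hmk : ContMDiff 𝓘(ℝ, E) 𝓘(ℝ, F) ∞ (QuotientGroup.mk : D → D ⧸ H))
    (Φ : C^∞⟮𝓘(ℝ, F), D ⧸ H; ℝ⟯) (x : D) : pullMk hmk Φ x = Φ (QuotientGroup.mk x) := rfl

variable [LieGroup 𝓘(ℝ, E) ∞ D] [IsManifold 𝓘(ℝ, F) ∞ (D ⧸ H)]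

omit [FiniteDimensional ℝ E] [FiniteDimensional ℝ F] [LieGroup 𝓘(ℝ, E) ∞ D] [IsManifold 𝓘(ℝ, F) ∞
  (D ⧸ H)] in
/-- A smooth function on `D` that is constant on the cosets of `H` descends to `D ⧸ H`. -/
theorem exists_descent
    (hsub : Manifold.IsSubmersion 𝓘(ℝ, E) 𝓘(ℝ, F) ∞ (QuotientGroup.mk : D → D ⧸ H))
    (φ : C^∞⟮𝓘(ℝ, E), D; ℝ⟯) (hφ : ∀ x, ∀ h ∈ H, φ (x * h) = φ x) :
    ∃ Φ : C^∞⟮𝓘(ℝ, F), D ⧸ H; ℝ⟯, ∀ x : D, Φ (QuotientGroup.mk x) = φ x := by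
  let Φ : D ⧸ H → ℝ := fun y => Quotient.liftOn' y φ fun x y hxy => by
    rw [QuotientGroup.leftRel_apply] at hxy
    rw [← hφ x _ hxy, mul_inv_cancel_left]
  have hΦ : ∀ x : D, Φ (QuotientGroup.mk x) = φ x := fun x => rfl
  refine ⟨⟨Φ, fun y => ?_⟩, hΦ⟩
  obtain ⟨x, rfl⟩ := QuotientGroup.mk_surjective y
  obtain ⟨s, hs, hsx, hs'⟩ := exists_local_section hsub x
  refine (φ.contMDiff.contMDiffAt.comp _ hs).congr_of_eventuallyEq ?_
  filter_upwards [hs'] with y hy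
  rw [Function.comp_apply, ← hΦ, hy]

variable (hsub : Manifold.IsSubmersion 𝓘(ℝ, E) 𝓘(ℝ, F) ∞ (QuotientGroup.mk : D → D ⧸ H))
  {V : Type*} [AddCommGroup V] [Module ℝ V] (c : V ≃ₗ[ℝ] E)

omit [LieGroup 𝓘(ℝ, E) ∞ D] [IsManifold 𝓘(ℝ, F) ∞ (D ⧸ H)] in
theorem pullMk_invariant (hmk : ContMDiff 𝓘(ℝ, E) 𝓘(ℝ, F) ∞ (QuotientGroup.mk : D → D ⧸ H))
    (Φ : C^∞⟮𝓘(ℝ, F), D ⧸ H; ℝ⟯) (x : D) {h : D} (hh : h ∈ H) :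
    pullMk hmk Φ (x * h) = pullMk hmk Φ x := by
  rw [pullMk_apply, pullMk_apply, QuotientGroup.mk_mul_of_mem x hh]

include hsub in
theorem exists_quotientDeriv (v : V) (Φ : C^∞⟮𝓘(ℝ, F), D ⧸ H; ℝ⟯) :
    ∃ Ψ : C^∞⟮𝓘(ℝ, F), D ⧸ H; ℝ⟯, ∀ x : D, Ψ (QuotientGroup.mk x)
      = rightInvDeriv (c v) (pullMk hsub.contMDiff Φ) x := by
  refine exists_descent hsub _ fun x h hh => ?_
  have h1 : translate h (pullMk hsub.contMDiff Φ) = pullMk hsub.contMDiff Φ := by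
    ext y
    exact pullMk_invariant hsub.contMDiff Φ y hh
  have h2 := rightInvDeriv_translate (c v) h (pullMk hsub.contMDiff Φ)
  rw [h1] at h2
  rw [← translate_apply h x, ← h2]

/-- The infinitesimal action of the Lie algebra of `D` on the functions on `D ⧸ H`: the derivative
of functions along the projections of the right-invariant vector fields. -/
def quotientDeriv : V →ₗ[ℝ] C^∞⟮𝓘(ℝ, F), D ⧸ H; ℝ⟯ →ₗ[ℝ] C^∞⟮𝓘(ℝ, F), D ⧸ H; ℝ⟯ :=
  have key : ∀ (v : V) (Φ : C^∞⟮𝓘(ℝ, F), D ⧸ H; ℝ⟯) (x : D),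
      (exists_quotientDeriv hsub c v Φ).choose (QuotientGroup.mk x)
        = rightInvDeriv (c v) (pullMk hsub.contMDiff Φ) x :=
    fun v Φ => (exists_quotientDeriv hsub c v Φ).choose_spec
  LinearMap.mk₂ ℝ (fun v Φ => (exists_quotientDeriv hsub c v Φ).choose)
    (fun v w Φ => by
      ext y
      obtain ⟨x, rfl⟩ := QuotientGroup.mk_surjective y
      refine (key _ _ x).trans ?_
      rw [map_add, map_add]
      exact (congrArg₂ (· + ·) (key v Φ x) (key w Φ x)).symm)
    (fun t v Φ => by
      ext y
      obtain ⟨x, rfl⟩ := QuotientGroup.mk_surjective y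
      refine (key _ _ x).trans ?_
      rw [map_smul, map_smul]
      exact (congrArg (t • ·) (key v Φ x)).symm)
    (fun v Φ Ψ => by
      ext y
      obtain ⟨x, rfl⟩ := QuotientGroup.mk_surjective y
      refine (key _ _ x).trans ?_
      have h : pullMk hsub.contMDiff (Φ + Ψ) = pullMk hsub.contMDiff Φ + pullMk hsub.contMDiff Ψ :=
        rfl
      rw [h, map_add]
      exact (congrArg₂ (· + ·) (key v Φ x) (key v Ψ x)).symm)
    (fun t v Φ => by
      ext y
      obtain ⟨x, rfl⟩ := QuotientGroup.mk_surjective y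
      refine (key _ _ x).trans ?_
      have h : pullMk hsub.contMDiff (t • Φ) = t • pullMk hsub.contMDiff Φ := rfl
      rw [h, map_smul]
      exact (congrArg (t • ·) (key v Φ x)).symm)

theorem quotientDeriv_mk (v : V) (Φ : C^∞⟮𝓘(ℝ, F), D ⧸ H; ℝ⟯) (x : D) :
    quotientDeriv hsub c v Φ (QuotientGroup.mk x)
      = rightForm c (pullMk hsub.contMDiff Φ) x v :=
  (exists_quotientDeriv hsub c v Φ).choose_spec x

theorem pullMk_quotientDeriv (v : V) (Φ : C^∞⟮𝓘(ℝ, F), D ⧸ H; ℝ⟯) :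
    pullMk hsub.contMDiff (quotientDeriv hsub c v Φ)
      = rightInvDeriv (c v) (pullMk hsub.contMDiff Φ) := by
  ext x
  exact quotientDeriv_mk hsub c v Φ x

theorem quotientDeriv_mul (v : V) (Φ Ψ : C^∞⟮𝓘(ℝ, F), D ⧸ H; ℝ⟯) :
    quotientDeriv hsub c v (Φ * Ψ)
      = quotientDeriv hsub c v Φ * Ψ + Φ * quotientDeriv hsub c v Ψ := by
  ext y
  obtain ⟨x, rfl⟩ := QuotientGroup.mk_surjective y
  refine (quotientDeriv_mk hsub c v _ x).trans ?_
  rw [rightForm_apply]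
  have h : pullMk hsub.contMDiff (Φ * Ψ) = pullMk hsub.contMDiff Φ * pullMk hsub.contMDiff Ψ :=
    rfl
  rw [h, rightInvDeriv_mul, ← pullMk_quotientDeriv, ← pullMk_quotientDeriv]
  rfl

theorem quotientDeriv_br {br : V → V → V}
    (hc : ∀ a b, c (br a b) = modelBracket D (c a) (c b))
    (a b : V) (Φ : C^∞⟮𝓘(ℝ, F), D ⧸ H; ℝ⟯) :
    quotientDeriv hsub c (br a b) Φ = quotientDeriv hsub c a (quotientDeriv hsub c b Φ)
      - quotientDeriv hsub c b (quotientDeriv hsub c a Φ) := by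
  have : CompleteSpace E := FiniteDimensional.complete ℝ E
  ext y
  obtain ⟨x, rfl⟩ := QuotientGroup.mk_surjective y
  refine (quotientDeriv_mk hsub c _ _ x).trans ?_
  rw [rightForm_apply, hc, rightInvDeriv_lieBr, ← pullMk_quotientDeriv, ← pullMk_quotientDeriv,
    ← pullMk_quotientDeriv, ← pullMk_quotientDeriv]
  rfl

end Descent

section Reduction

variable {V₁ V₂ : Type*} [AddCommGroup V₁] [Module ℝ V₁] [AddCommGroup V₂] [Module ℝ V₂]
  (T : ManinTriple V₁ V₂)
  {E : Type*} [NormedAddCommGroup E] [NormedSpace ℝ E] [FiniteDimensional ℝ E]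
  {D : Type*} [TopologicalSpace D] [ChartedSpace E D] [Group D] [LieGroup 𝓘(ℝ, E) ∞ D]
  [PreconnectedSpace D]
  (c : (V₁ × V₂) ≃ₗ[ℝ] E) (hc : ∀ a b, c (T.br a b) = modelBracket D (c a) (c b))
  {E' : Type*} [NormedAddCommGroup E'] [NormedSpace ℝ E']
  {K : Type*} [TopologicalSpace K] [ChartedSpace E' K] [Group K] (b : V₂ ≃ₗ[ℝ] E')
  (j : K →* D) (hj : ContMDiff 𝓘(ℝ, E') 𝓘(ℝ, E) ∞ j)
  (hjb : ∀ f, mder E' E j 1 (b f) = c (0, f))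
  {F : Type*} [NormedAddCommGroup F] [NormedSpace ℝ F] [FiniteDimensional ℝ F]
  [ChartedSpace F (D ⧸ j.range)] [IsManifold 𝓘(ℝ, F) ∞ (D ⧸ j.range)]
  (hsub : Manifold.IsSubmersion 𝓘(ℝ, E) 𝓘(ℝ, F) ∞ (QuotientGroup.mk : D → D ⧸ j.range))
  {ι : Type*} [Fintype ι] (e : Module.Basis ι ℝ V₁)

omit [PreconnectedSpace D] in
include hj hjb in
theorem leftForm_pullMk_inr (Φ : C^∞⟮𝓘(ℝ, F), D ⧸ j.range; ℝ⟯) (x : D) (f : V₂) :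
    leftForm c (pullMk hsub.contMDiff Φ) x (0, f) = 0 :=
  leftForm_inr_eq_zero c b j hj hjb
    (fun x u => pullMk_invariant hsub.contMDiff Φ x ⟨u, rfl⟩) x f

include hc hj hjb in
/-- The bracket `biDer` on the quotient, in terms of the left differentials, which take values in
`V₂`. -/
theorem biDer_quotientDeriv_mk (Φ Ψ : C^∞⟮𝓘(ℝ, F), D ⧸ j.range; ℝ⟯) (x : D) :
    T.biDer e (quotientDeriv hsub c) Φ Ψ (QuotientGroup.mk x) = T.pair
      (adjointOn c x (0, T.pair.symm
        (leftForm c (pullMk hsub.contMDiff Ψ) x ∘ₗ LinearMap.inl ℝ V₁ V₂))).2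
      (adjointOn c x (0, T.pair.symm
        (leftForm c (pullMk hsub.contMDiff Φ) x ∘ₗ LinearMap.inl ℝ V₁ V₂))).1 := by
  rw [← T.sum_bilin e, T.biDer_apply, coe_sum]
  refine Finset.sum_congr rfl fun k _ => ?_
  refine (congrArg₂ (· * ·) (quotientDeriv_mk hsub c _ Φ x) (quotientDeriv_mk hsub c _ Ψ x)).trans ?_
  rw [T.rightForm_eq_of_isotropic c hc (leftForm_pullMk_inr c b j hj hjb hsub Φ x),
    T.rightForm_eq_of_isotropic c hc (leftForm_pullMk_inr c b j hj hjb hsub Ψ x)]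

include hc hj hjb in
theorem biDer_quotientDeriv_skew (Φ Ψ : C^∞⟮𝓘(ℝ, F), D ⧸ j.range; ℝ⟯) :
    T.biDer e (quotientDeriv hsub c) Φ Ψ = -T.biDer e (quotientDeriv hsub c) Ψ Φ := by
  ext y
  obtain ⟨x, rfl⟩ := QuotientGroup.mk_surjective y
  refine (biDer_quotientDeriv_mk T c hc b j hj hjb hsub e Φ Ψ x).trans ?_
  refine Eq.trans ?_ (congrArg Neg.neg (biDer_quotientDeriv_mk T c hc b j hj hjb hsub e Ψ Φ x)).symm
  rw [eq_neg_iff_add_eq_zero, add_comm, ← T.bilin_apply, T.bilin_adjointOn c hc,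
    T.bilin_apply]
  simp only [map_zero, add_zero]

/-- The Poisson structure on `D ⧸ j.range` given by a multiple of `biDer`. -/
def quotientPoisson (ε : ℝ) : PoissonStructure F (D ⧸ j.range) where
  bracket := ε • T.biDer e (quotientDeriv hsub c)
  bracket_self Φ := by
    have h := biDer_quotientDeriv_skew T c hc b j hj hjb hsub e Φ Φ
    have h0 : T.biDer e (quotientDeriv hsub c) Φ Φ = 0 := by
      ext y
      have h1 := congrArg (fun χ : C^∞⟮𝓘(ℝ, F), D ⧸ j.range; ℝ⟯ => χ y) h
      exact self_eq_neg.1 h1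
    rw [LinearMap.smul_apply, LinearMap.smul_apply, h0, smul_zero]
  leibniz Φ Ψ χ := by
    simp only [LinearMap.smul_apply]
    rw [T.biDer_leibniz e _ (quotientDeriv_mul hsub c), smul_add, smul_mul_assoc, mul_smul_comm]
  jacobi Φ Ψ χ := by
    simp only [LinearMap.smul_apply, map_smul, ← smul_add]
    rw [T.biDer_jacobi e _ (quotientDeriv_mul hsub c) (quotientDeriv_br hsub c hc)
      (biDer_quotientDeriv_skew T c hc b j hj hjb hsub e), smul_zero, smul_zero]

/-- A Poisson structure on the base of a surjective map is determined by the bracket upstairs. -/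
theorem IsPoissonMap.eq_of_surjective {E M F N : Type*} [NormedAddCommGroup E] [NormedSpace ℝ E]
    [TopologicalSpace M] [ChartedSpace E M] [NormedAddCommGroup F] [NormedSpace ℝ F]
    [TopologicalSpace N] [ChartedSpace F N] {B : RawBracket E M} {P P' : PoissonStructure F N}
    {f : M → N} (hf : Function.Surjective f) (h : IsPoissonMap B P.raw f)
    (h' : IsPoissonMap B P'.raw f) : P = P' := by
  obtain ⟨s, h⟩ := h
  obtain ⟨_, h'⟩ := h'
  refine PoissonStructure.ext (LinearMap.ext fun φ => LinearMap.ext fun ψ => ?_)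
  ext y
  obtain ⟨x, rfl⟩ := hf y
  exact (h φ ψ x).symm.trans (h' φ ψ x)

end Reduction

/-! ### The open embedding given by factorization -/

section LocalSections

variable {E : Type*} [NormedAddCommGroup E] [NormedSpace ℝ E]
  {M : Type*} [TopologicalSpace M] [ChartedSpace E M]
  {F : Type*} [NormedAddCommGroup F] [NormedSpace ℝ F]
  {N : Type*} [TopologicalSpace N] [ChartedSpace F N] {f : M → N}

theorem isOpenEmbedding_of_local_sections (hf : Continuous f) (hinj : Function.Injective f)
    (h : ∀ x, ∃ s : N → M, ContinuousAt s (f x) ∧ s (f x) = x ∧ ∀ᶠ y in 𝓝 (f x), f (s y) = y) :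
    IsOpenEmbedding f := by
  refine .of_continuous_injective_isOpenMap hf hinj (IsOpenMap.of_nhds_le fun x => ?_)
  obtain ⟨s, hs, hsx, hs'⟩ := h x
  have h1 : map (f ∘ s) (𝓝 (f x)) = 𝓝 (f x) := by
    rw [Filter.map_congr (m₁ := f ∘ s) (m₂ := id) hs', map_id]
  rw [← h1, ← map_map]
  refine map_mono ?_
  have h2 : Tendsto s (𝓝 (f x)) (𝓝 (s (f x))) := hs
  rwa [hsx] at h2

theorem isLocalDiffeomorph_of_local_sections [Nonempty M]
    (hf : ContMDiff 𝓘(ℝ, E) 𝓘(ℝ, F) ∞ f) (hinj : Function.Injective f)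
    (h : ∀ x, ∃ s : N → M, ContMDiffAt 𝓘(ℝ, F) 𝓘(ℝ, E) ∞ s (f x) ∧ s (f x) = x ∧
      ∀ᶠ y in 𝓝 (f x), f (s y) = y) :
    IsLocalDiffeomorph 𝓘(ℝ, E) 𝓘(ℝ, F) ∞ f := by
  have hopen : IsOpenEmbedding f := isOpenEmbedding_of_local_sections hf.continuous hinj fun x => by
    obtain ⟨s, hs, h'⟩ := h x
    exact ⟨s, hs.continuousAt, h'⟩
  intro x
  refine ⟨⟨⟨f, Function.invFun f, Set.univ, Set.range f, fun x _ => ⟨x, rfl⟩, fun y _ => trivial,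
    fun x _ => Function.leftInverse_invFun hinj x, fun y hy => Function.invFun_eq hy⟩,
    isOpen_univ, hopen.isOpen_range, hf.contMDiffOn, ?_⟩, Set.mem_univ x, fun _ _ => rfl⟩
  rintro _ ⟨z, rfl⟩
  obtain ⟨s, hs, -, hs'⟩ := h z
  refine (hs.congr_of_eventuallyEq ?_).contMDiffWithinAt
  filter_upwards [hs'] with y hy
  apply hinj
  rw [hy]
  exact Function.invFun_eq ⟨_, hy⟩

end LocalSections

section Factorization

variable {V₁ V₂ : Type*} [AddCommGroup V₁] [Module ℝ V₁] [AddCommGroup V₂] [Module ℝ V₂]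
  {E₁ : Type*} [NormedAddCommGroup E₁] [NormedSpace ℝ E₁] [FiniteDimensional ℝ E₁]
  {G : Type*} [TopologicalSpace G] [ChartedSpace E₁ G] [Group G] [LieGroup 𝓘(ℝ, E₁) ∞ G]
  {E₂ : Type*} [NormedAddCommGroup E₂] [NormedSpace ℝ E₂] [FiniteDimensional ℝ E₂]
  {K : Type*} [TopologicalSpace K] [ChartedSpace E₂ K] [Group K] [LieGroup 𝓘(ℝ, E₂) ∞ K]
  {E : Type*} [NormedAddCommGroup E] [NormedSpace ℝ E] [FiniteDimensional ℝ E]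
  {D : Type*} [TopologicalSpace D] [ChartedSpace E D] [Group D] [LieGroup 𝓘(ℝ, E) ∞ D]
  (a : V₁ ≃ₗ[ℝ] E₁) (b : V₂ ≃ₗ[ℝ] E₂) (c : (V₁ × V₂) ≃ₗ[ℝ] E)
  (i : G →* D) (hi : ContMDiff 𝓘(ℝ, E₁) 𝓘(ℝ, E) ∞ i)
  (hia : ∀ X, mder E₁ E i 1 (a X) = c (X, 0))
  (j : K →* D) (hj : ContMDiff 𝓘(ℝ, E₂) 𝓘(ℝ, E) ∞ j)
  (hjb : ∀ f, mder E₂ E j 1 (b f) = c (0, f))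

omit [FiniteDimensional ℝ E] in
include hi hia hj hjb in
/-- The map `(g, u) ↦ i g * j u` has smooth local inverses. -/
theorem exists_local_factorization (g : G) (u : K) :
    ∃ (s₁ : D → G) (s₂ : D → K), ContMDiffAt 𝓘(ℝ, E) 𝓘(ℝ, E₁) ∞ s₁ (i g * j u) ∧
      ContMDiffAt 𝓘(ℝ, E) 𝓘(ℝ, E₂) ∞ s₂ (i g * j u) ∧ s₁ (i g * j u) = g ∧
      s₂ (i g * j u) = u ∧ ∀ᶠ p in 𝓝 (i g * j u), i (s₁ p) * j (s₂ p) = p := by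
  obtain ⟨s₁, s₂, h₁, h₂, e₁, e₂, h⟩ := exists_local_inverse_prod
    (f := fun p : G × K => i p.1 * j p.2) (x := 1) (y := 1)
    ((hi.comp contMDiff_fst).mul (hj.comp contMDiff_snd))
    ((LinearEquiv.prodCongr a.symm b.symm).trans c) (fun v w => by
      simp only [map_one, mul_one, one_mul]
      have h1 := hia (a.symm v)
      have h2 := hjb (b.symm w)
      rw [a.apply_symm_apply] at h1
      rw [b.apply_symm_apply] at h2
      rw [h1, h2, ← map_add]
      simp)
  simp only [map_one, mul_one] at h₁ h₂ e₁ e₂ h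
  -- translate the local inverse at `1` from the left by `i g` and from the right by `j u`
  let τ : D → D := fun p => (i g)⁻¹ * p * (j u)⁻¹
  have hτ : ContMDiff 𝓘(ℝ, E) 𝓘(ℝ, E) ∞ τ := (contMDiff_const.mul contMDiff_id).mul contMDiff_const
  have hτ1 : τ (i g * j u) = 1 := by simp [τ]
  have hs₁ : ContMDiffAt 𝓘(ℝ, E) 𝓘(ℝ, E₁) ∞ (s₁ ∘ τ) (i g * j u) :=
    ContMDiffAt.comp _ (by rwa [hτ1]) hτ.contMDiffAt
  have hs₂ : ContMDiffAt 𝓘(ℝ, E) 𝓘(ℝ, E₂) ∞ (s₂ ∘ τ) (i g * j u) :=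
    ContMDiffAt.comp _ (by rwa [hτ1]) hτ.contMDiffAt
  refine ⟨fun p => g * s₁ (τ p), fun p => s₂ (τ p) * u, contMDiffAt_const.mul hs₁,
    hs₂.mul contMDiffAt_const, by simp only [hτ1, e₁, mul_one], by simp only [hτ1, e₂, one_mul], ?_⟩
  have ht : Tendsto τ (𝓝 (i g * j u)) (𝓝 1) := by
    have := hτ.continuous.tendsto (i g * j u)
    rwa [hτ1] at this
  filter_upwards [ht.eventually h] with p hp
  rw [map_mul, map_mul, mul_assoc, ← mul_assoc (i (s₁ _)), hp]
  simp [τ, mul_assoc]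

variable {F : Type*} [NormedAddCommGroup F] [NormedSpace ℝ F] [FiniteDimensional ℝ F]
  [ChartedSpace F (D ⧸ j.range)] [IsManifold 𝓘(ℝ, F) ∞ (D ⧸ j.range)]

omit [TopologicalSpace G] [TopologicalSpace K] [TopologicalSpace D] in
theorem injective_mk_comp (hij : Function.Injective (fun p : G × K => i p.1 * j p.2)) :
    Function.Injective (fun g : G => (QuotientGroup.mk (i g) : D ⧸ j.range)) := by
  intro g g' h
  obtain ⟨u, hu⟩ := QuotientGroup.eq.1 h
  have h1 : (g', (1 : K)) = (g, u) := hij (by simp [hu])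
  exact (congrArg Prod.fst h1).symm

omit [FiniteDimensional ℝ F] [IsManifold 𝓘(ℝ, F) ∞ (D ⧸ j.range)] in
include hi hia hj hjb in
theorem exists_local_section_mk_comp
    (hsub : Manifold.IsSubmersion 𝓘(ℝ, E) 𝓘(ℝ, F) ∞ (QuotientGroup.mk : D → D ⧸ j.range))
    (g : G) : ∃ s : D ⧸ j.range → G,
      ContMDiffAt 𝓘(ℝ, F) 𝓘(ℝ, E₁) ∞ s (QuotientGroup.mk (i g)) ∧ s (QuotientGroup.mk (i g)) = g ∧
      ∀ᶠ y in 𝓝 (QuotientGroup.mk (i g) : D ⧸ j.range), QuotientGroup.mk (i (s y)) = y := by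
  obtain ⟨s₁, s₂, h₁, -, e₁, -, h⟩ := exists_local_factorization a b c i hi hia j hj hjb g 1
  rw [map_one, mul_one] at h₁ e₁ h
  obtain ⟨s, hs, hsx, hs'⟩ := exists_local_section hsub (i g)
  refine ⟨s₁ ∘ s, ContMDiffAt.comp _ (by rwa [hsx]) hs, by rw [Function.comp_apply, hsx, e₁], ?_⟩
  have ht : Tendsto s (𝓝 (QuotientGroup.mk (i g))) (𝓝 (i g)) := by
    have := hs.continuousAt.tendsto
    rwa [hsx] at this
  filter_upwards [hs', ht.eventually h] with y hy hy'
  refine Eq.trans ?_ hy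
  rw [QuotientGroup.eq]
  exact ⟨s₂ (s y), eq_inv_mul_iff_mul_eq.2 hy'⟩

end Factorization

/-! ### Multiplicative biderivations -/

section Multiplicative

variable {E : Type*} [NormedAddCommGroup E] [NormedSpace ℝ E]
  {G : Type*} [TopologicalSpace G] [ChartedSpace E G]

/-- If `δ` vanishes to second order at `x`, so does its product with a continuous function. -/
theorem hasMFDerivAt_zero_mul {c δ : G → ℝ} {x : G}
    (hδ : HasMFDerivAt 𝓘(ℝ, E) 𝓘(ℝ, ℝ) δ x (0 : E →L[ℝ] ℝ)) (h0 : δ x = 0)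
    (hc : ContinuousAt c x) :
    HasMFDerivAt 𝓘(ℝ, E) 𝓘(ℝ, ℝ) (fun y => c y * δ y) x (0 : E →L[ℝ] ℝ) := by
  refine ⟨hc.mul hδ.1, ?_⟩
  have h1 : HasFDerivWithinAt (δ ∘ (chartAt E x).symm) (0 : E →L[ℝ] ℝ) (Set.range 𝓘(ℝ, E))
    (chartAt E x x) := hδ.2
  suffices HasFDerivWithinAt ((fun y => c y * δ y) ∘ (chartAt E x).symm) (0 : E →L[ℝ] ℝ)
    (Set.range 𝓘(ℝ, E)) (chartAt E x x) from this
  rw [modelWithCornersSelf_coe, Set.range_id, hasFDerivWithinAt_univ,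
    hasFDerivAt_iff_isLittleO] at h1 ⊢
  have hx : (chartAt E x).symm (chartAt E x x) = x := (chartAt E x).left_inv (mem_chart_source E x)
  simp only [Function.comp_apply, hx, h0, sub_zero, mul_zero, zero_apply]
    at h1 ⊢
  have h2 : ContinuousAt (fun z => c ((chartAt E x).symm z)) (chartAt E x x) := by
    refine ContinuousAt.comp (g := c) (by rwa [hx]) ?_
    exact (chartAt E x).continuousAt_symm (mem_chart_target E x)
  have h3 := (h2.tendsto.isBigO_one ℝ).mul_isLittleO h1.norm_right
  simp only [one_mul] at h3
  exact h3.of_norm_right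

theorem hasMFDerivAt_zero_sum {n : ℕ} {f : Fin n → G → ℝ} {x : G}
    (hf : ∀ k, HasMFDerivAt 𝓘(ℝ, E) 𝓘(ℝ, ℝ) (f k) x (0 : E →L[ℝ] ℝ)) :
    HasMFDerivAt 𝓘(ℝ, E) 𝓘(ℝ, ℝ) (fun y => ∑ k, f k y) x (0 : E →L[ℝ] ℝ) := by
  have h := HasMFDerivAt.sum (t := Finset.univ) (f' := fun _ => (0 : E →L[ℝ] ℝ))
    (fun k _ => hf k)
  have h' := h.congr_mfderiv
    (Finset.sum_const_zero (s := (Finset.univ : Finset (Fin n))) (M := E →L[ℝ] ℝ))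
  have e : (fun y => ∑ k, f k y) = ∑ k, f k := by ext y; simp
  rw [e]
  exact h'

/-- A biderivation evaluated at a point depends only on the differentials at that point. -/
theorem biderivation_congr [FiniteDimensional ℝ E] [IsManifold 𝓘(ℝ, E) ∞ G] [T2Space G]
    (Δ : C^∞⟮𝓘(ℝ, E), G; ℝ⟯ →ₗ[ℝ] C^∞⟮𝓘(ℝ, E), G; ℝ⟯ →ₗ[ℝ] C^∞⟮𝓘(ℝ, E), G; ℝ⟯)
    (hl : ∀ φ ψ χ, Δ (φ * ψ) χ = Δ φ χ * ψ + φ * Δ ψ χ)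
    (hr : ∀ φ ψ χ, Δ φ (ψ * χ) = Δ φ ψ * χ + ψ * Δ φ χ) {x : G}
    {φ φ' ψ ψ' : C^∞⟮𝓘(ℝ, E), G; ℝ⟯} (h : mder E ℝ φ x = mder E ℝ φ' x)
    (h' : mder E ℝ ψ x = mder E ℝ ψ' x) : Δ φ ψ x = Δ φ' ψ' x := by
  let ev : C^∞⟮𝓘(ℝ, E), G; ℝ⟯ →ₗ[ℝ] ℝ :=
    { toFun := fun φ => φ x, map_add' := fun _ _ => rfl, map_smul' := fun _ _ => rfl }
  have hsub : ∀ {φ φ' : C^∞⟮𝓘(ℝ, E), G; ℝ⟯}, mder E ℝ φ x = mder E ℝ φ' x →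
      mder E ℝ (φ - φ' : C^∞⟮𝓘(ℝ, E), G; ℝ⟯) x = 0 := by
    intro φ φ' h
    have h1 := mder_add (smooth_mdiffAt (φ - φ').contMDiff x) (smooth_mdiffAt φ'.contMDiff x)
    have h2 : (⇑(φ - φ') + ⇑φ' : G → ℝ) = φ := by
      ext y
      exact sub_add_cancel (φ y) (φ' y)
    have h3 : mder E ℝ φ x = mder E ℝ (φ - φ' : C^∞⟮𝓘(ℝ, E), G; ℝ⟯) x + mder E ℝ φ' x := by
      rw [← h1]
      exact congrArg (fun f => mder E ℝ f x) h2.symm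
    rwa [h, right_eq_add] at h3
  have h1 : Δ φ ψ x - Δ φ' ψ x = 0 := by
    have := pointDerivation_eq_zero (ev ∘ₗ Δ.flip ψ) (fun φ χ => by
      change Δ (φ * χ) ψ x = _
      rw [hl]
      rfl) (hsub h)
    rw [map_sub] at this
    exact this
  have h2 : Δ φ' ψ x - Δ φ' ψ' x = 0 := by
    have := pointDerivation_eq_zero (ev ∘ₗ Δ φ') (fun ψ χ => by
      change Δ φ' (ψ * χ) x = _
      rw [hr]
      rfl) (hsub h')
    rw [map_sub] at this
    exact this
  linarith

variable [Group G] [LieGroup 𝓘(ℝ, E) ∞ G] [FiniteDimensional ℝ E]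

/-- A multiplicative biderivation on a connected Lie group vanishes if its linearization at the
identity does: in the left trivialization it has zero derivative at the identity, hence
everywhere by multiplicativity. -/
theorem multiplicative_biderivation_eq_zero [PreconnectedSpace G]
    (Δ : C^∞⟮𝓘(ℝ, E), G; ℝ⟯ →ₗ[ℝ] C^∞⟮𝓘(ℝ, E), G; ℝ⟯ →ₗ[ℝ] C^∞⟮𝓘(ℝ, E), G; ℝ⟯)
    (hl : ∀ φ ψ χ, Δ (φ * ψ) χ = Δ φ χ * ψ + φ * Δ ψ χ)
    (hr : ∀ φ ψ χ, Δ φ (ψ * χ) = Δ φ ψ * χ + ψ * Δ φ χ)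
    (hmul : ∀ φ ψ g k, Δ φ ψ (g * k) = Δ (translate k φ) (translate k ψ) g
      + Δ (leftTranslate g φ) (leftTranslate g ψ) k)
    (hlin : ∀ φ ψ, mder E ℝ (Δ φ ψ) 1 = 0) (φ ψ : C^∞⟮𝓘(ℝ, E), G; ℝ⟯) : Δ φ ψ = 0 := by
  have := t2Space_of_lieGroup (E := E) (D := G)
  let e := Module.finBasis ℝ E
  choose χ hχ using fun k => exists_mder_eq (1 : G) (LinearMap.toContinuousLinearMap (e.coord k))
  have hχ' : ∀ k v (g : G), leftInvDeriv v (leftTranslate g⁻¹ (χ k)) g = e.coord k v := by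
    intro k v g
    rw [leftInvDeriv_leftTranslate, inv_mul_cancel, leftInvDeriv_one, hχ]
    rfl
  -- the coefficients of the biderivation in the left trivialization
  let N : Fin (Module.finrank ℝ E) → Fin (Module.finrank ℝ E) → G → ℝ := fun k l g =>
    Δ (leftTranslate g⁻¹ (χ k)) (leftTranslate g⁻¹ (χ l)) g
  have hleft : ∀ (v : E) (x : G) (s : Fin (Module.finrank ℝ E) → ℝ)
      (η : Fin (Module.finrank ℝ E) → C^∞⟮𝓘(ℝ, E), G; ℝ⟯),
      leftInvDeriv v (∑ k, s k • η k) x = ∑ k, s k * leftInvDeriv v (η k) x := by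
    intro v x s η
    rw [leftInvDeriv_eq_rightInvDeriv, map_sum, coe_sum]
    refine Finset.sum_congr rfl fun k _ => ?_
    rw [leftInvDeriv_eq_rightInvDeriv, map_smul]
    rfl
  have hcongr : ∀ {φ φ' : C^∞⟮𝓘(ℝ, E), G; ℝ⟯} {x : G},
      (∀ v, leftInvDeriv v φ x = leftInvDeriv v φ' x) → mder E ℝ φ x = mder E ℝ φ' x := by
    intro φ φ' x h
    ext w
    rw [mder_eq_leftInvDeriv, mder_eq_leftInvDeriv, h]
  have hexp : ∀ φ ψ g, Δ φ ψ g
      = ∑ k, ∑ l, leftInvDeriv (e k) φ g * leftInvDeriv (e l) ψ g * N k l g := by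
    intro φ ψ g
    have h1 : ∀ φ v, leftInvDeriv v φ g
        = leftInvDeriv v (∑ k, leftInvDeriv (e k) φ g • leftTranslate g⁻¹ (χ k)) g := by
      intro φ v
      rw [hleft]
      simp only [hχ']
      have h2 := congrArg (mder E ℝ (fun y => φ (g * y)) 1) (e.sum_repr v)
      rw [map_sum] at h2
      refine h2.symm.trans (Finset.sum_congr rfl fun k _ => ?_)
      rw [map_smul, smul_eq_mul, mul_comm]
      rfl
    rw [biderivation_congr Δ hl hr (hcongr (h1 φ)) (hcongr (h1 ψ))]
    simp only [map_sum, LinearMap.sum_apply, map_smul, LinearMap.smul_apply, Finset.smul_sum, coe_sum]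
    rw [Finset.sum_comm]
    refine Finset.sum_congr rfl fun k _ => Finset.sum_congr rfl fun l _ => ?_
    rw [mul_assoc, mul_left_comm]
    rfl
  have hone : ∀ φ ψ, Δ φ ψ 1 = 0 := by
    intro φ ψ
    have h := hmul φ ψ 1 1
    have h1 : ∀ φ : C^∞⟮𝓘(ℝ, E), G; ℝ⟯, translate 1 φ = φ := fun φ => by
      ext y; rw [translate_apply, mul_one]
    have h2 : ∀ φ : C^∞⟮𝓘(ℝ, E), G; ℝ⟯, leftTranslate 1 φ = φ := fun φ => by
      ext y; rw [leftTranslate_apply, one_mul]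
    rw [h1, h1, h2, h2, one_mul] at h
    linarith
  -- near the identity, the coefficients are combinations of functions `Δ (χ k) (χ l)`
  have hN1 : ∀ k l, HasMFDerivAt 𝓘(ℝ, E) 𝓘(ℝ, ℝ) (N k l) 1 (0 : E →L[ℝ] ℝ) := by
    let A : G → Matrix (Fin (Module.finrank ℝ E)) (Fin (Module.finrank ℝ E)) ℝ := fun g =>
      Matrix.of fun k l => leftInvDeriv (e l) (χ k) g
    have hA : Continuous A := continuous_matrix fun k l => (leftInvDeriv (e l) (χ k)).contMDiff.continuous
    have hA1 : A 1 = 1 := by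
      ext k l
      change leftInvDeriv (e l) (χ k) 1 = _
      rw [leftInvDeriv_one, hχ, Matrix.one_apply]
      simp [Finsupp.single_apply, eq_comm]
    have hdet : ∀ᶠ g in 𝓝 (1 : G), (A g).det ≠ 0 :=
      hA.matrix_det.continuousAt.eventually_ne (by rw [hA1, Matrix.det_one]; exact one_ne_zero)
    have hinv : ∀ k l, ContinuousAt (fun g => (A g)⁻¹ k l) 1 := by
      intro k l
      have h1 : ContinuousAt (fun g => (A g)⁻¹) 1 := by
        refine ContinuousAt.comp (g := Inv.inv) (continuousAt_matrix_inv _ ?_) hA.continuousAt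
        rw [hA1, Matrix.det_one]
        simp
      exact (continuous_id.matrix_elem k l).continuousAt.comp h1
    intro k l
    have h1 : HasMFDerivAt 𝓘(ℝ, E) 𝓘(ℝ, ℝ)
        (fun g => ∑ p, ∑ q, (A g)⁻¹ k p * (A g)⁻¹ l q * Δ (χ p) (χ q) g) 1 (0 : E →L[ℝ] ℝ) := by
      refine hasMFDerivAt_zero_sum fun p => hasMFDerivAt_zero_sum fun q => ?_
      refine hasMFDerivAt_zero_mul ?_ (hone _ _) ((hinv k p).mul (hinv l q))
      rw [← hlin (χ p) (χ q)]
      exact (smooth_mdiffAt (Δ (χ p) (χ q)).contMDiff 1).hasMFDerivAt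
    refine h1.congr_of_eventuallyEq ?_
    filter_upwards [hdet] with g hg
    have h2 : ∀ p q, Δ (χ p) (χ q) g = (A g * Matrix.of (fun k l => N k l g) * (A g).transpose) p q := by
      intro p q
      rw [hexp, Matrix.mul_apply]
      simp only [Matrix.mul_apply, Finset.sum_mul]
      rw [Finset.sum_comm]
      refine Finset.sum_congr rfl fun k _ => Finset.sum_congr rfl fun l _ => ?_
      simp only [A, Matrix.of_apply, Matrix.transpose_apply]
      ring
    have h3 : ∑ p, ∑ q, (A g)⁻¹ k p * (A g)⁻¹ l q * Δ (χ p) (χ q) g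
        = ((A g)⁻¹ * (A g * Matrix.of (fun k l => N k l g) * (A g).transpose)
          * ((A g)⁻¹).transpose) k l := by
      rw [Matrix.mul_apply]
      simp only [Matrix.mul_apply (M := (A g)⁻¹), Finset.sum_mul]
      rw [Finset.sum_comm]
      refine Finset.sum_congr rfl fun p _ => Finset.sum_congr rfl fun q _ => ?_
      rw [h2, Matrix.transpose_apply]
      ring
    have hu : IsUnit (A g).det := isUnit_iff_ne_zero.2 hg
    rw [h3, ← Matrix.mul_assoc, ← Matrix.mul_assoc, Matrix.nonsing_inv_mul _ hu, Matrix.one_mul,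
      Matrix.mul_assoc, ← Matrix.transpose_mul, Matrix.nonsing_inv_mul _ hu, Matrix.transpose_one,
      Matrix.mul_one]
    rfl
  -- the coefficients form a cocycle
  have hcoc : ∀ k : G, ∃ C : Fin (Module.finrank ℝ E) → Fin (Module.finrank ℝ E) → ℝ,
      ∀ p q g, N p q (g * k) = (∑ r, ∑ s, C p r * C q s * N r s g) + N p q k := by
    intro k
    refine ⟨fun p r => mder E ℝ (fun y => χ p (k⁻¹ * y * k)) 1 (e r), fun p q g => ?_⟩
    have h1 : ∀ p, leftTranslate g (leftTranslate (g * k)⁻¹ (χ p)) = leftTranslate k⁻¹ (χ p) := by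
      intro p
      ext y
      simp [leftTranslate_apply, mul_assoc]
    have h2 : ∀ p r, leftInvDeriv (e r) (translate k (leftTranslate (g * k)⁻¹ (χ p))) g
        = mder E ℝ (fun y => χ p (k⁻¹ * y * k)) 1 (e r) := by
      intro p r
      rw [leftInvDeriv_apply]
      simp only [leftTranslate_apply, translate_apply, mul_inv_rev, mul_assoc, inv_mul_cancel_left]
    change Δ _ _ (g * k) = _
    rw [hmul, h1, h1, hexp]
    simp only [h2]
    rfl
  have hN : ∀ p q g, HasMFDerivAt 𝓘(ℝ, E) 𝓘(ℝ, ℝ) (N p q) g (0 : E →L[ℝ] ℝ) := by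
    intro p q k
    obtain ⟨C, hC⟩ := hcoc k
    have h1 : HasMFDerivAt 𝓘(ℝ, E) 𝓘(ℝ, ℝ)
        (fun g => (∑ r, ∑ s, C p r * C q s * N r s g) + N p q k) 1 (0 : E →L[ℝ] ℝ) := by
      have h2 : HasMFDerivAt 𝓘(ℝ, E) 𝓘(ℝ, ℝ)
          (fun g => ∑ r, ∑ s, C p r * C q s * N r s g) 1 (0 : E →L[ℝ] ℝ) := by
        refine hasMFDerivAt_zero_sum fun r => hasMFDerivAt_zero_sum fun s => ?_
        refine hasMFDerivAt_zero_mul (c := fun _ => C p r * C q s) (hN1 r s) (hone _ _)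
          continuousAt_const
      have h3 := h2.add (hasMFDerivAt_const (N p q k) (1 : G))
      exact h3.congr_mfderiv (add_zero (0 : E →L[ℝ] ℝ))
    have h4 : N p q = (fun g => (∑ r, ∑ s, C p r * C q s * N r s g) + N p q k)
        ∘ fun y => y * k⁻¹ := by
      ext y
      rw [Function.comp_apply, ← hC, inv_mul_cancel_right]
    rw [h4]
    have h5 := HasMFDerivAt.comp k (g := fun g => (∑ r, ∑ s, C p r * C q s * N r s g) + N p q k)
      (f := fun y : G => y * k⁻¹) (g' := (0 : E →L[ℝ] ℝ)) (by rwa [mul_inv_cancel])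
      (mdiffAt_mul_const k⁻¹ k).hasMFDerivAt
    exact h5.congr_mfderiv (ContinuousLinearMap.zero_comp (mder E E (fun y : G => y * k⁻¹) k))
  have hN0 : ∀ p q g, N p q g = 0 := by
    intro p q g
    rw [eq_of_mder_eq_zero (fun g => (hN p q g).mdifferentiableAt)
      (fun g v => by rw [mder, (hN p q g).mfderiv]; rfl) g 1]
    exact hone _ _
  ext g
  rw [hexp]
  simp [hN0]

end Multiplicative

/-! ### The bracket that the double induces on the subgroup -/

section DressingBracket

variable {V₁ V₂ : Type*} [AddCommGroup V₁] [Module ℝ V₁] [AddCommGroup V₂] [Module ℝ V₂]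
  (T : ManinTriple V₁ V₂)
  {E₁ : Type*} [NormedAddCommGroup E₁] [NormedSpace ℝ E₁]
  {G : Type*} [TopologicalSpace G] [ChartedSpace E₁ G] [Group G] [LieGroup 𝓘(ℝ, E₁) ∞ G]
  {E : Type*} [NormedAddCommGroup E] [NormedSpace ℝ E] [FiniteDimensional ℝ E]
  {D : Type*} [TopologicalSpace D] [ChartedSpace E D] [Group D] [LieGroup 𝓘(ℝ, E) ∞ D]
  (a : V₁ ≃ₗ[ℝ] E₁) (c : (V₁ × V₂) ≃ₗ[ℝ] E)
  (hc : ∀ p q, c (T.br p q) = modelBracket D (c p) (c q))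
  (i : G →* D) (hi : ContMDiff 𝓘(ℝ, E₁) 𝓘(ℝ, E) ∞ i)
  (hia : ∀ X, mder E₁ E i 1 (a X) = c (X, 0))
  {ι : Type*} [Fintype ι] (e : Module.Basis ι ℝ V₁)

namespace ManinTriple

/-- The function `x ↦ ⟨Ad_x p, q⟩` on the double. -/
def adCoeff (p q : V₁ × V₂) : C^∞⟮𝓘(ℝ, E), D; ℝ⟯ :=
  adjointCoeff (LinearMap.toContinuousLinearMap (T.bilin.flip q ∘ₗ c.symm.toLinearMap)) (c p)

theorem adCoeff_apply (p q : V₁ × V₂) (x : D) :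
    T.adCoeff c p q x = T.bilin (adjointOn c x p) q := rfl

include hc in
theorem rightInvDeriv_adCoeff_one (r p q : V₁ × V₂) :
    rightInvDeriv (c r) (T.adCoeff (D := D) c p q) 1 = -T.bilin (T.br r p) q := by
  rw [adCoeff, rightInvDeriv_adjointCoeff, adjointMap_one, ← hc]
  simp

omit [FiniteDimensional ℝ E] in
include hi hia in
theorem adjointOn_map_inl (g : G) (X : V₁) :
    adjointOn c (i g) (X, 0) = ((adjointOn a g X, 0) : V₁ × V₂) := by
  apply c.injective
  rw [apply_adjointOn, ← hia, adjointMap_map i hi, ← apply_adjointOn, hia]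

theorem pair_br₂_sum (s t : ι → ℝ) (f : ι → V₂) (X : V₁) :
    T.pair (T.br₂ (∑ k, s k • f k) (∑ l, t l • f l)) X
      = ∑ k, ∑ l, s k * t l * T.pair (T.br₂ (f k) (f l)) X := by
  have h1 : ∀ g, T.pair (T.br₂ g (∑ l, t l • f l)) X = ∑ l, t l * T.pair (T.br₂ g (f l)) X := by
    intro g
    simp only [← pair_br_inl_inr_fst, map_sum, map_smul, LinearMap.sum_apply, LinearMap.smul_apply,
      smul_eq_mul]
  have h2 : ∀ g, T.pair (T.br₂ (∑ k, s k • f k) g) X = ∑ k, s k * T.pair (T.br₂ (f k) g) X := by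
    intro g
    simp only [T.br₂_skew _ g, map_neg, LinearMap.neg_apply, ← pair_br_inl_inr_fst, map_sum,
      map_smul, LinearMap.sum_apply, LinearMap.smul_apply, smul_eq_mul, mul_neg,
      Finset.sum_neg_distrib]
  rw [h2]
  refine Finset.sum_congr rfl fun k _ => ?_
  rw [h1, Finset.mul_sum]
  exact Finset.sum_congr rfl fun l _ => by ring

/-- The left differential of a function on `G`, as an element of `V₂`. -/
def leftVec (φ : C^∞⟮𝓘(ℝ, E₁), G; ℝ⟯) (g : G) : V₂ := T.pair.symm (leftForm a φ g)

theorem pair_leftVec (φ : C^∞⟮𝓘(ℝ, E₁), G; ℝ⟯) (g : G) (X : V₁) :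
    T.pair (T.leftVec a φ g) X = leftInvDeriv (a X) φ g := by
  rw [leftVec, LinearEquiv.apply_symm_apply, leftForm_apply]

theorem sum_leftInvDeriv_smul_dualVec (φ : C^∞⟮𝓘(ℝ, E₁), G; ℝ⟯) (g : G) :
    ∑ k, leftInvDeriv (a (e k)) φ g • T.dualVec e k = T.leftVec a φ g := by
  simp only [← T.pair_leftVec]
  exact T.sum_pair_smul_dualVec e _

/-- The components, in the left trivialization, of the bivector on `G` that is induced by the
infinitesimal action of the double. -/
def dressingCoeff (k l : ι) : C^∞⟮𝓘(ℝ, E₁), G; ℝ⟯ :=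
  ∑ m, (T.adCoeff (D := D) c (0, T.dualVec e k) (0, T.dualVec e m)).comp ⟨i, hi⟩
    * (T.adCoeff (D := D) c (0, T.dualVec e l) (e m, 0)).comp ⟨i, hi⟩

omit [LieGroup 𝓘(ℝ, E₁) ∞ G] in
theorem dressingCoeff_apply (k l : ι) (g : G) : T.dressingCoeff c i hi e k l g
    = T.pair (adjointOn c (i g) (0, T.dualVec e l)).2
      (adjointOn c (i g) (0, T.dualVec e k)).1 := by
  rw [dressingCoeff, coe_sum, ← T.sum_bilin e]
  rfl

/-- The bracket on `G` that is induced by the infinitesimal action of the double. -/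
def dressingBracket :
    C^∞⟮𝓘(ℝ, E₁), G; ℝ⟯ →ₗ[ℝ] C^∞⟮𝓘(ℝ, E₁), G; ℝ⟯ →ₗ[ℝ] C^∞⟮𝓘(ℝ, E₁), G; ℝ⟯ :=
  LinearMap.mk₂ ℝ (fun φ ψ => ∑ k, ∑ l, leftInvDeriv (a (e k)) φ * leftInvDeriv (a (e l)) ψ
      * T.dressingCoeff c i hi e k l)
    (fun φ φ' ψ => by simp only [leftInvDeriv_add, add_mul, Finset.sum_add_distrib])
    (fun t φ ψ => by simp only [leftInvDeriv_smul, smul_mul_assoc, Finset.smul_sum])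
    (fun φ ψ ψ' => by
      simp only [leftInvDeriv_add, mul_add, add_mul, Finset.sum_add_distrib])
    (fun t φ ψ => by
      simp only [leftInvDeriv_smul, mul_smul_comm, smul_mul_assoc, Finset.smul_sum])

theorem dressingBracket_def (φ ψ : C^∞⟮𝓘(ℝ, E₁), G; ℝ⟯) : T.dressingBracket a c i hi e φ ψ
    = ∑ k, ∑ l, leftInvDeriv (a (e k)) φ * leftInvDeriv (a (e l)) ψ
      * T.dressingCoeff c i hi e k l := rfl

theorem dressingBracket_mul_left (φ ψ χ : C^∞⟮𝓘(ℝ, E₁), G; ℝ⟯) :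
    T.dressingBracket a c i hi e (φ * ψ) χ
      = T.dressingBracket a c i hi e φ χ * ψ + φ * T.dressingBracket a c i hi e ψ χ := by
  simp only [dressingBracket_def, Finset.sum_mul, Finset.mul_sum, ← Finset.sum_add_distrib,
    leftInvDeriv_mul]
  exact Finset.sum_congr rfl fun k _ => Finset.sum_congr rfl fun l _ => by ring

theorem dressingBracket_mul_right (φ ψ χ : C^∞⟮𝓘(ℝ, E₁), G; ℝ⟯) :
    T.dressingBracket a c i hi e φ (ψ * χ)
      = T.dressingBracket a c i hi e φ ψ * χ + ψ * T.dressingBracket a c i hi e φ χ := by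
  simp only [dressingBracket_def, Finset.sum_mul, Finset.mul_sum, ← Finset.sum_add_distrib,
    leftInvDeriv_mul]
  exact Finset.sum_congr rfl fun k _ => Finset.sum_congr rfl fun l _ => by ring

theorem dressingBracket_apply (φ ψ : C^∞⟮𝓘(ℝ, E₁), G; ℝ⟯) (g : G) :
    T.dressingBracket a c i hi e φ ψ g = T.pair (adjointOn c (i g) (0, T.leftVec a ψ g)).2
      (adjointOn c (i g) (0, T.leftVec a φ g)).1 := by
  have h : ∀ φ : C^∞⟮𝓘(ℝ, E₁), G; ℝ⟯, adjointOn c (i g) (0, T.leftVec a φ g)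
      = ∑ k, leftInvDeriv (a (e k)) φ g • adjointOn c (i g) (0, T.dualVec e k) := by
    intro φ
    have h1 : ((0, T.leftVec a φ g) : V₁ × V₂)
        = ∑ k, leftInvDeriv (a (e k)) φ g • ((0, T.dualVec e k) : V₁ × V₂) := by
      refine Prod.ext ?_ ?_
      · simp [Prod.fst_sum]
      · simp [Prod.snd_sum, sum_leftInvDeriv_smul_dualVec]
    rw [h1, map_sum]
    exact Finset.sum_congr rfl fun k _ => map_smul _ _ _
  rw [h φ, h ψ, dressingBracket_def, coe_sum]
  simp only [Prod.fst_sum, Prod.snd_sum, Prod.smul_fst, Prod.smul_snd, map_sum, map_smul,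
    LinearMap.sum_apply, LinearMap.smul_apply, smul_eq_mul, Finset.mul_sum]
  refine Finset.sum_congr rfl fun k _ => ?_
  rw [coe_sum]
  refine Finset.sum_congr rfl fun l _ => ?_
  rw [← mul_assoc, ← dressingCoeff_apply T c i hi]
  rfl

include hc hi hia in
/-- The bracket induced by the action of the double is multiplicative, since the adjoint action
preserves the canonical form and, on `G`, the summand `V₁`. -/
theorem dressingBracket_multiplicative [PreconnectedSpace D] (φ ψ : C^∞⟮𝓘(ℝ, E₁), G; ℝ⟯)
    (g z : G) : T.dressingBracket a c i hi e φ ψ (g * z)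
      = T.dressingBracket a c i hi e (translate z φ) (translate z ψ) g
        + T.dressingBracket a c i hi e (leftTranslate g φ) (leftTranslate g ψ) z := by
  have h1 : ∀ φ : C^∞⟮𝓘(ℝ, E₁), G; ℝ⟯, T.leftVec a (leftTranslate g φ) z = T.leftVec a φ (g * z) := by
    intro φ
    refine T.pair.injective (LinearMap.ext fun X => ?_)
    rw [pair_leftVec, pair_leftVec, leftInvDeriv_leftTranslate]
  have h2 : ∀ φ : C^∞⟮𝓘(ℝ, E₁), G; ℝ⟯, T.leftVec a (translate z φ) g
      = (adjointOn c (i z) (0, T.leftVec a φ (g * z))).2 := by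
    intro φ
    refine T.pair.injective (LinearMap.ext fun X => ?_)
    have h3 := T.bilin_adjointOn_left c hc (i z) (0, T.leftVec a φ (g * z)) (X, 0)
    rw [← map_inv, adjointOn_map_inl a c i hi hia, T.bilin_apply, T.bilin_apply] at h3
    simp only [map_zero, LinearMap.zero_apply, add_zero] at h3
    rw [h3, pair_leftVec, pair_leftVec, leftInvDeriv_eq_rightInvDeriv, rightInvDeriv_translate,
      translate_apply, leftInvDeriv_eq_rightInvDeriv, adjointMap_mul, apply_adjointOn,
      adjointMap_inv_apply]
  simp only [dressingBracket_apply, h1, h2, map_mul, adjointOn_mul]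
  set p := adjointOn c (i z) (0, T.leftVec a φ (g * z)) with hp
  set q := adjointOn c (i z) (0, T.leftVec a ψ (g * z)) with hq
  have hsplit : ∀ p : V₁ × V₂, adjointOn c (i g) p
      = (adjointOn a g p.1, 0) + adjointOn c (i g) (0, p.2) := by
    intro p
    rw [← adjointOn_map_inl a c i hi hia, ← map_add]
    simp
  have h4 := T.bilin_adjointOn c hc (i g) (0, q.2) (p.1, 0)
  rw [adjointOn_map_inl a c i hi hia, T.bilin_apply, T.bilin_apply] at h4
  simp only [map_zero, LinearMap.zero_apply, add_zero] at h4
  rw [hsplit p, hsplit q]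
  simp only [Prod.fst_add, Prod.snd_add, zero_add, map_add, h4]
  ring

include hc hi hia in
/-- The linearization at the identity of the bracket induced by the action of the double. -/
theorem mder_dressingBracket_one (φ ψ : C^∞⟮𝓘(ℝ, E₁), G; ℝ⟯) (X : V₁) :
    mder E₁ ℝ (T.dressingBracket a c i hi e φ ψ) 1 (a X)
      = -T.pair (T.br₂ (T.leftVec a φ 1) (T.leftVec a ψ 1)) X := by
  have h0 : ∀ p q, T.adCoeff (D := D) c p q 1 = T.bilin p q := fun p q => by
    rw [adCoeff_apply, adjointOn_one]
  have h1 : ∀ k l, T.dressingCoeff (G := G) c i hi e k l 1 = 0 := by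
    intro k l
    rw [dressingCoeff_apply, map_one, adjointOn_one, adjointOn_one, map_zero]
  have h2 : ∀ k l, rightInvDeriv (a X) (T.dressingCoeff c i hi e k l) 1
      = -T.pair (T.br₂ (T.dualVec e k) (T.dualVec e l)) X := by
    intro k l
    rw [dressingCoeff, map_sum, coe_sum]
    have h3 : ∀ m, rightInvDeriv (a X)
        ((T.adCoeff (D := D) c (0, T.dualVec e k) (0, T.dualVec e m)).comp ⟨i, hi⟩
          * (T.adCoeff (D := D) c (0, T.dualVec e l) (e m, 0)).comp ⟨i, hi⟩) 1
        = -(T.bilin (T.br (X, 0) (0, T.dualVec e k)) (0, T.dualVec e m)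
          * T.bilin (0, T.dualVec e l) (e m, 0)) := by
      intro m
      have h5 := rightInvDeriv_comp i hi (a X)
        (T.adCoeff (D := D) c (0, T.dualVec e k) (0, T.dualVec e m)) 1
      rw [hia, map_one i, rightInvDeriv_adCoeff_one T c hc] at h5
      have h6 : (T.adCoeff (D := D) c (0, T.dualVec e k) (0, T.dualVec e m)).comp ⟨i, hi⟩ (1 : G)
          = 0 := by
        change T.adCoeff (D := D) c _ _ (i 1) = 0
        rw [map_one, h0, T.bilin_apply]
        simp only [map_zero, add_zero]
      have h7 : (T.adCoeff (D := D) c (0, T.dualVec e l) (e m, 0)).comp ⟨i, hi⟩ (1 : G)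
          = T.bilin (0, T.dualVec e l) (e m, 0) := by
        change T.adCoeff (D := D) c _ _ (i 1) = _
        rw [map_one, h0]
      rw [rightInvDeriv_mul]
      change rightInvDeriv (a X) _ 1 * _ + _ * rightInvDeriv (a X) _ 1 = _
      rw [h5, h6, h7]
      ring
    rw [Finset.sum_congr rfl fun m _ => h3 m, Finset.sum_neg_distrib, T.sum_bilin e,
      pair_br_inl_inr_fst]
  have h3 : ∀ k l, rightInvDeriv (a X) (leftInvDeriv (a (e k)) φ * leftInvDeriv (a (e l)) ψ
      * T.dressingCoeff c i hi e k l) 1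
      = -(leftInvDeriv (a (e k)) φ 1 * leftInvDeriv (a (e l)) ψ 1
        * T.pair (T.br₂ (T.dualVec e k) (T.dualVec e l)) X) := by
    intro k l
    rw [rightInvDeriv_mul]
    change _ * T.dressingCoeff c i hi e k l 1
      + leftInvDeriv (a (e k)) φ 1 * leftInvDeriv (a (e l)) ψ 1
        * rightInvDeriv (a X) (T.dressingCoeff c i hi e k l) 1 = _
    rw [h1, h2]
    ring
  rw [← rightInvDeriv_one, dressingBracket_def]
  simp only [map_sum, coe_sum, h3, Finset.sum_neg_distrib]
  rw [← T.sum_leftInvDeriv_smul_dualVec a e φ, ← T.sum_leftInvDeriv_smul_dualVec a e ψ,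
    pair_br₂_sum]

end ManinTriple

end DressingBracket

section PoissonLieGroup

variable {V₁ V₂ : Type*} [AddCommGroup V₁] [Module ℝ V₁] [AddCommGroup V₂] [Module ℝ V₂]
  (T : ManinTriple V₁ V₂)
  {E₁ : Type*} [NormedAddCommGroup E₁] [NormedSpace ℝ E₁] [FiniteDimensional ℝ E₁]
  {G : Type*} [TopologicalSpace G] [ChartedSpace E₁ G] [Group G] [LieGroup 𝓘(ℝ, E₁) ∞ G]
  [PreconnectedSpace G]
  {E : Type*} [NormedAddCommGroup E] [NormedSpace ℝ E] [FiniteDimensional ℝ E]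
  {D : Type*} [TopologicalSpace D] [ChartedSpace E D] [Group D] [LieGroup 𝓘(ℝ, E) ∞ D]
  [PreconnectedSpace D]
  (a : V₁ ≃ₗ[ℝ] E₁) (c : (V₁ × V₂) ≃ₗ[ℝ] E)
  {ι : Type*} [Fintype ι] (e : Module.Basis ι ℝ V₁)

omit [FiniteDimensional ℝ E] in
theorem PoissonStructure.skew {M : Type*} [TopologicalSpace M] [ChartedSpace E M]
    (P : PoissonStructure E M) (φ ψ : C^∞⟮𝓘(ℝ, E), M; ℝ⟯) :
    P.bracket φ ψ = -P.bracket ψ φ := by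
  have h1 := P.bracket_self (φ + ψ)
  simp only [map_add, LinearMap.add_apply, P.bracket_self, zero_add, add_zero] at h1
  exact eq_neg_of_add_eq_zero_right h1

theorem PoissonStructure.leibniz_left {M : Type*} [TopologicalSpace M] [ChartedSpace E M]
    (P : PoissonStructure E M) (φ ψ χ : C^∞⟮𝓘(ℝ, E), M; ℝ⟯) :
    P.bracket (φ * ψ) χ = P.bracket φ χ * ψ + φ * P.bracket ψ χ := by
  rw [P.skew, P.leibniz, P.skew χ φ, P.skew χ ψ]
  ring

/-- The Poisson Lie structure with the given linearization is minus the bracket induced by the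
action of the double. -/
theorem bracket_eq_neg_dressingBracket
    (hc : ∀ p q, c (T.br p q) = modelBracket D (c p) (c q))
    (i : G →* D) (hi : ContMDiff 𝓘(ℝ, E₁) 𝓘(ℝ, E) ∞ i)
    (hia : ∀ X, mder E₁ E i 1 (a X) = c (X, 0))
    (P : PoissonStructure E₁ G) (hP : IsPoissonLieGroup P)
    (hlin : ∀ φ ψ X, mder E₁ ℝ (P.bracket φ ψ) 1 (a X)
      = T.pair (T.br₂ (T.leftVec a φ 1) (T.leftVec a ψ 1)) X)
    (φ ψ : C^∞⟮𝓘(ℝ, E₁), G; ℝ⟯) :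
    P.bracket φ ψ = -T.dressingBracket a c i hi e φ ψ := by
  have h := multiplicative_biderivation_eq_zero (P.bracket + T.dressingBracket a c i hi e)
    (fun φ ψ χ => by
      simp only [LinearMap.add_apply, P.leibniz_left, T.dressingBracket_mul_left]
      ring)
    (fun φ ψ χ => by
      simp only [LinearMap.add_apply, P.leibniz, T.dressingBracket_mul_right]
      ring)
    (fun φ ψ g z => by
      have h1 : P.bracket φ ψ (g * z) = P.bracket (translate z φ) (translate z ψ) g
          + P.bracket (leftTranslate g φ) (leftTranslate g ψ) z := (hP φ ψ (g, z)).symm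
      change P.bracket φ ψ (g * z) + T.dressingBracket a c i hi e φ ψ (g * z)
        = (P.bracket (translate z φ) (translate z ψ) g
          + T.dressingBracket a c i hi e (translate z φ) (translate z ψ) g)
        + (P.bracket (leftTranslate g φ) (leftTranslate g ψ) z
          + T.dressingBracket a c i hi e (leftTranslate g φ) (leftTranslate g ψ) z)
      rw [h1, T.dressingBracket_multiplicative a c hc i hi hia]
      ring)
    (fun φ ψ => by
      ext v
      obtain ⟨X, rfl⟩ := a.surjective v
      have h1 : mder E₁ ℝ ((P.bracket + T.dressingBracket a c i hi e) φ ψ) 1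
          = mder E₁ ℝ (P.bracket φ ψ) 1 + mder E₁ ℝ (T.dressingBracket a c i hi e φ ψ) 1 :=
        mder_add (smooth_mdiffAt (P.bracket φ ψ).contMDiff 1)
          (smooth_mdiffAt (T.dressingBracket a c i hi e φ ψ).contMDiff 1)
      rw [h1]
      change mder E₁ ℝ (P.bracket φ ψ) 1 (a X)
        + mder E₁ ℝ (T.dressingBracket a c i hi e φ ψ) 1 (a X) = 0
      rw [hlin, T.mder_dressingBracket_one a c hc i hi hia, add_neg_cancel]) φ ψ
  exact eq_neg_of_add_eq_zero_left h

end PoissonLieGroup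

/-! ### Reduced structures restricted to the subgroup -/

section OpenSubmanifold

variable {E : Type*} [NormedAddCommGroup E] [NormedSpace ℝ E] [FiniteDimensional ℝ E]
  {M : Type*} [TopologicalSpace M] [ChartedSpace E M] [IsManifold 𝓘(ℝ, E) ∞ M] [T2Space M]
  {F : Type*} [NormedAddCommGroup F] [NormedSpace ℝ F] [FiniteDimensional ℝ F]
  {N : Type*} [TopologicalSpace N] [ChartedSpace F N] [IsManifold 𝓘(ℝ, F) ∞ N] [T2Space N]

/-- A Poisson structure on an open submanifold is determined by the ambient one, since functions on
the ambient manifold realize all differentials. -/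
theorem IsPoissonMap.eq_of_local_sections {f : N → M} (hinj : Function.Injective f)
    (h : ∀ x, ∃ s : M → N, ContMDiffAt 𝓘(ℝ, E) 𝓘(ℝ, F) ∞ s (f x) ∧ s (f x) = x ∧
      ∀ᶠ y in 𝓝 (f x), f (s y) = y)
    {P P' : PoissonStructure F N} {B : RawBracket E M} (hP : IsPoissonMap P.raw B f)
    (hP' : IsPoissonMap P'.raw B f) : P = P' := by
  obtain ⟨hf, hP⟩ := hP
  obtain ⟨_, hP'⟩ := hP'
  refine PoissonStructure.ext (LinearMap.ext fun φ => LinearMap.ext fun ψ => ?_)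
  ext x
  obtain ⟨s, hs, hsx, hs'⟩ := h x
  have hs1 : MDifferentiableAt 𝓘(ℝ, E) 𝓘(ℝ, F) s (f x) := hs.mdifferentiableAt (by simp)
  have hleft : ∀ v, mder E F s (f x) (mder F E f x v) = v := by
    intro v
    rw [← mder_comp hs1 (smooth_mdiffAt hf x)]
    have h1 : s ∘ f =ᶠ[𝓝 x] fun y => y := by
      filter_upwards [hf.continuous.continuousAt.eventually hs'] with y hy
      exact hinj hy
    rw [mder_congr h1, mder_id]
  have hext : ∀ φ : C^∞⟮𝓘(ℝ, F), N; ℝ⟯, ∃ Φ : C^∞⟮𝓘(ℝ, E), M; ℝ⟯,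
      mder F ℝ φ x = mder F ℝ (Φ.comp ⟨f, hf⟩) x := by
    intro φ
    obtain ⟨Φ, hΦ⟩ := exists_mder_eq (f x) ((mder F ℝ φ x).comp (mder E F s (f x)))
    refine ⟨Φ, ?_⟩
    ext v
    have h1 := mder_comp (g := Φ) (f := f) (x := x) (smooth_mdiffAt Φ.contMDiff _)
      (smooth_mdiffAt hf x) v
    rw [hΦ, ContinuousLinearMap.comp_apply, hleft] at h1
    exact h1.symm
  obtain ⟨Φ, hΦ⟩ := hext φ
  obtain ⟨Ψ, hΨ⟩ := hext ψ
  rw [biderivation_congr P.bracket P.leibniz_left P.leibniz hΦ hΨ,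
    biderivation_congr P'.bracket P'.leibniz_left P'.leibniz hΦ hΨ]
  exact (hP Φ Ψ x).trans (hP' Φ Ψ x).symm

end OpenSubmanifold

section Main

variable {V₁ V₂ : Type*} [AddCommGroup V₁] [Module ℝ V₁] [FiniteDimensional ℝ V₁]
  [AddCommGroup V₂] [Module ℝ V₂]
  (T : ManinTriple V₁ V₂)
  {E₁ : Type*} [NormedAddCommGroup E₁] [NormedSpace ℝ E₁] [FiniteDimensional ℝ E₁]
  {G : Type*} [TopologicalSpace G] [ChartedSpace E₁ G] [Group G] [LieGroup 𝓘(ℝ, E₁) ∞ G]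
  [PreconnectedSpace G]
  {E₂ : Type*} [NormedAddCommGroup E₂] [NormedSpace ℝ E₂] [FiniteDimensional ℝ E₂]
  {K : Type*} [TopologicalSpace K] [ChartedSpace E₂ K] [Group K] [LieGroup 𝓘(ℝ, E₂) ∞ K]
  {E : Type*} [NormedAddCommGroup E] [NormedSpace ℝ E] [FiniteDimensional ℝ E]
  {D : Type*} [TopologicalSpace D] [ChartedSpace E D] [Group D] [LieGroup 𝓘(ℝ, E) ∞ D]
  [PreconnectedSpace D]
  (a : V₁ ≃ₗ[ℝ] E₁) (b : V₂ ≃ₗ[ℝ] E₂) (c : (V₁ × V₂) ≃ₗ[ℝ] E)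
  (hc : ∀ p q, c (T.br p q) = modelBracket D (c p) (c q))
  (i : G →* D) (hi : ContMDiff 𝓘(ℝ, E₁) 𝓘(ℝ, E) ∞ i)
  (hia : ∀ X, mder E₁ E i 1 (a X) = c (X, 0))
  (j : K →* D) (hj : ContMDiff 𝓘(ℝ, E₂) 𝓘(ℝ, E) ∞ j)
  (hjb : ∀ f, mder E₂ E j 1 (b f) = c (0, f))
  {F : Type*} [NormedAddCommGroup F] [NormedSpace ℝ F] [FiniteDimensional ℝ F]
  [ChartedSpace F (D ⧸ j.range)] [IsManifold 𝓘(ℝ, F) ∞ (D ⧸ j.range)]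
  (hsub : Manifold.IsSubmersion 𝓘(ℝ, E) 𝓘(ℝ, F) ∞ (QuotientGroup.mk : D → D ⧸ j.range))

/-- The bracket `β` on `D` agrees with `ε * ⟨p₁, q₂⟩` on pairs of functions whose right differentials
are represented by `p`, `q`, as soon as the left differentials are represented by elements of `V₂`.
This is the only property of the bracket `{ , }₊` that matters for the reduction. -/
def IsReducibleBracket (β : RawBracket E D) (ε : ℝ) : Prop :=
  ∀ φ ψ x p q f h, (∀ r, rightForm c φ x r = T.bilin p r) → (∀ r, rightForm c ψ x r = T.bilin q r) →
    (∀ r, leftForm c φ x r = T.bilin (0, f) r) → (∀ r, leftForm c ψ x r = T.bilin (0, h) r) →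
    T.bilin p q = 0 → β φ ψ x = ε * T.pair q.2 p.1

variable {T c} {β : RawBracket E D} {ε : ℝ} (hβ : IsReducibleBracket T c β ε)

omit [FiniteDimensional ℝ V₁] [FiniteDimensional ℝ E₂] [LieGroup 𝓘(ℝ, E₂) ∞ K] in
include hc hj hjb hβ in
theorem IsReducibleBracket.apply_pullMk (Φ Ψ : C^∞⟮𝓘(ℝ, F), D ⧸ j.range; ℝ⟯) (x : D) :
    β (pullMk hsub.contMDiff Φ) (pullMk hsub.contMDiff Ψ) x = ε * T.pair
      (adjointOn c x (0, T.pair.symm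
        (leftForm c (pullMk hsub.contMDiff Ψ) x ∘ₗ LinearMap.inl ℝ V₁ V₂))).2
      (adjointOn c x (0, T.pair.symm
        (leftForm c (pullMk hsub.contMDiff Φ) x ∘ₗ LinearMap.inl ℝ V₁ V₂))).1 := by
  have h := leftForm_pullMk_inr c b j hj hjb hsub
  refine hβ _ _ x _ _ _ _ (T.rightForm_eq_of_isotropic c hc (h Φ x))
    (T.rightForm_eq_of_isotropic c hc (h Ψ x)) (T.leftForm_eq_of_isotropic c (h Φ x))
    (T.leftForm_eq_of_isotropic c (h Ψ x)) ?_
  rw [T.bilin_adjointOn c hc, T.bilin_apply]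
  simp only [map_zero, add_zero]

include hc hj hjb hsub hβ in
theorem IsReducibleBracket.existsUnique :
    ∃! P : PoissonStructure F (D ⧸ j.range), IsPoissonMap β P.raw QuotientGroup.mk := by
  let e := Module.finBasis ℝ V₁
  have h : IsPoissonMap β (quotientPoisson T c hc b j hj hjb hsub e ε).raw QuotientGroup.mk := by
    refine ⟨hsub.contMDiff, fun Φ Ψ x => ?_⟩
    refine (hβ.apply_pullMk b hc j hj hjb hsub Φ Ψ x).trans ?_
    exact congrArg (ε * ·) (biDer_quotientDeriv_mk T c hc b j hj hjb hsub e Φ Ψ x).symm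
  exact ⟨_, h, fun P hP => IsPoissonMap.eq_of_surjective QuotientGroup.mk_surjective hP h⟩

include hc hi hia hj hjb hβ hsub in
/-- The reduced Poisson structure restricts on `G` to a multiple of the Poisson Lie structure. -/
theorem IsReducibleBracket.isOpenPoissonSubmanifold
    (hij : Function.Injective (fun p : G × K => i p.1 * j p.2))
    (PG : PoissonStructure E₁ G) (hPG : IsPoissonLieGroup PG)
    (hlin : ∀ φ ψ X, mder E₁ ℝ (PG.bracket φ ψ) 1 (a X)
      = T.pair (T.br₂ (T.leftVec a φ 1) (T.leftVec a ψ 1)) X)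
    {P : PoissonStructure F (D ⧸ j.range)} (hP : IsPoissonMap β P.raw QuotientGroup.mk)
    {P' : PoissonStructure E₁ G} (hP' : ∀ φ ψ, P'.bracket φ ψ = -ε • PG.bracket φ ψ) :
    IsOpenPoissonSubmanifold P' P (fun g : G => (QuotientGroup.mk (i g) : D ⧸ j.range)) ∧
      ∀ P'' : PoissonStructure E₁ G,
        IsPoissonMap P''.raw P.raw (fun g : G => (QuotientGroup.mk (i g) : D ⧸ j.range)) →
          P'' = P' := by
  have := t2Space_of_lieGroup (E := E₁) (D := G)
  have := t2Space_quotient (E := E) (F := F) j.range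
  let e := Module.finBasis ℝ V₁
  have hinj := injective_mk_comp i j hij
  have hsm : ContMDiff 𝓘(ℝ, E₁) 𝓘(ℝ, F) ∞ (fun g : G => (QuotientGroup.mk (i g) : D ⧸ j.range)) :=
    hsub.contMDiff.comp hi
  have hsec := exists_local_section_mk_comp a b c i hi hia j hj hjb hsub
  have hpois : IsPoissonMap P'.raw P.raw
      (fun g : G => (QuotientGroup.mk (i g) : D ⧸ j.range)) := by
    refine ⟨hsm, fun Φ Ψ g => ?_⟩
    obtain ⟨_, hP⟩ := hP
    have hvec : ∀ Φ : C^∞⟮𝓘(ℝ, F), D ⧸ j.range; ℝ⟯, T.leftVec a (Φ.comp ⟨_, hsm⟩) g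
        = T.pair.symm (leftForm c (pullMk hsub.contMDiff Φ) (i g) ∘ₗ LinearMap.inl ℝ V₁ V₂) := by
      intro Φ
      refine congrArg T.pair.symm (LinearMap.ext fun X => ?_)
      have h1 := leftInvDeriv_comp i hi (a X) (pullMk hsub.contMDiff Φ) g
      rw [hia] at h1
      exact h1
    refine Eq.trans ?_ (hP Φ Ψ (i g))
    refine Eq.trans ?_ (hβ.apply_pullMk b hc j hj hjb hsub Φ Ψ (i g)).symm
    change P'.bracket _ _ g = _
    rw [hP', bracket_eq_neg_dressingBracket T a c e hc i hi hia PG hPG hlin, smul_neg, neg_smul,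
      neg_neg, ← hvec, ← hvec, ← T.dressingBracket_apply a c i hi e]
    rfl
  exact ⟨⟨isOpenEmbedding_of_local_sections hsm.continuous hinj fun g => by
      obtain ⟨s, hs, h⟩ := hsec g
      exact ⟨s, hs.continuousAt, h⟩,
    isLocalDiffeomorph_of_local_sections hsm hinj hsec, hpois⟩,
    fun P'' hP'' => IsPoissonMap.eq_of_local_sections hinj hsec hP'' hpois⟩

end Main

theorem denseRange_mk_comp {D G K : Type*} [TopologicalSpace D] [Group D] [Group G] [Group K]
    (i : G →* D) (j : K →* D) {S : Set D} (hS : Dense S) (h : ∀ x ∈ S, ∃ g u, x = i g * j u) :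
    DenseRange (fun g : G => (QuotientGroup.mk (i g) : D ⧸ j.range)) := by
  have h1 : Dense ((QuotientGroup.mk : D → D ⧸ j.range) '' S) :=
    QuotientGroup.mk_surjective.denseRange.dense_image QuotientGroup.continuous_mk hS
  refine h1.mono ?_
  rintro _ ⟨x, hx, rfl⟩
  obtain ⟨g, u, rfl⟩ := h x hx
  exact ⟨g, (QuotientGroup.mk_mul_of_mem (i g) (MonoidHom.mem_range.2 ⟨u, rfl⟩)).symm⟩

section Bialgebra

open Module

variable {L : Type*} [LieRing L] [LieAlgebra ℝ L] [FiniteDimensional ℝ L] (B : LieBialgebra L)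

theorem LieBialgebra.doubleBracket_skew (p q : L × Dual ℝ L) :
    B.doubleBracket p q = -B.doubleBracket q p := by
  have h := lie_skew p.1 q.1
  refine Prod.ext ?_ ?_
  · simp only [doubleBracket, Prod.fst_neg]
    rw [← h]
    abel
  · simp only [doubleBracket, Prod.snd_neg]
    rw [B.dualBracket_skew p.2]
    abel

/-- The Manin triple `(𝔡, 𝔤, 𝔤*)` of a Lie bialgebra. -/
def LieBialgebra.maninTriple : ManinTriple L (Dual ℝ L) where
  pair := LinearEquiv.refl ℝ _
  br := B.doubleBracket
  br₁ := fun X Y => ⁅X, Y⁆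
  br₂ := fun f h => B.dualBracket f h
  br_inl := B.doubleBracket_inl
  br_inr := B.doubleBracket_inr
  br_skew := B.doubleBracket_skew
  br_invariant := B.form_doubleBracket

/-- The Manin triple `(𝔡, 𝔤*, 𝔤)` of a Lie bialgebra, with the summands in the opposite order. -/
def LieBialgebra.maninTripleSwap : ManinTriple (Dual ℝ L) L where
  pair := evalEquiv ℝ L
  br := fun p q => (B.doubleBracket p.swap q.swap).swap
  br₁ := fun f h => B.dualBracket f h
  br₂ := fun X Y => ⁅X, Y⁆
  br_inl := fun f h => congrArg Prod.swap (B.doubleBracket_inr f h)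
  br_inr := fun X Y => congrArg Prod.swap (B.doubleBracket_inl X Y)
  br_skew := fun p q => congrArg Prod.swap (B.doubleBracket_skew p.swap q.swap)
  br_invariant := fun p q r => by
    have h := B.form_doubleBracket p.swap q.swap r.swap
    simp only [form] at h
    change r.1 (B.doubleBracket p.swap q.swap).1 + (B.doubleBracket p.swap q.swap).2 r.2
      = (B.doubleBracket q.swap r.swap).2 p.2 + p.1 (B.doubleBracket q.swap r.swap).1
    rw [add_comm]
    exact h.trans (add_comm _ _)

variable {E : Type*} [NormedAddCommGroup E] [NormedSpace ℝ E]
  {D : Type*} [TopologicalSpace D] [ChartedSpace E D] [Group D]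
  (c : (L × Dual ℝ L) ≃ₗ[ℝ] E)

theorem leftGrad_eq {φ : C^∞⟮𝓘(ℝ, E), D; ℝ⟯} {x : D} {p : L × Dual ℝ L}
    (h : ∀ r, rightForm c φ x r = form p r) : leftGrad (D := D) (E := E) c φ x = p :=
  form_nondegenerate fun r => (form_grad _ r).trans (h r)

theorem rightGrad_eq {φ : C^∞⟮𝓘(ℝ, E), D; ℝ⟯} {x : D} {p : L × Dual ℝ L}
    (h : ∀ r, leftForm c φ x r = form p r) : rightGrad (D := D) (E := E) c φ x = p :=
  form_nondegenerate fun r => (form_grad _ r).trans (h r)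

theorem plusBracket_apply (φ ψ : C^∞⟮𝓘(ℝ, E), D; ℝ⟯) (x : D) :
    plusBracket (D := D) (E := E) c φ ψ x
      = 1 / 2 * form (rOp (leftGrad (D := D) (E := E) c φ x)) (leftGrad (D := D) (E := E) c ψ x)
        + 1 / 2 * form (rOp (rightGrad (D := D) (E := E) c φ x))
          (rightGrad (D := D) (E := E) c ψ x) := rfl

theorem isReducibleBracket_plusBracket : IsReducibleBracket B.maninTriple c
    (plusBracket (D := D) (E := E) c) 1 := by
  intro φ ψ x p q f h h1 h2 h3 h4 h5
  rw [plusBracket_apply, leftGrad_eq c h1, leftGrad_eq c h2, rightGrad_eq c (p := (0, f)) h3,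
    rightGrad_eq c (p := (0, h)) h4]
  have h6 : p.2 q.1 + q.2 p.1 = 0 := h5
  change _ = 1 * q.2 p.1
  simp only [form, rOp, map_zero, LinearMap.neg_apply]
  linear_combination (-1 / 2) * h6

theorem isReducibleBracket_plusBracket_swap : IsReducibleBracket B.maninTripleSwap
    ((LinearEquiv.prodComm ℝ (Dual ℝ L) L).trans c) (plusBracket (D := D) (E := E) c) (-1) := by
  have hform : ∀ p r : L × Dual ℝ L, B.maninTripleSwap.bilin p.swap r.swap = form p r :=
    fun p r => add_comm _ _
  intro φ ψ x p q f h h1 h2 h3 h4 h5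
  rw [plusBracket_apply, leftGrad_eq c (p := p.swap) fun r => (h1 r.swap).trans (hform p.swap r),
    leftGrad_eq c (p := q.swap) fun r => (h2 r.swap).trans (hform q.swap r),
    rightGrad_eq c (p := (f, 0)) fun r => (h3 r.swap).trans (hform (f, 0) r),
    rightGrad_eq c (p := (h, 0)) fun r => (h4 r.swap).trans (hform (h, 0) r)]
  have h6 : q.1 p.2 + p.1 q.2 = 0 := h5
  change _ = -1 * p.1 q.2
  simp only [form, rOp, LinearMap.neg_apply, LinearMap.zero_apply, Prod.fst_swap, Prod.snd_swap,
    neg_zero]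
  linear_combination (1 / 2) * h6

end Bialgebra

/-- The Poisson structure with the opposite bracket. -/
def PoissonStructure.opposite {E M : Type*} [NormedAddCommGroup E] [NormedSpace ℝ E]
    [TopologicalSpace M] [ChartedSpace E M] (P : PoissonStructure E M) : PoissonStructure E M where
  bracket := -P.bracket
  bracket_self φ := by simp [P.bracket_self]
  leibniz φ ψ χ := by
    simp only [LinearMap.neg_apply, P.leibniz]
    ring
  jacobi φ ψ χ := by
    simp only [LinearMap.neg_apply, map_neg, neg_neg, P.jacobi]

end PoissonLie

end

/-! ### Both quotients of the double -/

theorem theorem2p2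
    -- the Lie bialgebra `(𝔤, 𝔤*)`
    {L : Type*} [LieRing L] [LieAlgebra ℝ L] [FiniteDimensional ℝ L]
    (B : PoissonLie.LieBialgebra L)
    -- the groups `G`, `G*` (written `K`) and `D`, with Lie algebras `𝔤`, `𝔤*` and `𝔤 ⊕ 𝔤*`
    {EG : Type*} [NormedAddCommGroup EG] [NormedSpace ℝ EG] [FiniteDimensional ℝ EG]
    {G : Type*} [TopologicalSpace G] [ChartedSpace EG G] [Group G]
    [LieGroup 𝓘(ℝ, EG) ∞ G] [ConnectedSpace G]
    {EK : Type*} [NormedAddCommGroup EK] [NormedSpace ℝ EK] [FiniteDimensional ℝ EK]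
    {K : Type*} [TopologicalSpace K] [ChartedSpace EK K] [Group K]
    [LieGroup 𝓘(ℝ, EK) ∞ K] [ConnectedSpace K]
    {ED : Type*} [NormedAddCommGroup ED] [NormedSpace ℝ ED] [FiniteDimensional ℝ ED]
    {D : Type*} [TopologicalSpace D] [ChartedSpace ED D] [Group D]
    [LieGroup 𝓘(ℝ, ED) ∞ D] [ConnectedSpace D]
    (a : L ≃ₗ[ℝ] TangentSpace 𝓘(ℝ, EG) (1 : G))
    (ha : PoissonLie.IsLieAlgebraOf (fun X Y : L => ⁅X, Y⁆) a)
    (b : Module.Dual ℝ L ≃ₗ[ℝ] TangentSpace 𝓘(ℝ, EK) (1 : K))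
    (hb : PoissonLie.IsLieAlgebraOf (fun f h => B.dualBracket f h) b)
    (c : (L × Module.Dual ℝ L) ≃ₗ[ℝ] TangentSpace 𝓘(ℝ, ED) (1 : D))
    (hc : PoissonLie.IsLieAlgebraOf B.doubleBracket c)
    -- the Poisson Lie structures of `G` and `G*`, with tangent Lie bialgebras `(𝔤, 𝔤*)`, `(𝔤*, 𝔤)`
    (PG : PoissonLie.PoissonStructure EG G) (hPG : PoissonLie.IsPoissonLieGroup PG)
    (hPG' : PoissonLie.HasLinearization a (fun f h => B.dualBracket f h) PG)
    (PK : PoissonLie.PoissonStructure EK K) (hPK : PoissonLie.IsPoissonLieGroup PK)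
    (hPK' : PoissonLie.HasLinearization b PoissonLie.LieBialgebra.bidualBracket PK)
    -- `G` and `G*` are subgroups of `D`, and factorization is unique
    (i : G →* D) (hi : ContMDiff 𝓘(ℝ, EG) 𝓘(ℝ, ED) ∞ i)
    (hia : ∀ X : L, (mfderiv 𝓘(ℝ, EG) 𝓘(ℝ, ED) i 1 (a X) : ED) = c (X, 0))
    (j : K →* D) (hj : ContMDiff 𝓘(ℝ, EK) 𝓘(ℝ, ED) ∞ j)
    (hjb : ∀ f : Module.Dual ℝ L, (mfderiv 𝓘(ℝ, EK) 𝓘(ℝ, ED) j 1 (b f) : ED) = c (0, f))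
    (hij : Function.Injective (fun p : G × K => i p.1 * j p.2))
    {F₁ : Type*} [NormedAddCommGroup F₁] [NormedSpace ℝ F₁] [FiniteDimensional ℝ F₁]
    {F₂ : Type*} [NormedAddCommGroup F₂] [NormedSpace ℝ F₂] [FiniteDimensional ℝ F₂] :
    -- (i) the quotient `D / G*` being a smooth manifold
    (∀ [ChartedSpace F₁ (D ⧸ j.range)] [IsManifold 𝓘(ℝ, F₁) ∞ (D ⧸ j.range)],
      Manifold.IsSubmersion 𝓘(ℝ, ED) 𝓘(ℝ, F₁) ∞ (QuotientGroup.mk : D → D ⧸ j.range) →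
      (Dense (PoissonLie.factorizable i j) →
        DenseRange (fun g : G => (QuotientGroup.mk (i g) : D ⧸ j.range))) ∧
      (∃! P : PoissonLie.PoissonStructure F₁ (D ⧸ j.range), PoissonLie.IsReducedStructure c P) ∧
      ∀ P : PoissonLie.PoissonStructure F₁ (D ⧸ j.range), PoissonLie.IsReducedStructure c P →
        ∃ P' : PoissonLie.PoissonStructure EG G,
          PoissonLie.IsOpenPoissonSubmanifold P' P
            (fun g : G => (QuotientGroup.mk (i g) : D ⧸ j.range)) ∧
          (∀ P'' : PoissonLie.PoissonStructure EG G,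
            PoissonLie.IsPoissonMap P''.raw P.raw
              (fun g : G => (QuotientGroup.mk (i g) : D ⧸ j.range)) → P'' = P') ∧
          ∀ φ ψ, P'.bracket φ ψ = -PG.bracket φ ψ) ∧
    -- (ii) the quotient `D / G` being a smooth manifold
    (∀ [ChartedSpace F₂ (D ⧸ i.range)] [IsManifold 𝓘(ℝ, F₂) ∞ (D ⧸ i.range)],
      Manifold.IsSubmersion 𝓘(ℝ, ED) 𝓘(ℝ, F₂) ∞ (QuotientGroup.mk : D → D ⧸ i.range) →
      (Dense (PoissonLie.factorizable i j) →
        DenseRange (fun u : K => (QuotientGroup.mk (j u) : D ⧸ i.range))) ∧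
      (∃! P : PoissonLie.PoissonStructure F₂ (D ⧸ i.range), PoissonLie.IsReducedStructure c P) ∧
      ∀ P : PoissonLie.PoissonStructure F₂ (D ⧸ i.range), PoissonLie.IsReducedStructure c P →
        ∃ P' : PoissonLie.PoissonStructure EK K,
          PoissonLie.IsOpenPoissonSubmanifold P' P
            (fun u : K => (QuotientGroup.mk (j u) : D ⧸ i.range)) ∧
          (∀ P'' : PoissonLie.PoissonStructure EK K,
            PoissonLie.IsPoissonMap P''.raw P.raw
              (fun u : K => (QuotientGroup.mk (j u) : D ⧸ i.range)) → P'' = P') ∧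
          P' = PK) := by
  -- the tangent spaces at the identity are the model spaces
  let a' : L ≃ₗ[ℝ] EG := a
  let b' : Module.Dual ℝ L ≃ₗ[ℝ] EK := b
  let c' : (L × Module.Dual ℝ L) ≃ₗ[ℝ] ED := c
  have hia' : ∀ X, PoissonLie.mder EG ED i 1 (a' X) = c' (X, 0) := hia
  have hjb' : ∀ f, PoissonLie.mder EK ED j 1 (b' f) = c' (0, f) := hjb
  have hc' : ∀ p q, c' (B.doubleBracket p q) = PoissonLie.modelBracket D (c' p) (c' q) := hc
  refine ⟨?_, ?_⟩
  · intro _ _ hsub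
    have hred := PoissonLie.isReducibleBracket_plusBracket (D := D) (E := ED) B c'
    refine ⟨fun hd => PoissonLie.denseRange_mk_comp i j hd fun x hx => ?_,
      hred.existsUnique (b := b') hc' j hj hjb' hsub, fun P hP => ⟨PG.opposite, ?_⟩⟩
    · obtain ⟨⟨p, hp, -⟩, -⟩ := hx
      exact ⟨p.1, p.2, hp⟩
    · have hlin : ∀ φ ψ (X : L), PoissonLie.mder EG ℝ (PG.bracket φ ψ) 1 (a' X)
          = B.maninTriple.pair (B.maninTriple.br₂ (B.maninTriple.leftVec a' φ 1)
            (B.maninTriple.leftVec a' ψ 1)) X := by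
        have hvec : ∀ φ : C^∞⟮𝓘(ℝ, EG), G; ℝ⟯,
            B.maninTriple.leftVec a' φ 1 = PoissonLie.diffOne a φ := fun φ =>
          LinearMap.ext fun X => PoissonLie.leftInvDeriv_one (a' X) φ
        intro φ ψ X
        rw [hvec, hvec]
        exact LinearMap.congr_fun (hPG' φ ψ) X
      have h := hred.isOpenPoissonSubmanifold (a := a') (b := b') hc' i hi hia' j hj hjb' hsub hij PG
        hPG hlin hP (P' := PG.opposite) fun φ ψ => by
          rw [neg_one_smul]
          rfl
      exact ⟨h.1, h.2, fun φ ψ => rfl⟩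
  · intro _ _ hsub
    have hred := PoissonLie.isReducibleBracket_plusBracket_swap (D := D) (E := ED) B c'
    -- the factorizations in the opposite order are obtained by inversion
    have hji : Function.Injective (fun p : K × G => j p.1 * i p.2) := by
      rintro ⟨u, g⟩ ⟨u', g'⟩ h
      have h1 : (g⁻¹, u⁻¹) = (g'⁻¹, u'⁻¹) := hij (by
        have h2 := congrArg (fun x : D => x⁻¹) h
        simpa using h2)
      simpa [and_comm] using h1
    have hcs : ∀ p q, (LinearEquiv.prodComm ℝ (Module.Dual ℝ L) L).trans c'
        (B.maninTripleSwap.br p q) = PoissonLie.modelBracket D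
          ((LinearEquiv.prodComm ℝ (Module.Dual ℝ L) L).trans c' p)
          ((LinearEquiv.prodComm ℝ (Module.Dual ℝ L) L).trans c' q) := fun p q =>
      hc' p.swap q.swap
    refine ⟨fun hd => PoissonLie.denseRange_mk_comp j i hd fun x hx => ?_,
      hred.existsUnique (b := a') hcs i hi hia' hsub, fun P hP => ⟨PK, ?_⟩⟩
    · obtain ⟨-, ⟨p, hp, -⟩⟩ := hx
      exact ⟨p.2, p.1, hp⟩
    · have hlin : ∀ φ ψ (f : Module.Dual ℝ L), PoissonLie.mder EK ℝ (PK.bracket φ ψ) 1 (b' f)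
          = B.maninTripleSwap.pair (B.maninTripleSwap.br₂
            (B.maninTripleSwap.leftVec b' φ 1)
            (B.maninTripleSwap.leftVec b' ψ 1)) f := by
        have hvec : ∀ φ : C^∞⟮𝓘(ℝ, EK), K; ℝ⟯, B.maninTripleSwap.leftVec b' φ 1
            = (Module.evalEquiv ℝ L).symm (PoissonLie.diffOne b φ) := fun φ =>
          congrArg (Module.evalEquiv ℝ L).symm
            (LinearMap.ext fun f => PoissonLie.leftInvDeriv_one (b' f) φ)
        intro φ ψ f
        rw [hvec, hvec]
        exact LinearMap.congr_fun (hPK' φ ψ) f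
      have h := hred.isOpenPoissonSubmanifold (a := b') (b := a') hcs j hj hjb' i hi hia' hsub hji PK
        hPK hlin hP (P' := PK) fun φ ψ => by rw [neg_neg, one_smul]
      exact ⟨h.1, h.2, rfl⟩
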